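/- Let $k\ge 0$ and let $M$ be a smooth Riemannian manifold of dimension $8k+4$, with Levi-Civita connection $\nabla^{TM}$ of curvature $R$, extended to $T_{\mathbf C}M=TM\otimes\mathbf C$. Put $$\widehat A(TM)=\det{}^{1/2}\!\left(\frac{\frac{\sqrt{-1}}{4\pi}R}{\sinh(\frac{\sqrt{-1}}{4\pi}R)}\right),\qquad \widehat L(TM)=\det{}^{1/2}\!\left(\frac{\frac{\sqrt{-1}}{2\pi}R}{\tanh(\frac{\sqrt{-1}}{4\pi}R)}\right)$$ (square roots with positive constant term), let $\mathrm{ch}(E)=\mathrm{tr}\,\exp(\frac{\sqrt{-1}}{2\pi}R^E)$ be the Chern character form of a complex vector bundle $E$ with connection of curvature $R^E$, extended linearly to virtual bundles, and let $\{\cdot\}^{(8k+4)}$ denote the component of degree $8k+4$. For $N=8k+4$ and $\widetilde{T_{\mathbf C}M}=T_{\mathbf C}M-\mathbf C^{N}$ write $$\bigotimes_{n\ge1}S_{q^n}(\widetilde{T_{\mathbf C}M})\otimes\bigotimes_{m\ge1}\Lambda_{-q^{m-1/2}}(\widetilde{T_{\mathbf C}M})=\sum_{j\ge0}B_j(T_{\mathbf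 C}M)\,q^{j/2},$$ where $\Lambda_t(E)=\sum_p t^p\Lambda^pE$, $S_t(E)=\sum_p t^pS^pE$, $\Lambda_t(E-F)=\Lambda_t(E)/\Lambda_t(F)$, $S_t(E-F)=S_t(E)/S_t(F)$; the virtual bundles $B_j(T_{\mathbf C}M)$ carry the connections induced by $\nabla^{TM}$. Let $$\theta_1=2q^{1/8}\prod_{j\ge1}(1-q^j)(1+q^j)^2,\quad \theta_3=\prod_{j\ge1}(1-q^j)(1+q^{j-1/2})^2,$$ $$\delta_2=-\tfrac18(\theta_1^4+\theta_3^4),\qquad \varepsilon_2=\tfrac1{16}\theta_1^4\theta_3^4 ,$$ so that $8\delta_2=-1-24q^{1/2}-\cdots$ and $\varepsilon_2=q^{1/2}+8q+\cdots$ have integral coefficients. Define $b_0(T_{\mathbf C}M),\dots,b_k(T_{\mathbf C}M)$ recursively by comparing the coefficients of $q^{0},q^{1/2},\dots,q^{k/2}$ in $$\sum_{j}B_j(T_{\mathbf C}M)q^{j/2}\equiv\sum_{r=0}^{k}b_r(T_{\mathbf C}M)\,(8\delta_2)^{2k+1-2r}\varepsilon_2^{\,r}\pmod{q^{(k+1)/2}};$$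 thus $b_r(T_{\mathbf C}M)$ is a combination of the $B_j(T_{\mathbf C}M)$, $0\le j\le r$, with integral coefficients depending only on $k,r,j$. Put $h_r(T_{\mathbf C}M)=\{\widehat A(TM)\,\mathrm{ch}(b_r(T_{\mathbf C}M))\}^{(8k+4)}$. Then $$\left\{\widehat L(TM)\,\mathrm{ch}(T_{\mathbf C}M)-16\,\widehat L(TM)\right\}^{(8k+4)}=2^{14}\sum_{r=0}^{k-1}(k-r)\,2^{6(k-r-1)}\,h_r(T_{\mathbf C}M),$$ the right-hand side being $0$ for $k=0$. In particular, the left-hand side equals $0$ if $\dim M=4$; it equals $-2^{14}\{\widehat A(TM)\}^{(12)}$ if $\dim M=12$; and it equals $2^{14}\{\widehat A(TM)\,\mathrm{ch}(T_{\mathbf C}M)-28\,\widehat A(TM)\}^{(20)}$ if $\dim M=20$. -/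

import Mathlib

open scoped Manifold ContDiff

noncomputable section

namespace TwistedAnomaly

/-! ### Complex-valued differential forms at a point

For a complex vector space `W` (below: the complex-valued covectors at a point), the forms at the
point are the elements of `ExteriorAlgebra ℂ W`; the forms of even degree make up the commutative
subalgebra generated by the products of two covectors. -/

section Forms

variable (W : Type*) [AddCommGroup W] [Module ℂ W]

/-- The products of two covectors. -/
def wedgePairs : Set (ExteriorAlgebra ℂ W) :=
  {w | ∃ u v : W, w = ExteriorAlgebra.ι ℂ u * ExteriorAlgebra.ι ℂ v}

variable {W}

theorem wedgePairs_comm (a : ExteriorAlgebra ℂ W) (ha : a ∈ wedgePairs W)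
    (b : ExteriorAlgebra ℂ W) (hb : b ∈ wedgePairs W) : a * b = b * a := by
  obtain ⟨u, v, rfl⟩ := ha
  obtain ⟨s, t, rfl⟩ := hb
  have anti : ∀ x y : W, ExteriorAlgebra.ι ℂ x * ExteriorAlgebra.ι ℂ y =
      -(ExteriorAlgebra.ι ℂ y * ExteriorAlgebra.ι ℂ x) := fun x y =>
    eq_neg_of_add_eq_zero_left (ExteriorAlgebra.ι_add_mul_swap x y)
  have slide : ∀ x y z : W, ExteriorAlgebra.ι ℂ x * ExteriorAlgebra.ι ℂ y * ExteriorAlgebra.ι ℂ z =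
      ExteriorAlgebra.ι ℂ z * (ExteriorAlgebra.ι ℂ x * ExteriorAlgebra.ι ℂ y) := fun x y z => by
    rw [mul_assoc, anti y z, mul_neg, ← mul_assoc, anti x z, neg_mul, neg_neg, mul_assoc]
  rw [← mul_assoc, slide, mul_assoc, slide, ← mul_assoc]

variable (W)

/-- The commutative algebra of forms of even degree. -/
abbrev EvenForms : Type _ := Algebra.adjoin ℂ (wedgePairs W)

instance : IsMulCommutative (Algebra.adjoin ℂ (wedgePairs W)) :=
  Algebra.isMulCommutative_adjoin ℂ wedgePairs_comm

open scoped IsMulCommutative in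
instance : CommRing (EvenForms W) := inferInstance

/-- The inclusion of the even forms in all forms. -/
def EvenForms.incl : EvenForms W →ₐ[ℂ] ExteriorAlgebra ℂ W :=
  (Algebra.adjoin ℂ (wedgePairs W)).val

variable {W}

/-- The 2-form `u ∧ v`. -/
def wedge (u v : W) : EvenForms W :=
  ⟨ExteriorAlgebra.ι ℂ u * ExteriorAlgebra.ι ℂ v, Algebra.subset_adjoin ⟨u, v, rfl⟩⟩

/-- The component `{η}^{(d)}` of degree `d` of an even form `η`. -/
def degreePart (d : ℕ) (η : EvenForms W) : ExteriorAlgebra ℂ W :=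
  GradedAlgebra.proj (fun i : ℕ => ⋀[ℂ]^i W) d (EvenForms.incl W η)

/-- The component of degree `0`, a complex number. -/
def constantTerm (η : EvenForms W) : ℂ := ExteriorAlgebra.algebraMapInv (EvenForms.incl W η)

end Forms

/-- The value `f(X) = ∑ fₘ Xᵐ` of a power series at an element with `X ^ (N + 1) = 0`. -/
def evalNilpotent (N : ℕ) (f : PowerSeries ℂ) {A : Type*} [Ring A] [Algebra ℂ A] (X : A) : A :=
  ∑ m ∈ Finset.range (N + 1), PowerSeries.coeff m f • X ^ m

/-- The square root of an even form (on a manifold of dimension `n`) with positive constant term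
`c`, normalized to have positive constant term: `√c (1 + (D / c - 1))^{1/2}`. -/
def sqrtForm (n : ℕ) {W : Type*} [AddCommGroup W] [Module ℂ W] (D : EvenForms W) : EvenForms W :=
  ((Real.sqrt (constantTerm D).re : ℝ) : ℂ) •
    evalNilpotent n (PowerSeries.binomialSeries ℂ (1 / 2 : ℂ)) ((constantTerm D)⁻¹ • D - 1)

/-! ### The power series of the characteristic forms -/

/-- `sinh(y) / y`. -/
def sinhDivSeries : PowerSeries ℂ :=
  PowerSeries.mk fun m => if Even m then (((m + 1).factorial : ℕ) : ℂ)⁻¹ else 0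

/-- `cosh(y)`. -/
def coshSeries : PowerSeries ℂ :=
  PowerSeries.mk fun m => if Even m then ((m.factorial : ℕ) : ℂ)⁻¹ else 0

/-- `y / sinh(y)`. -/
def aHatSeries : PowerSeries ℂ := sinhDivSeries⁻¹

/-- `2 y / tanh(y)`. -/
def lHatSeries : PowerSeries ℂ := PowerSeries.C 2 * coshSeries * sinhDivSeries⁻¹

/-! ### Complex vector bundles with connection over a coordinate chart -/

/-- A complex vector bundle with connection over a chart with coordinates `y¹, …, yⁿ`, given in a
local frame `(sⱼ)` by its connection matrices: `∇_{∂ₖ} sⱼ = ∑ᵢ (conn y k) i j • sᵢ`. -/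
structure LocalBundle (n : ℕ) where
  /-- The index set of the frame. -/
  idx : Type
  [fintype : Fintype idx]
  [decEq : DecidableEq idx]
  /-- The connection matrices. -/
  conn : EuclideanSpace ℝ (Fin n) → Fin n → Matrix idx idx ℂ

attribute [instance] LocalBundle.fintype LocalBundle.decEq

/-- The partial derivative `∂ₖ f` at `y`. -/
def pderiv {n : ℕ} {F : Type*} [NormedAddCommGroup F] [NormedSpace ℝ F]
    (k : Fin n) (f : EuclideanSpace ℝ (Fin n) → F) (y : EuclideanSpace ℝ (Fin n)) : F :=
  fderiv ℝ f y (EuclideanSpace.single k 1)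

/-- The coefficients `F_{kl} = ∂ₖ Aₗ - ∂ₗ Aₖ + [Aₖ, Aₗ]` of the curvature
`∇² = ∑_{k<l} F_{kl} dyᵏ ∧ dyˡ`. -/
def LocalBundle.curvCoeff {n : ℕ} (B : LocalBundle n) (y : EuclideanSpace ℝ (Fin n))
    (k l : Fin n) : Matrix B.idx B.idx ℂ :=
  Matrix.of (fun i j => pderiv k (fun z => B.conn z l i j) y - pderiv l (fun z => B.conn z k i j) y)
    + B.conn y k * B.conn y l - B.conn y l * B.conn y k

/-- The tensor product of a finite family of bundles with the induced connection, in the frame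
of the tensor products of frame elements (the empty product is the trivial line bundle). -/
def LocalBundle.tensor {n : ℕ} {α : Type} [Fintype α] [DecidableEq α] (B : α → LocalBundle n) :
    LocalBundle n where
  idx := ∀ a, (B a).idx
  conn := fun y k => Matrix.of fun f f' =>
    ∑ a, if ∀ b, b ≠ a → f b = f' b then (B a).conn y k (f a) (f' a) else 0

/-- The `p`-th exterior power of a bundle of rank `N` with the induced connection, in the frame
`e_S = e_{s₁} ∧ ⋯ ∧ e_{s_p}`, `S = {s₁ < ⋯ < s_p}`. By the Leibniz rule the entry `(S', S)` is the
sum over `a` of the coefficient of `e_{S'}` in `e_{s₁} ∧ ⋯ ∧ ∇e_{s_a} ∧ ⋯ ∧ e_{s_p}`, and this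
coefficient is a minor. -/
def extPower {n N : ℕ} (A : EuclideanSpace ℝ (Fin n) → Fin n → Matrix (Fin N) (Fin N) ℂ) (p : ℕ) :
    LocalBundle n where
  idx := {S : Finset (Fin N) // S.card = p}
  conn := fun y k => Matrix.of fun S' S =>
    ∑ a : Fin p, Matrix.det
      (((1 : Matrix (Fin N) (Fin N) ℂ).submatrix
          (S'.1.orderEmbOfFin S'.2) (S.1.orderEmbOfFin S.2)).updateCol a
        fun b => A y k (S'.1.orderEmbOfFin S'.2 b) (S.1.orderEmbOfFin S.2 a))

/-- The `p`-th symmetric power of a bundle of rank `N` with the induced connection, in the frame of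
monomials of degree `p` in the `eⱼ`. By the Leibniz rule a monomial `s` is sent to
`∑_{i,j} (multiplicity of j in s) A_{ij} (s with one factor eⱼ replaced by eᵢ)`. -/
def symPower {n N : ℕ} (A : EuclideanSpace ℝ (Fin n) → Fin n → Matrix (Fin N) (Fin N) ℂ) (p : ℕ) :
    LocalBundle n where
  idx := Sym (Fin N) p
  conn := fun y k => Matrix.of fun s' s =>
    ∑ j, ∑ i, if (s' : Multiset (Fin N)) = i ::ₘ (s : Multiset (Fin N)).erase j then
      ((s : Multiset (Fin N)).count j : ℂ) * A y k i j else 0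

/-! ### Virtual bundles -/

/-- The names of the exterior and symmetric powers of a bundle. -/
inductive PowerName : Type
  | ext (p : ℕ)
  | sym (p : ℕ)
  deriving DecidableEq

/-- Formal integral combinations of tensor products of exterior and symmetric powers of a bundle
`E`; the ring multiplication is the tensor product and `1` is the trivial line bundle. A multiset
of powers stands for the tensor product of its elements. -/
abbrev VirtualBundle : Type := AddMonoidAlgebra ℤ (Multiset PowerName)

/-- The class of a single power of `E`. -/
def powerClass (a : PowerName) : VirtualBundle := AddMonoidAlgebra.single {a} 1

/-- `Λ_t(E) = 1 + t E + t² Λ²(E) + ⋯`. -/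
def lambdaSeries : PowerSeries VirtualBundle :=
  PowerSeries.mk fun p => if p = 0 then 1 else powerClass (.ext p)

/-- `S_t(E) = 1 + t E + t² S²(E) + ⋯`. -/
def symSeries : PowerSeries VirtualBundle :=
  PowerSeries.mk fun p => if p = 0 then 1 else powerClass (.sym p)

/-- `Λ_t(E - ℂᴺ) = Λ_t(E) / Λ_t(ℂᴺ)`, where `Λ_t(ℂᴺ) = (1 + t)ᴺ`. -/
def lambdaTilde (N : ℕ) : PowerSeries VirtualBundle :=
  lambdaSeries * PowerSeries.invOfUnit ((1 + PowerSeries.X) ^ N) 1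

/-- `S_t(E - ℂᴺ) = S_t(E) / S_t(ℂᴺ)`, where `S_t(ℂᴺ) = 1 / Λ_{-t}(ℂᴺ) = (1 - t)⁻ᴺ`. -/
def symTilde (N : ℕ) : PowerSeries VirtualBundle :=
  symSeries * (1 - PowerSeries.X) ^ N

/-- The infinite product `∏_{j ≥ 0} fⱼ` of power series with `fⱼ ≡ 1 mod X^{j+1}`: the coefficient
of `X^m` only depends on the first `m` factors. -/
def infiniteProduct {R : Type*} [CommRing R] (f : ℕ → PowerSeries R) : PowerSeries R :=
  PowerSeries.mk fun m => PowerSeries.coeff m (∏ j ∈ Finset.range m, f j)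

/-- `Θ₂(E) = ⨂_{n ≥ 1} S_{qⁿ}(E - ℂᴺ) ⊗ ⨂_{m ≥ 1} Λ_{-q^{m-1/2}}(E - ℂᴺ)` for `E` of rank `N`,
as a power series in `X = q^{1/2}`; `rescale (-1)` followed by `expand d` substitutes `-X ^ d`
for the variable. -/
def thetaTwo (N : ℕ) : PowerSeries VirtualBundle :=
  infiniteProduct (fun j => PowerSeries.expand (2 * (j + 1)) (by omega) (symTilde N)) *
  infiniteProduct (fun j => PowerSeries.expand (2 * j + 1) (by omega)
    (PowerSeries.rescale (-1) (lambdaTilde N)))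

/-- `Bⱼ(E)`, the coefficient of `q^{j/2}` in `Θ₂(E)`, for `E` of rank `N`. -/
def bundleB (N j : ℕ) : VirtualBundle := PowerSeries.coeff j (thetaTwo N)

/-! ### The combinations `b_r` -/

/-- `∏_{j ≥ 1} (1 - q^j) (1 + q^j)²` in the variable `X = q^{1/2}`, so that
`θ₁(0, τ) = 2 q^{1/8} * thetaOneProduct`. -/
def thetaOneProduct : PowerSeries ℤ :=
  infiniteProduct fun j => (1 - PowerSeries.X ^ (2 * (j + 1))) *
    (1 + PowerSeries.X ^ (2 * (j + 1))) ^ 2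

/-- `θ₃(0, τ) = ∏_{j ≥ 1} (1 - q^j) (1 + q^{j-1/2})²` in the variable `X = q^{1/2}`. -/
def thetaThreeSeries : PowerSeries ℤ :=
  infiniteProduct fun j => (1 - PowerSeries.X ^ (2 * (j + 1))) *
    (1 + PowerSeries.X ^ (2 * j + 1)) ^ 2

/-- `8 δ₂ = -(θ₁⁴ + θ₃⁴) = -1 - 24 q^{1/2} - ⋯` in the variable `X = q^{1/2}`. -/
def eightDeltaTwo : PowerSeries ℤ :=
  -(16 * PowerSeries.X * thetaOneProduct ^ 4 + thetaThreeSeries ^ 4)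

/-- `ε₂ = θ₁⁴ θ₃⁴ / 16 = q^{1/2} + 8 q + ⋯` in the variable `X = q^{1/2}`. -/
def epsilonTwo : PowerSeries ℤ :=
  PowerSeries.X * thetaOneProduct ^ 4 * thetaThreeSeries ^ 4

/-- The integers `c_{r,j}` in `b_r = ∑_{j ≤ r} c_{r,j} Bⱼ`. They are obtained by comparing the
coefficients of `q^{r/2}`, `r = 0, …, k`, in
`∑ⱼ Bⱼ q^{j/2} = ∑ₛ bₛ (8 δ₂)^{2k+1-2s} ε₂ˢ`: the coefficient of `q^{r/2}` in the summand `s`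
vanishes for `s > r` and is `-b_r` for `s = r`. -/
def coeffB (k : ℕ) (r j : ℕ) : ℤ :=
  (if r = j then -1 else 0) + ∑ s : Fin r,
    PowerSeries.coeff r (eightDeltaTwo ^ (2 * k + 1 - 2 * (s : ℕ)) * epsilonTwo ^ (s : ℕ)) *
      coeffB k s j
termination_by r
decreasing_by exact s.2

/-- The virtual bundle `b_r(E)`, `0 ≤ r ≤ k`, for `E` of rank `8k+4`. -/
def bundleb (k r : ℕ) : VirtualBundle :=
  ∑ j ∈ Finset.range (r + 1), coeffB k r j • bundleB (8 * k + 4) j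

/-! ### Riemannian geometry in a chart -/

section Geometry

variable {n : ℕ} {M : Type*} [TopologicalSpace M] [ChartedSpace (EuclideanSpace ℝ (Fin n)) M]
  [IsManifold (𝓡 n) ∞ M]

/-- A smooth Riemannian metric on `M`. -/
abbrev RiemannianMetricOn (n : ℕ) (M : Type*) [TopologicalSpace M]
    [ChartedSpace (EuclideanSpace ℝ (Fin n)) M] [IsManifold (𝓡 n) ∞ M] : Type _ :=
  Bundle.ContMDiffRiemannianMetric (𝓡 n) ∞ (EuclideanSpace ℝ (Fin n))
    (fun x : M => TangentSpace (𝓡 n) x)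

/-- The complex-valued covectors at `x`. -/
abbrev Covector (n : ℕ) {M : Type*} [TopologicalSpace M]
    [ChartedSpace (EuclideanSpace ℝ (Fin n)) M] (x : M) : Type :=
  TangentSpace (𝓡 n) x →ₗ[ℝ] ℂ

variable (g : RiemannianMetricOn n M) (e : OpenPartialHomeomorph M (EuclideanSpace ℝ (Fin n)))

/-- The coordinate vector `∂ᵢ` of the chart `e` at the point with coordinates `y`. -/
def coordVector (i : Fin n) (y : EuclideanSpace ℝ (Fin n)) : TangentSpace (𝓡 n) (e.symm y) :=
  mfderiv (𝓡 n) (𝓡 n) e.symm y (EuclideanSpace.single i (1 : ℝ) : EuclideanSpace ℝ (Fin n))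

/-- The differential `dyᵏ` at `x` of the `k`-th coordinate of the chart `e`. -/
def coordCovector (k : Fin n) (x : M) : Covector n x :=
  Complex.ofRealCLM.toLinearMap ∘ₗ
    (EuclideanSpace.proj k : EuclideanSpace ℝ (Fin n) →L[ℝ] ℝ).toLinearMap ∘ₗ
      (mfderiv (𝓡 n) (𝓡 n) e x).toLinearMap

/-- The matrix `(g_{ij})` of the metric in the chart `e`. -/
def metricMatrix (y : EuclideanSpace ℝ (Fin n)) : Matrix (Fin n) (Fin n) ℝ :=
  Matrix.of fun i j => g.inner (e.symm y) (coordVector e i y) (coordVector e j y)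

/-- The Christoffel symbol `Γⁱ_{kj}` of the Levi-Civita connection in the chart `e`. -/
def christoffel (y : EuclideanSpace ℝ (Fin n)) (i k j : Fin n) : ℝ :=
  (1 / 2) * ∑ m, (metricMatrix g e y)⁻¹ i m *
    (pderiv k (fun z => metricMatrix g e z j m) y + pderiv j (fun z => metricMatrix g e z k m) y -
      pderiv m (fun z => metricMatrix g e z k j) y)

/-- The matrices of the Levi-Civita connection, extended to the complexified tangent bundle, in the
frame `∂₁, …, ∂ₙ`: `∇_{∂ₖ} ∂ⱼ = ∑ᵢ Γⁱ_{kj} ∂ᵢ`. -/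
def leviCivita (y : EuclideanSpace ℝ (Fin n)) (k : Fin n) : Matrix (Fin n) (Fin n) ℂ :=
  Matrix.of fun i j => (christoffel g e y i k j : ℂ)

/-- The complexified tangent bundle with the Levi-Civita connection. -/
def tangentC : LocalBundle n where
  idx := Fin n
  conn := leviCivita g e

/-- The power of the complexified tangent bundle named by `a`, with its induced connection. -/
def powerBundle : PowerName → LocalBundle n
  | .ext p => extPower (leviCivita g e) p
  | .sym p => symPower (leviCivita g e) p

open scoped Classical in
/-- The tensor product of a multiset of powers of the complexified tangent bundle. -/
def tensorBundle (w : Multiset PowerName) : LocalBundle n :=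
  LocalBundle.tensor fun a : w.ToType => powerBundle g e a.1

/-- The curvature of a bundle at `x`, a matrix of 2-forms. -/
def curvature (B : LocalBundle n) (x : M) : Matrix B.idx B.idx (EvenForms (Covector n x)) :=
  Matrix.of fun i j => ∑ k, ∑ l ∈ Finset.Ioi k,
    B.curvCoeff (e x) k l i j • wedge (coordCovector e k x) (coordCovector e l x)

/-- The Chern character form `tr exp(√-1/(2π) R)`. -/
def chForm (B : LocalBundle n) (x : M) : EvenForms (Covector n x) :=
  Matrix.trace (evalNilpotent n (PowerSeries.exp ℂ)
    ((Complex.I / (2 * Real.pi)) • curvature e B x))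

/-- The Chern character form of a virtual bundle built from the complexified tangent bundle. -/
def chVirtual (b : VirtualBundle) (x : M) : EvenForms (Covector n x) :=
  b.coeff.sum fun w m => m • chForm e (tensorBundle g e w) x

/-- `ch(T_ℂ M)`. -/
def chTangent (x : M) : EvenForms (Covector n x) := chForm e (tangentC g e) x

/-- `Â(TM) = det^{1/2} ((√-1/(4π) R) / sinh(√-1/(4π) R))`. -/
def aHatForm (x : M) : EvenForms (Covector n x) :=
  sqrtForm n (Matrix.det (evalNilpotent n aHatSeries
    ((Complex.I / (4 * Real.pi)) • curvature e (tangentC g e) x)))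

/-- `L̂(TM) = det^{1/2} ((√-1/(2π) R) / tanh(√-1/(4π) R))`. -/
def lHatForm (x : M) : EvenForms (Covector n x) :=
  sqrtForm n (Matrix.det (evalNilpotent n lHatSeries
    ((Complex.I / (4 * Real.pi)) • curvature e (tangentC g e) x)))

/-- `h_r(T_ℂ M) = {Â(TM) ch(b_r(T_ℂ M))}^{(8k+4)}`. -/
def hForm {M : Type*} [TopologicalSpace M] (k r : ℕ)
    [ChartedSpace (EuclideanSpace ℝ (Fin (8 * k + 4))) M] [IsManifold (𝓡 (8 * k + 4)) ∞ M]
    (g : RiemannianMetricOn (8 * k + 4) M)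
    (e : OpenPartialHomeomorph M (EuclideanSpace ℝ (Fin (8 * k + 4)))) (x : M) :
    ExteriorAlgebra ℂ (Covector (8 * k + 4) x) :=
  degreePart (8 * k + 4) (aHatForm g e x * chVirtual g e (bundleb k r) x)

end Geometry

end TwistedAnomaly

end

open scoped Manifold ContDiff

noncomputable section

namespace TwistedAnomaly

set_option linter.unusedSectionVars false

/-! Both sides of the formula come from one polynomial. Let h = x² + ⋯ solve h'' = 2 - a h + 6 b h².
The coefficients of h are universal polynomials in a and b, homogeneous when a has weight 2 and b
weight 4 (`isWeightedHomogeneous_solutionCoeff`). For the matrix F = √-1/(2π) R of 2-forms let Φ(a,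
b) be the fourth root of 1 / det(h(F) / F²) with Φ - 1 nilpotent (`exists_solutionRoot`). The
coefficient of a^i b^j in Φ is a form of degree 4i + 8j. In degree 8k+4 only the monomials
a^{2k+1-2r} b^r with 0 ≤ r ≤ k survive, with coefficients α_r (`linear_aeval_diagonal`).

At a = 8δ₂, b = ε₂ the solution h is the square of a quotient of theta functions, and Φ becomes
Â(TM) ch(∑ B_j q^{j/2}) (`theta_character`). The recursion for b_r inverts the expansion in
(8δ₂)^{2k+1-2r} ε₂^r, so h_r = α_r (`sum_coeffB_smul`).

At a = 2, b = 1/16 the solution is 4 tanh²(x/2), and 2^{4k+2} Φ is L̂(TM). Along the tangent vector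
(2 + 48η, 1/16 - η) with η² = 0, the value of 2^{4k+2} Φ is L̂(TM) (1 + 2η (ch(T_ℂM) - (8k+4)))
(`tanh_character`). These are the leading terms of the modular forms at the other cusp, but no
modular transformation is needed: a first-order deformation of a differential equation suffices. The
coefficient of α_r in L̂ ch(T_ℂM) - 16 L̂ contains the factor 12(2k+1-2r) - 8r + (8k+4) - 16 =
32(k-r). This explains the constant 16, the absence of h_k and the powers of 2
(`top_coefficient_eq`).

Three ingredients support this. The differential equation of the theta quotient (`elliptic_ode`)
follows from the triple product and from splitting ℤ² into pairs of even and of odd difference. The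
Chern characters of exterior and symmetric powers with induced connections are traces of these
functors at exp(F) (`MatrixFunctor.act_exp`, `traceSeries_exterior`, `traceSeries_symmetric`). The
curvature is skew for the metric (`realCurvature_skew`), so det f(F) = det f(-F), and the factors of
the theta quotient at x and -x have the same determinant. Fourth roots are then identified by their
constant terms (`eq_of_pow_four_eq`). -/

/-! ### The finite triple product -/

section FiniteTripleProduct

variable {R : Type*} [CommRing R]

/-- The coefficient of `zⁿ` in `∏_{j < m} (1 + p^{2j+1+r} z) (1 + p^{2j+1-r} z⁻¹)`. -/
def tripleCoeff (p : R) (r : ℕ) : ℕ → ℤ → R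
  | 0, n => if n = 0 then 1 else 0
  | m + 1, n => (1 + p ^ (4 * m + 2)) * tripleCoeff p r m n +
      (p ^ (2 * m + 1 + r) * tripleCoeff p r m (n - 1) + p ^ (2 * m + 1 - r) * tripleCoeff p r m (n + 1))

theorem tripleCoeff_eq_zero (p : R) (r : ℕ) (m : ℕ) (n : ℤ) (h : m < n.natAbs) : tripleCoeff p r m n = 0 := by
  induction m generalizing n with
  | zero => simp only [tripleCoeff]; rw [if_neg]; omega
  | succ m ih =>
    simp only [tripleCoeff]
    rw [ih n (by omega), ih (n - 1) (by omega), ih (n + 1) (by omega)]; ring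

theorem tripleCoeff_support_finite (p : R) (r : ℕ) (m : ℕ) (k : ℤ) (f : ℤ → R) :
    (Function.support fun n => tripleCoeff p r m (n + k) * f n).Finite := by
  refine (Set.finite_Icc (-(m : ℤ) - k) (m - k)).subset fun n hn => ?_
  by_contra h
  refine hn ?_
  dsimp only
  rw [tripleCoeff_eq_zero p r m _ (by simp only [Set.mem_Icc] at h; omega), zero_mul]

/-- For r ≤ 1 the truncated subtraction 2j + 1 - r is a true one, so the exponents of a new pair of
factors add up to 4m + 2. The recursion defining `tripleCoeff` is the expansion of that pair. -/
theorem prod_eq_finsum_tripleCoeff (p : R) {r : ℕ} (hr : r ≤ 1) (z : Rˣ) (m : ℕ) :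
    ∏ j ∈ Finset.range m, ((1 + p ^ (2 * j + 1 + r) * (z : R)) *
        (1 + p ^ (2 * j + 1 - r) * (z⁻¹ : Rˣ))) =
      ∑ᶠ n : ℤ, tripleCoeff p r m n * (z ^ n : Rˣ) := by
  induction m with
  | zero =>
    rw [finsum_eq_single _ 0]
    · simp [tripleCoeff]
    · intro n hn; simp [tripleCoeff, hn]
  | succ m ih =>
    have h0 : (Function.support fun n : ℤ => tripleCoeff p r m n * ((z ^ n : Rˣ) : R)).Finite := by
      simpa using tripleCoeff_support_finite p r m 0 fun n => ((z ^ n : Rˣ) : R)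
    have h1 : ∑ᶠ n : ℤ, tripleCoeff p r m (n - 1) * ((z ^ n : Rˣ) : R) =
        z * ∑ᶠ n : ℤ, tripleCoeff p r m n * ((z ^ n : Rˣ) : R) := by
      rw [mul_finsum' _ _ h0]
      refine finsum_eq_of_bijective (fun n : ℤ => n - 1) (Equiv.subRight (1 : ℤ)).bijective
        fun n => ?_
      rw [zpow_sub_one, Units.val_mul, mul_left_comm, mul_left_comm (z : R), Units.mul_inv, mul_one]
    have h2 : ∑ᶠ n : ℤ, tripleCoeff p r m (n + 1) * ((z ^ n : Rˣ) : R) =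
        (z⁻¹ : Rˣ) * ∑ᶠ n : ℤ, tripleCoeff p r m n * ((z ^ n : Rˣ) : R) := by
      rw [mul_finsum' _ _ h0]
      refine finsum_eq_of_bijective (fun n : ℤ => n + 1) (Equiv.addRight (1 : ℤ)).bijective
        fun n => ?_
      rw [zpow_add_one, Units.val_mul, mul_left_comm, mul_left_comm ((z⁻¹ : Rˣ) : R), Units.inv_mul,
        mul_one]
    have hs1 := tripleCoeff_support_finite p r m (-1) fun n => ((z ^ n : Rˣ) : R)
    have hs2 := tripleCoeff_support_finite p r m 1 fun n => ((z ^ n : Rˣ) : R)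
    have key : ∑ᶠ n : ℤ, tripleCoeff p r (m + 1) n * ((z ^ n : Rˣ) : R) =
        (1 + p ^ (4 * m + 2)) * ∑ᶠ n : ℤ, tripleCoeff p r m n * ((z ^ n : Rˣ) : R) +
        (p ^ (2 * m + 1 + r) * ∑ᶠ n : ℤ, tripleCoeff p r m (n - 1) * ((z ^ n : Rˣ) : R) +
          p ^ (2 * m + 1 - r) * ∑ᶠ n : ℤ, tripleCoeff p r m (n + 1) * ((z ^ n : Rˣ) : R)) := by
      simp only [← sub_eq_add_neg] at hs1
      have hm : ∀ (a : R) (f : ℤ → R), (Function.support f).Finite →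
          (Function.support fun n => a * f n).Finite := fun a f hf => hf.subset fun n hn hc => hn (by
        simp only at *; rw [hc, mul_zero])
      rw [mul_finsum' _ _ h0, mul_finsum' _ _ hs1, mul_finsum' _ _ hs2,
        ← finsum_add_distrib (hm _ _ hs1) (hm _ _ hs2), ← finsum_add_distrib (hm _ _ h0)]
      · refine finsum_congr fun n => ?_
        simp only [tripleCoeff]; ring
      · exact ((hm _ _ hs1).union (hm _ _ hs2)).subset (Function.support_add _ _)
    rw [Finset.prod_range_succ, ih, key, h1, h2]
    have hz := Units.mul_inv z
    rw [show 4 * m + 2 = (2 * m + 1 + r) + (2 * m + 1 - r) by omega, pow_add p (2 * m + 1 + r)]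
    linear_combination (p ^ (2 * m + 1 + r) * p ^ (2 * m + 1 - r) * ∑ᶠ n : ℤ, tripleCoeff p r m n * ((z ^ n : Rˣ) : R)) * hz

theorem mul_add_nonneg {r : ℕ} (n : ℤ) (hr : r ≤ 1) : 0 ≤ n * (n + r) := by
  have h : (r : ℤ) ≤ 1 := by exact_mod_cast hr
  have h' : (0 : ℤ) ≤ r := by positivity
  rcases le_or_gt 0 n with hn | hn
  · positivity
  · nlinarith

/-- `∏_{1 ≤ j ≤ k} (1 - p^{2j})`. -/
def evenEuler (p : R) (k : ℕ) : R := ∏ j ∈ Finset.range k, (1 - p ^ (2 * (j + 1)))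

theorem evenEuler_succ (p : R) (k : ℕ) :
    evenEuler p (k + 1) = evenEuler p k * (1 - p ^ (2 * (k + 1))) := Finset.prod_range_succ _ _

/-- With n = j - m, the coefficient is p^{n(n+r)} times the Gaussian binomial coefficient of 2m over
j in base p². Denominators are cleared, so no division in the ring is needed; the induction is
Pascal's rule applied twice. -/
theorem evenEuler_mul_tripleCoeff (p : R) {r : ℕ} (hr : r ≤ 1) (m : ℕ) (i j : ℕ) (h : i + j = 2 * m) :
    evenEuler p i * evenEuler p j * tripleCoeff p r m ((j : ℤ) - m) =
      evenEuler p (2 * m) * p ^ (((j : ℤ) - m) * ((j : ℤ) - m + r)).toNat := by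
  induction m generalizing i j with
  | zero =>
    obtain rfl : i = 0 := by omega
    obtain rfl : j = 0 := by omega
    simp [tripleCoeff, evenEuler]
  | succ m ih =>
    obtain ⟨N, hN⟩ : ∃ N : ℕ, N =
        (((j : ℤ) - (m + 1 : ℕ)) * ((j : ℤ) - (m + 1 : ℕ) + r)).toNat := ⟨_, rfl⟩
    have hNz : (N : ℤ) = ((j : ℤ) - (m + 1 : ℕ)) * ((j : ℤ) - (m + 1 : ℕ) + r) := by
      rw [hN, Int.toNat_of_nonneg (mul_add_nonneg _ hr)]
    -- The induction hypothesis at the three coefficients of the recursion, all expressed through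
    -- the target exponent N.
    have t1 : j ≠ 0 → i ≠ 0 → evenEuler p (i - 1) * evenEuler p (j - 1) *
        tripleCoeff p r m ((j : ℤ) - (m + 1 : ℕ)) = evenEuler p (2 * m) * p ^ N := by
      intro hj hi
      have := ih (i - 1) (j - 1) (by omega)
      rwa [show ((j - 1 : ℕ) : ℤ) - m = (j : ℤ) - (m + 1 : ℕ) by omega, ← hN] at this
    have t2 : 2 ≤ j → evenEuler p i * evenEuler p (j - 2) *
        (p ^ (2 * m + 1 + r) * tripleCoeff p r m ((j : ℤ) - (m + 1 : ℕ) - 1)) =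
        evenEuler p (2 * m) * (p ^ N * p ^ (2 * i)) := by
      intro hj
      have := ih i (j - 2) (by omega)
      rw [show ((j - 2 : ℕ) : ℤ) - m = (j : ℤ) - (m + 1 : ℕ) - 1 by omega] at this
      have e : (((j : ℤ) - (m + 1 : ℕ) - 1) * ((j : ℤ) - (m + 1 : ℕ) - 1 + r)).toNat +
          (2 * m + 1 + r) = N + 2 * i := by
        zify
        rw [hNz, Int.toNat_of_nonneg (mul_add_nonneg _ hr)]
        have : (i : ℤ) = 2 * (m + 1) - j := by omega
        rw [this]; push_cast; ring
      rw [mul_left_comm, this, ← pow_add, ← e, pow_add]; ring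
    have t3 : 2 ≤ i → evenEuler p (i - 2) * evenEuler p j *
        (p ^ (2 * m + 1 - r) * tripleCoeff p r m ((j : ℤ) - (m + 1 : ℕ) + 1)) =
        evenEuler p (2 * m) * (p ^ N * p ^ (2 * j)) := by
      intro hj
      have := ih (i - 2) j (by omega)
      rw [show (j : ℤ) - m = (j : ℤ) - (m + 1 : ℕ) + 1 by push_cast; ring] at this
      have e : (((j : ℤ) - (m + 1 : ℕ) + 1) * ((j : ℤ) - (m + 1 : ℕ) + 1 + r)).toNat +
          (2 * m + 1 - r) = N + 2 * j := by
        zify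
        rw [hNz, Int.toNat_of_nonneg (mul_add_nonneg _ hr), Nat.cast_sub (by omega)]
        push_cast; ring
      rw [mul_left_comm, this, ← pow_add, ← e, pow_add]; ring
    rw [← hN, show 2 * (m + 1) = 2 * m + 1 + 1 by ring, evenEuler_succ, evenEuler_succ]
    simp only [tripleCoeff]
    set a := tripleCoeff p r m ((j : ℤ) - (m + 1 : ℕ)) with ha
    set b := tripleCoeff p r m ((j : ℤ) - (m + 1 : ℕ) - 1) with hb
    set c := tripleCoeff p r m ((j : ℤ) - (m + 1 : ℕ) + 1) with hc
    -- At an end of the range only one of the three neighbours is nonzero; these cases are separated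
    -- because i - 1 and j - 1 would be truncated.
    rcases i with _ | i
    · obtain rfl : j = 2 * m + 2 := by omega
      have ha0 : a = 0 := tripleCoeff_eq_zero _ _ _ _ (by omega)
      have hc0 : c = 0 := tripleCoeff_eq_zero _ _ _ _ (by omega)
      have t := t2 (by omega)
      rw [show 2 * m + 2 - 2 = 2 * m by omega] at t
      rw [ha0, hc0, show 2 * m + 2 = 2 * m + 1 + 1 by ring, evenEuler_succ, evenEuler_succ]
      linear_combination (1 - p ^ (2 * (2 * m + 1))) * (1 - p ^ (2 * (2 * m + 1 + 1))) * t
    rcases j with _ | j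
    · obtain rfl : i = 2 * m + 1 := by omega
      have ha0 : a = 0 := tripleCoeff_eq_zero _ _ _ _ (by omega)
      have hb0 : b = 0 := tripleCoeff_eq_zero _ _ _ _ (by omega)
      have t := t3 (by omega)
      rw [show 2 * m + 1 + 1 - 2 = 2 * m by omega] at t
      rw [ha0, hb0, evenEuler_succ, evenEuler_succ]
      linear_combination (1 - p ^ (2 * (2 * m + 1))) * (1 - p ^ (2 * (2 * m + 1 + 1))) * t
    have u1 : evenEuler p i * evenEuler p j * a = evenEuler p (2 * m) * p ^ N :=
      t1 (by omega) (by omega)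
    have u2 : evenEuler p (i + 1) * evenEuler p j * (p ^ (2 * m + 1 + r) * b) =
        evenEuler p (2 * m) * (p ^ N * p ^ (2 * (i + 1))) * (1 - p ^ (2 * j)) := by
      rcases j with _ | j
      · have hb0 : b = 0 := tripleCoeff_eq_zero _ _ _ _ (by omega)
        rw [hb0]; simp
      · have t := t2 (by omega)
        rw [show j + 1 + 1 - 2 = j by omega] at t
        rw [evenEuler_succ p j]
        linear_combination (1 - p ^ (2 * (j + 1))) * t
    have u3 : evenEuler p i * evenEuler p (j + 1) * (p ^ (2 * m + 1 - r) * c) =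
        evenEuler p (2 * m) * (p ^ N * p ^ (2 * (j + 1))) * (1 - p ^ (2 * i)) := by
      rcases i with _ | i
      · have hb0 : c = 0 := tripleCoeff_eq_zero _ _ _ _ (by omega)
        rw [hb0]; simp
      · have t := t3 (by omega)
        rw [show i + 1 + 1 - 2 = i by omega] at t
        rw [evenEuler_succ p i]
        linear_combination (1 - p ^ (2 * (i + 1))) * t
    have hm : 2 * m = i + j := by omega
    clear t1 t2 t3 ih
    rw [show 4 * m + 2 = 2 * i + 2 * j + 2 by omega]
    generalize p ^ (2 * m + 1 + r) = w at *
    generalize p ^ (2 * m + 1 - r) = w' at *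
    rw [hm] at u1 u2 u3 ⊢
    rw [evenEuler_succ p i] at u2 ⊢
    rw [evenEuler_succ p j] at u3 ⊢
    have e1 : p ^ (2 * i + 2 * j + 2) = p ^ (2 * i) * p ^ (2 * j) * p ^ 2 := by ring
    have e2 : p ^ (2 * (i + 1)) = p ^ (2 * i) * p ^ 2 := by ring
    have e3 : p ^ (2 * (j + 1)) = p ^ (2 * j) * p ^ 2 := by ring
    have e4 : p ^ (2 * (i + j + 1)) = p ^ (2 * i) * p ^ (2 * j) * p ^ 2 := by ring
    have e5 : p ^ (2 * (i + j + 1 + 1)) = p ^ (2 * i) * p ^ (2 * j) * p ^ 4 := by ring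
    rw [e2] at u2
    rw [e3] at u3
    rw [e1, e2, e3, e4, e5]
    generalize p ^ (2 * i) = u at *
    generalize p ^ (2 * j) = v at *
    linear_combination (1 + u * v * p ^ 2) * (1 - u * p ^ 2) * (1 - v * p ^ 2) * u1 +
      (1 - v * p ^ 2) * u2 + (1 - u * p ^ 2) * u3

end FiniteTripleProduct

/-! ### Gaussian sums -/

section Gaussian

open PowerSeries
open scoped PowerSeries.WithPiTopology

variable {A : Type*} [CommRing A] [TopologicalSpace A] [DiscreteTopology A]

/-- Only finitely many exponents lie below a given degree, so each coefficient is a finite sum. With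
discrete coefficients this is summability in the product topology. -/
theorem summable_monomial {ι : Type*} (e : ι → ℤ) (c : ι → A)
    (h : ∀ d : ℕ, {i | e i ≤ d}.Finite) :
    Summable fun i => (monomial (e i).toNat (c i) : PowerSeries A) := by
  rw [PowerSeries.WithPiTopology.summable_iff_summable_coeff]
  refine fun d => summable_of_hasFiniteSupport ((h d).subset fun i hi => ?_)
  by_contra hc
  refine hi ?_
  simp only [coeff_monomial]
  rw [if_neg]
  simp only [Set.mem_ofPred_eq] at hc
  omega

theorem tsum_mul_tsum_monomial {ι κ : Type*} (e : ι → ℤ) (c : ι → A) (e' : κ → ℤ) (c' : κ → A)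
    (h0 : ∀ i, 0 ≤ e i) (h0' : ∀ i, 0 ≤ e' i)
    (h : ∀ d : ℕ, {i | e i ≤ d}.Finite) (h' : ∀ d : ℕ, {i | e' i ≤ d}.Finite) :
    (∑' i, (monomial (e i).toNat (c i) : PowerSeries A)) * ∑' i, monomial (e' i).toNat (c' i) =
      ∑' i : ι × κ, monomial (e i.1 + e' i.2).toNat (c i.1 * c' i.2) := by
  have hm : ∀ i : ι × κ, (monomial (e i.1).toNat (c i.1) : PowerSeries A) *
      monomial (e' i.2).toNat (c' i.2) = monomial (e i.1 + e' i.2).toNat (c i.1 * c' i.2) :=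
    fun i => by rw [monomial_mul_monomial, Int.toNat_add (h0 _) (h0' _)]
  rw [(summable_monomial e c h).tsum_mul_tsum (summable_monomial e' c' h')]
  · exact tsum_congr hm
  · simp only [hm]
    refine summable_monomial (fun i : ι × κ => e i.1 + e' i.2) _ fun d => ?_
    refine ((h d).prod (h' d)).subset fun i hi => ?_
    have := h0 i.1; have := h0' i.2
    simp only [Set.mem_ofPred_eq, Set.mem_prod] at hi ⊢
    omega

/-- The pairs of integers with even difference, respectively with odd difference. -/
def latticeEquiv : (ℤ × ℤ) ⊕ (ℤ × ℤ) ≃ ℤ × ℤ :=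
  Equiv.ofBijective
    (Sum.elim (fun i => (i.1 + i.2, i.1 - i.2)) (fun i => (i.1 + i.2 + 1, i.1 - i.2))) <| by
    constructor
    · rintro (⟨s, t⟩ | ⟨s, t⟩) (⟨s', t'⟩ | ⟨s', t'⟩) h <;>
        simp only [Sum.elim_inl, Sum.elim_inr, Prod.mk.injEq] at h <;>
        simp only [Sum.inl.injEq, Sum.inr.injEq, Prod.mk.injEq, reduceCtorEq] <;> omega
    · rintro ⟨m, n⟩
      rcases Int.even_or_odd (m - n) with ⟨t, ht⟩ | ⟨t, ht⟩
      · exact ⟨.inl (m - t, t), by simp only [Sum.elim_inl, Prod.mk.injEq]; omega⟩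
      · exact ⟨.inr (m - t - 1, t), by simp only [Sum.elim_inr, Prod.mk.injEq]; omega⟩

theorem tsum_lattice {B : Type*} [AddCommGroup B] [TopologicalSpace B] [IsTopologicalAddGroup B]
    [T2Space B] (F : ℤ × ℤ → B)
    (h1 : Summable fun i : ℤ × ℤ => F (i.1 + i.2, i.1 - i.2))
    (h2 : Summable fun i : ℤ × ℤ => F (i.1 + i.2 + 1, i.1 - i.2)) :
    ∑' i, F i = ∑' i : ℤ × ℤ, F (i.1 + i.2, i.1 - i.2) +
      ∑' i : ℤ × ℤ, F (i.1 + i.2 + 1, i.1 - i.2) := by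
  rw [← latticeEquiv.tsum_eq]
  exact (HasSum.sum (f := F ∘ latticeEquiv) h1.hasSum h2.hasSum).tsum_eq

/-- The reflection `s ↦ -s - 1` of both coordinates. -/
def reflectEquiv : ℤ × ℤ ≃ ℤ × ℤ where
  toFun i := (-i.1 - 1, -i.2 - 1)
  invFun i := (-i.1 - 1, -i.2 - 1)
  left_inv i := by ext <;> simp
  right_inv i := by ext <;> simp

theorem finite_quadratic (a : ℤ) {r : ℕ} (ha : 0 < a) (hr : r ≤ 1) (d : ℕ) :
    {n : ℤ | a * (n * (n + r)) ≤ d}.Finite := by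
  refine (Set.finite_Icc (-(d : ℤ) - 1) d).subset fun n hn => ?_
  have h0 := mul_add_nonneg (r := r) n hr
  have h : n * (n + r) ≤ d := by
    simp only [Set.mem_ofPred_eq] at hn
    nlinarith
  have hr' : (r : ℤ) ≤ 1 := by exact_mod_cast hr
  have h' : (0 : ℤ) ≤ r := by positivity
  rw [Set.mem_Icc]
  constructor <;> by_contra hc
  · nlinarith
  · nlinarith

theorem finite_two_quadratic (d : ℕ) : {n : ℤ | n * (2 * n + 1) ≤ d}.Finite := by
  refine (Set.finite_Icc (-(d : ℤ) - 1) d).subset fun n hn => ?_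
  simp only [Set.mem_ofPred_eq] at hn
  rw [Set.mem_Icc]
  constructor <;> by_contra hc
  · nlinarith
  · nlinarith

theorem two_quadratic_nonneg (n : ℤ) : 0 ≤ n * (2 * n + 1) := by
  rcases le_or_gt 0 n with hn | hn
  · positivity
  · nlinarith

/-- `∑ₙ X^{a n (n + r)} zⁿ`. -/
def gaussSum (a : ℤ) (r : ℕ) (z : Aˣ) : PowerSeries A :=
  ∑' n : ℤ, monomial (a * (n * (n + r))).toNat ((z ^ n : Aˣ) : A)

/-- `∑ₙ X^{n (2 n + 1)} zⁿ`. -/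
def quarterSum (z : Aˣ) : PowerSeries A :=
  ∑' n : ℤ, monomial (n * (2 * n + 1)).toNat ((z ^ n : Aˣ) : A)

/-- `∑ₙ (4 n + 1) X^{n (2 n + 1)}`. -/
def quarterMoment : PowerSeries A :=
  ∑' n : ℤ, monomial (n * (2 * n + 1)).toNat ((4 * n + 1 : ℤ) : A)

theorem gaussSum_mul_gaussSum (r r' : ℕ) (hr : r ≤ 1) (hr' : r' ≤ 1) (z w : Aˣ) :
    (gaussSum 1 r z * gaussSum 1 r' w : PowerSeries A) = ∑' i : ℤ × ℤ,
      monomial (i.1 * (i.1 + r) + i.2 * (i.2 + r')).toNat ((z ^ i.1 * w ^ i.2 : Aˣ) : A) := by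
  rw [gaussSum, gaussSum, tsum_mul_tsum_monomial]
  · simp
  · intro i; simpa using mul_add_nonneg i hr
  · intro i; simpa using mul_add_nonneg i hr'
  · exact finite_quadratic 1 one_pos hr
  · exact finite_quadratic 1 one_pos hr'

theorem summable_pairs {e e' : ℤ → ℤ} {c : ℤ × ℤ → A} {E : ℤ × ℤ → ℤ}
    (hE : ∀ i, E i = e i.1 + e' i.2) (h0 : ∀ i, 0 ≤ e i) (h0' : ∀ i, 0 ≤ e' i)
    (h : ∀ d : ℕ, {i | e i ≤ d}.Finite) (h' : ∀ d : ℕ, {i | e' i ≤ d}.Finite) :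
    Summable fun i => (monomial (E i).toNat (c i) : PowerSeries A) := by
  refine summable_monomial E c fun d => ((h d).prod (h' d)).subset fun i hi => ?_
  have := h0 i.1; have := h0' i.2
  have hi' : E i ≤ d := hi
  rw [hE] at hi'
  refine Set.mem_prod.2 ⟨?_, ?_⟩
  · change e i.1 ≤ d; omega
  · change e' i.2 ≤ d; omega

theorem tsum_pairs {e e' : ℤ → ℤ} {c c' : ℤ → A} {C : ℤ × ℤ → A} {E : ℤ × ℤ → ℤ}
    (σ : ℤ × ℤ ≃ ℤ × ℤ) (hE : ∀ i, E (σ i) = e i.1 + e' i.2) (hC : ∀ i, C (σ i) = c i.1 * c' i.2)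
    (h0 : ∀ i, 0 ≤ e i) (h0' : ∀ i, 0 ≤ e' i)
    (h : ∀ d : ℕ, {i | e i ≤ d}.Finite) (h' : ∀ d : ℕ, {i | e' i ≤ d}.Finite) :
    (Summable fun i => (monomial (E i).toNat (C i) : PowerSeries A)) ∧
    ∑' i, (monomial (E i).toNat (C i) : PowerSeries A) =
      (∑' i, monomial (e i).toNat (c i)) * ∑' i, monomial (e' i).toNat (c' i) := by
  constructor
  · rw [← σ.summable_iff]
    exact summable_pairs (E := fun i => E (σ i)) hE h0 h0' h h'
  · rw [tsum_mul_tsum_monomial e c e' c' h0 h0' h h', ← σ.tsum_eq]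
    exact tsum_congr fun i => by rw [hE, hC]

theorem gauss_nonneg (a : ℤ) (ha : 0 < a) {r : ℕ} (hr : r ≤ 1) (n : ℤ) : 0 ≤ a * (n * (n + r)) :=
  mul_nonneg ha.le (mul_add_nonneg n hr)

theorem C_mul_tsum_monomial {ι : Type*} (a : A) (e : ι → ℤ) (c : ι → A)
    (h : ∀ d : ℕ, {i | e i ≤ d}.Finite) :
    C a * ∑' i, (monomial (e i).toNat (c i) : PowerSeries A) =
      ∑' i, monomial (e i).toNat (a * c i) := by
  rw [← (summable_monomial e c h).tsum_mul_left]
  refine tsum_congr fun i => ?_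
  rw [← monomial_zero_eq_C_apply, monomial_mul_monomial, zero_add]

/-- Common mechanism of the theta identities: in the coordinates (s + t, s - t) and (s + t + 1, s -
t) of the two halves of ℤ² the exponent separates into a part in s and a part in t, so a double
series becomes a sum of two products. The bijection `σ` shifts or reflects the odd half to bring its
exponents to normal form. -/
theorem tsum_monomial_lattice {e₁ e₁' e₂ e₂' : ℤ → ℤ} {c₁ c₁' c₂ c₂' : ℤ → A} (E : ℤ × ℤ → ℤ)
    (C : ℤ × ℤ → A) (σ : ℤ × ℤ ≃ ℤ × ℤ)
    (hE₁ : ∀ s t, E (s + t, s - t) = e₁ s + e₁' t) (hC₁ : ∀ s t, C (s + t, s - t) = c₁ s * c₁' t)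
    (hE₂ : ∀ s t, E ((σ (s, t)).1 + (σ (s, t)).2 + 1, (σ (s, t)).1 - (σ (s, t)).2) = e₂ s + e₂' t)
    (hC₂ : ∀ s t, C ((σ (s, t)).1 + (σ (s, t)).2 + 1, (σ (s, t)).1 - (σ (s, t)).2) = c₂ s * c₂' t)
    (h₁ : ∀ i, 0 ≤ e₁ i) (h₁' : ∀ i, 0 ≤ e₁' i) (h₂ : ∀ i, 0 ≤ e₂ i) (h₂' : ∀ i, 0 ≤ e₂' i)
    (f₁ : ∀ d : ℕ, {i | e₁ i ≤ d}.Finite) (f₁' : ∀ d : ℕ, {i | e₁' i ≤ d}.Finite)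
    (f₂ : ∀ d : ℕ, {i | e₂ i ≤ d}.Finite) (f₂' : ∀ d : ℕ, {i | e₂' i ≤ d}.Finite) :
    ∑' i, (monomial (E i).toNat (C i) : PowerSeries A) =
      (∑' i, monomial (e₁ i).toNat (c₁ i)) * (∑' i, monomial (e₁' i).toNat (c₁' i)) +
      (∑' i, monomial (e₂ i).toNat (c₂ i)) * (∑' i, monomial (e₂' i).toNat (c₂' i)) := by
  have t₁ := tsum_pairs (A := A) (E := fun i => E (i.1 + i.2, i.1 - i.2))
    (C := fun i => C (i.1 + i.2, i.1 - i.2)) (Equiv.refl _) (fun i => hE₁ i.1 i.2)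
    (fun i => hC₁ i.1 i.2) h₁ h₁' f₁ f₁'
  have t₂ := tsum_pairs (A := A) (E := fun i => E (i.1 + i.2 + 1, i.1 - i.2))
    (C := fun i => C (i.1 + i.2 + 1, i.1 - i.2)) σ (fun i => hE₂ i.1 i.2)
    (fun i => hC₂ i.1 i.2) h₂ h₂' f₂ f₂'
  rw [tsum_lattice (fun i => (monomial (E i).toNat (C i) : PowerSeries A)) t₁.1 t₂.1, t₁.2, t₂.2]

theorem X_mul_C_mul_tsum_monomial {ι : Type*} (a : A) (e : ι → ℤ) (c : ι → A) (h0 : ∀ i, 0 ≤ e i)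
    (h : ∀ d : ℕ, {i | e i ≤ d}.Finite) :
    X * C a * ∑' i, (monomial (e i).toNat (c i) : PowerSeries A) =
      ∑' i, monomial (e i + 1).toNat (a * c i) := by
  rw [mul_assoc, C_mul_tsum_monomial a e c h,
    ← (summable_monomial e (fun i => a * c i) h).tsum_mul_left]
  refine tsum_congr fun i => ?_
  rw [Int.toNat_add (h0 i) zero_le_one, X_eq, monomial_mul_monomial, one_mul, add_comm,
    Int.toNat_one]

/-- The exponent m² + n² equals 2s² + 2t² on the even half and 2s(s+1) + 2t(t+1) + 1 on the odd
half, while m + n depends on s alone. -/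
theorem gaussSum_zero_sq (v : Aˣ) :
    (gaussSum 1 0 v : PowerSeries A) ^ 2 = gaussSum 2 0 (v ^ 2) * gaussSum 2 0 1 +
      X * C (v : A) * (gaussSum 2 1 (v ^ 2) * gaussSum 2 1 1) := by
  have h3 : X * C (v : A) * gaussSum 2 1 (v ^ 2) =
      ∑' n : ℤ, (monomial (2 * (n * (n + (1 : ℕ))) + 1).toNat
        (v * (((v ^ 2) ^ n : Aˣ) : A)) : PowerSeries A) :=
    X_mul_C_mul_tsum_monomial _ (fun n : ℤ => 2 * (n * (n + (1 : ℕ)))) _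
      (gauss_nonneg 2 two_pos le_rfl) (finite_quadratic 2 two_pos le_rfl)
  rw [sq, gaussSum_mul_gaussSum 0 0 zero_le_one zero_le_one, ← mul_assoc (X * C (v : A)), h3,
    gaussSum, gaussSum, gaussSum]
  refine tsum_monomial_lattice
    (fun i => i.1 * (i.1 + (0 : ℕ)) + i.2 * (i.2 + (0 : ℕ)))
    (fun i => ((v ^ i.1 * v ^ i.2 : Aˣ) : A)) (Equiv.refl _)
    (fun s t => by push_cast; ring)
    (fun s t => by
      rw [← Units.val_mul]; congr 1
      rw [one_zpow, mul_one, ← zpow_add, ← zpow_natCast, ← zpow_mul]; congr 1; push_cast; ring)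
    (fun s t => by simp only [Equiv.refl_apply]; push_cast; ring)
    (fun s t => by
      rw [← Units.val_mul, ← Units.val_mul, Equiv.refl_apply]; congr 1
      rw [one_zpow, mul_one, ← zpow_add, ← zpow_natCast, ← zpow_mul, ← zpow_one_add]; congr 1
      push_cast; ring)
    (gauss_nonneg 2 two_pos zero_le_one) (gauss_nonneg 2 two_pos zero_le_one)
    (fun n => (gauss_nonneg 2 two_pos le_rfl n).trans (by omega))
    (gauss_nonneg 2 two_pos le_rfl)
    (finite_quadratic 2 two_pos zero_le_one) (finite_quadratic 2 two_pos zero_le_one)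
    (fun d => (finite_quadratic 2 two_pos le_rfl d).subset fun n hn => by
      simp only [Set.mem_ofPred_eq] at hn ⊢; omega) (finite_quadratic 2 two_pos le_rfl)

/-- The exponent m(m+1) + n(n+1) equals 2s(s+1) + 2t² on the even half and, after the shift of s by
one, 2s² + 2t(t+1) on the odd half, where m + n = 2s - 1. -/
theorem gaussSum_one_sq (v : Aˣ) :
    (gaussSum 1 1 v : PowerSeries A) ^ 2 = gaussSum 2 1 (v ^ 2) * gaussSum 2 0 1 +
      C ((v⁻¹ : Aˣ) : A) * (gaussSum 2 0 (v ^ 2) * gaussSum 2 1 1) := by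
  rw [sq, gaussSum_mul_gaussSum 1 1 le_rfl le_rfl, ← mul_assoc (C _), gaussSum, gaussSum, gaussSum,
    gaussSum, C_mul_tsum_monomial _ _ _ (finite_quadratic 2 two_pos zero_le_one)]
  refine tsum_monomial_lattice
    (fun i => i.1 * (i.1 + (1 : ℕ)) + i.2 * (i.2 + (1 : ℕ)))
    (fun i => ((v ^ i.1 * v ^ i.2 : Aˣ) : A)) ((Equiv.subRight 1).prodCongr (Equiv.refl _))
    (fun s t => by push_cast; ring)
    (fun s t => by
      rw [← Units.val_mul]; congr 1
      rw [one_zpow, mul_one, ← zpow_add, ← zpow_natCast, ← zpow_mul]; congr 1; push_cast; ring)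
    (fun s t => by
      simp only [Equiv.prodCongr_apply, Prod.map, Equiv.refl_apply, Equiv.subRight_apply]
      push_cast; ring)
    (fun s t => by
      rw [← Units.val_mul, ← Units.val_mul]
      simp only [Equiv.prodCongr_apply, Prod.map, Equiv.refl_apply, Equiv.subRight_apply]
      congr 1
      rw [one_zpow, mul_one, ← zpow_add, ← zpow_natCast, ← zpow_mul, ← zpow_neg_one, ← zpow_add]
      congr 1; push_cast; ring)
    (gauss_nonneg 2 two_pos le_rfl) (gauss_nonneg 2 two_pos zero_le_one)
    (gauss_nonneg 2 two_pos zero_le_one) (gauss_nonneg 2 two_pos le_rfl)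
    (finite_quadratic 2 two_pos le_rfl) (finite_quadratic 2 two_pos zero_le_one)
    (finite_quadratic 2 two_pos zero_le_one) (finite_quadratic 2 two_pos le_rfl)

/-- On both halves m(m+1) + n² becomes s(2s+1) + t(2t+1), the odd half after reflection. There m + n
is 2s, respectively -2s - 1, so the series in t is a common factor. -/
theorem gaussSum_one_mul_zero (v : Aˣ) :
    (gaussSum 1 1 v * gaussSum 1 0 v : PowerSeries A) =
      (quarterSum (v ^ 2) + C ((v⁻¹ : Aˣ) : A) * quarterSum (v⁻¹ ^ 2)) * quarterSum 1 := by
  rw [gaussSum_mul_gaussSum 1 0 le_rfl zero_le_one, add_mul, quarterSum, quarterSum, quarterSum,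
    C_mul_tsum_monomial _ _ _ finite_two_quadratic]
  refine tsum_monomial_lattice
    (fun i => i.1 * (i.1 + (1 : ℕ)) + i.2 * (i.2 + (0 : ℕ)))
    (fun i => ((v ^ i.1 * v ^ i.2 : Aˣ) : A)) reflectEquiv
    (fun s t => by push_cast; ring)
    (fun s t => by
      rw [← Units.val_mul]; congr 1
      rw [one_zpow, mul_one, ← zpow_add, ← zpow_natCast, ← zpow_mul]; congr 1; push_cast; ring)
    (fun s t => by simp only [reflectEquiv, Equiv.coe_fn_mk]; push_cast; ring)
    (fun s t => by
      rw [← Units.val_mul, ← Units.val_mul]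
      simp only [reflectEquiv, Equiv.coe_fn_mk]
      congr 1
      rw [one_zpow, mul_one, ← zpow_add, ← zpow_natCast, ← zpow_mul, ← zpow_neg_one, ← zpow_mul,
        ← zpow_add]
      congr 1; push_cast; ring)
    two_quadratic_nonneg two_quadratic_nonneg two_quadratic_nonneg two_quadratic_nonneg
    finite_two_quadratic finite_two_quadratic finite_two_quadratic finite_two_quadratic

/-- `∑ₙ (2 n + r) X^{n (n + r)} zⁿ`. -/
def gaussMoment (r : ℕ) (z : Aˣ) : PowerSeries A :=
  ∑' n : ℤ, monomial (1 * (n * (n + r))).toNat (((2 * n + r : ℤ) : A) * (z ^ n : Aˣ))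

/-- Same decomposition as for the product, with the extra weight 2m + 1 - 2n. It is 4t + 1 on the
even half and -(4t + 1) on the reflected odd half, so again the series in t factors out, now with a
minus sign between the two series in s. -/
theorem gaussMoment_wronskian (v : Aˣ) :
    (gaussMoment 1 v * gaussSum 1 0 v - gaussSum 1 1 v * gaussMoment 0 v : PowerSeries A) =
      (quarterSum (v ^ 2) - C ((v⁻¹ : Aˣ) : A) * quarterSum (v⁻¹ ^ 2)) * quarterMoment := by
  have hz := fun n : ℤ => gauss_nonneg (r := 0) 1 one_pos zero_le_one n
  have ho := fun n : ℤ => gauss_nonneg (r := 1) 1 one_pos le_rfl n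
  have fz := finite_quadratic (r := 0) 1 one_pos zero_le_one
  have fo := finite_quadratic (r := 1) 1 one_pos le_rfl
  have hs := fun c : ℤ × ℤ → A => summable_pairs (c := c)
    (E := fun i => 1 * (i.1 * (i.1 + (1 : ℕ))) + 1 * (i.2 * (i.2 + (0 : ℕ)))) (fun i => rfl) ho hz
    fo fz
  rw [gaussMoment, gaussSum, gaussMoment, gaussSum, tsum_mul_tsum_monomial _ _ _ _ ho hz fo fz,
    tsum_mul_tsum_monomial _ _ _ _ ho hz fo fz, ← Summable.tsum_sub
      (hs _) (hs _)]
  have h3 : ∀ i : ℤ × ℤ, (monomial (1 * (i.1 * (i.1 + (1 : ℕ))) + 1 * (i.2 * (i.2 + (0 : ℕ)))).toNat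
        (((2 * i.1 + (1 : ℕ) : ℤ) : A) * (v ^ i.1 : Aˣ) * (v ^ i.2 : Aˣ)) : PowerSeries A) -
      monomial (1 * (i.1 * (i.1 + (1 : ℕ))) + 1 * (i.2 * (i.2 + (0 : ℕ)))).toNat
        ((v ^ i.1 : Aˣ) * (((2 * i.2 + (0 : ℕ) : ℤ) : A) * (v ^ i.2 : Aˣ))) =
      monomial (1 * (i.1 * (i.1 + (1 : ℕ))) + 1 * (i.2 * (i.2 + (0 : ℕ)))).toNat
        (((2 * i.1 + (1 : ℕ) - (2 * i.2 + (0 : ℕ)) : ℤ) : A) * (v ^ i.1 * v ^ i.2 : Aˣ)) := by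
    intro i
    rw [← map_sub]; congr 1; push_cast; ring
  rw [tsum_congr h3, sub_eq_add_neg (quarterSum _), ← neg_mul, ← map_neg, add_mul, quarterSum,
    quarterSum, quarterMoment, C_mul_tsum_monomial _ _ _ finite_two_quadratic]
  refine tsum_monomial_lattice
    (fun i => 1 * (i.1 * (i.1 + (1 : ℕ))) + 1 * (i.2 * (i.2 + (0 : ℕ))))
    (fun i => ((2 * i.1 + (1 : ℕ) - (2 * i.2 + (0 : ℕ)) : ℤ) : A) * (v ^ i.1 * v ^ i.2 : Aˣ))
    reflectEquiv
    (fun s t => by push_cast; ring)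
    (fun s t => by
      rw [mul_comm]
      congr 2
      · rw [← zpow_add, ← zpow_natCast, ← zpow_mul]; congr 1; push_cast; ring
      · push_cast; ring)
    (fun s t => by simp only [reflectEquiv, Equiv.coe_fn_mk]; push_cast; ring)
    (fun s t => by
      simp only [reflectEquiv, Equiv.coe_fn_mk]
      rw [neg_mul, ← Units.val_mul, mul_comm, neg_mul, ← mul_neg, ← Int.cast_neg]
      congr 2
      · rw [← zpow_add, ← zpow_natCast, ← zpow_mul, ← zpow_neg_one, ← zpow_mul,
          ← zpow_add]
        congr 1; push_cast; ring
      · push_cast; ring)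
    two_quadratic_nonneg two_quadratic_nonneg two_quadratic_nonneg two_quadratic_nonneg
    finite_two_quadratic finite_two_quadratic finite_two_quadratic finite_two_quadratic

end Gaussian

/-! ### Infinite products of power series -/

section Products

open PowerSeries

variable {A : Type*} [CommRing A]

/-- Reduction of power series modulo `X ^ d`. -/
def modX (d : ℕ) : PowerSeries A →+* PowerSeries A ⧸ Ideal.span {(X : PowerSeries A) ^ d} :=
  Ideal.Quotient.mk _

theorem modX_eq_iff {d : ℕ} {f g : PowerSeries A} :
    modX d f = modX d g ↔ ∀ m < d, coeff m f = coeff m g := by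
  rw [modX, Ideal.Quotient.mk_eq_mk_iff_sub_mem, Ideal.mem_span_singleton, X_pow_dvd_iff]
  simp only [map_sub, sub_eq_zero]

theorem modX_mono {d d' : ℕ} (h : d ≤ d') {f g : PowerSeries A} (hfg : modX d' f = modX d' g) :
    modX d f = modX d g :=
  modX_eq_iff.2 fun m hm => modX_eq_iff.1 hfg m (hm.trans_le h)

theorem eq_of_modX {f g : PowerSeries A} (h : ∀ d, modX d f = modX d g) : f = g :=
  ext fun m => modX_eq_iff.1 (h (m + 1)) m m.lt_succ_self

theorem modX_X_pow {d e : ℕ} (h : d ≤ e) : modX d (X ^ e : PowerSeries A) = 0 := by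
  rw [← map_zero (modX d), modX_eq_iff]
  intro m hm
  rw [coeff_X_pow, if_neg (by omega), map_zero]

theorem modX_one_sub_X_pow {d e : ℕ} (h : d ≤ e) (u : A) :
    modX d (1 - X ^ e * C u : PowerSeries A) = 1 := by
  rw [map_sub, map_mul, modX_X_pow h, zero_mul, sub_zero, map_one]

/-- The factors of index at least M ≥ d - 1 are 1 modulo X^d. Every identity of infinite products
below is thereby checked on finite products, one d at a time. -/
theorem modX_infiniteProduct {f : ℕ → PowerSeries A} (hf : ∀ j, modX (j + 1) (f j) = 1) {d M : ℕ}
    (h : d ≤ M + 1) : modX d (infiniteProduct f) = ∏ j ∈ Finset.range M, modX d (f j) := by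
  rw [← map_prod, modX_eq_iff]
  intro m hm
  rw [infiniteProduct, coeff_mk]
  obtain ⟨c, rfl⟩ : ∃ c, M = m + c := ⟨M - m, by omega⟩
  clear h hm
  induction c with
  | zero => rfl
  | succ c ih =>
    rw [ih, ← add_assoc, Finset.prod_range_succ]
    refine modX_eq_iff.1 ?_ m m.lt_succ_self
    rw [map_mul, modX_mono (d := m + 1) (by omega) ((hf (m + c)).trans (map_one _).symm), map_one,
      mul_one]

theorem infiniteProduct_mul {f g : ℕ → PowerSeries A} (hf : ∀ j, modX (j + 1) (f j) = 1)
    (hg : ∀ j, modX (j + 1) (g j) = 1) :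
    infiniteProduct (fun j => f j * g j) = infiniteProduct f * infiniteProduct g := by
  refine eq_of_modX fun d => ?_
  rw [map_mul, modX_infiniteProduct hf d.le_succ, modX_infiniteProduct hg d.le_succ,
    modX_infiniteProduct (fun j => by rw [map_mul, hf, hg, mul_one]) d.le_succ,
    ← Finset.prod_mul_distrib]
  simp only [map_mul]

theorem infiniteProduct_one : infiniteProduct (fun _ => (1 : PowerSeries A)) = 1 := by
  refine eq_of_modX fun d => ?_
  rw [modX_infiniteProduct (fun j => map_one _) d.le_succ]; simp

theorem map_infiniteProduct {B : Type*} [CommRing B] (φ : A →+* B) (f : ℕ → PowerSeries A) :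
    PowerSeries.map φ (infiniteProduct f) = infiniteProduct fun j => PowerSeries.map φ (f j) := by
  ext m
  simp only [coeff_map, infiniteProduct, coeff_mk, ← map_prod]

theorem constantCoeff_infiniteProduct (f : ℕ → PowerSeries A) :
    constantCoeff (infiniteProduct f) = 1 := by
  rw [← coeff_zero_eq_constantCoeff_apply, infiniteProduct, coeff_mk]; simp

theorem isUnit_infiniteProduct (f : ℕ → PowerSeries A) : IsUnit (infiniteProduct f) := by
  rw [isUnit_iff_constantCoeff, constantCoeff_infiniteProduct]; exact isUnit_one

/-- `∏_{j ≥ 1} (1 - u X^{2j})`. -/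
def evenProd (u : A) : PowerSeries A := infiniteProduct fun j => 1 - X ^ (2 * (j + 1)) * C u

/-- `∏_{j ≥ 1} (1 - u X^{2j-1})`. -/
def oddProd (u : A) : PowerSeries A := infiniteProduct fun j => 1 - X ^ (2 * j + 1) * C u

theorem modX_evenProd (u : A) {d M : ℕ} (h : d ≤ M + 1) :
    modX d (evenProd u) = ∏ j ∈ Finset.range M, modX d (1 - X ^ (2 * (j + 1)) * C u) :=
  modX_infiniteProduct (fun j => modX_one_sub_X_pow (by omega) u) h

theorem modX_oddProd (u : A) {d M : ℕ} (h : d ≤ M + 1) :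
    modX d (oddProd u) = ∏ j ∈ Finset.range M, modX d (1 - X ^ (2 * j + 1) * C u) :=
  modX_infiniteProduct (fun j => modX_one_sub_X_pow (by omega) u) h

theorem map_evenProd {B : Type*} [CommRing B] (φ : A →+* B) (u : A) :
    PowerSeries.map φ (evenProd u) = evenProd (φ u) := by
  rw [evenProd, map_infiniteProduct, evenProd]; simp

theorem map_oddProd {B : Type*} [CommRing B] (φ : A →+* B) (u : A) :
    PowerSeries.map φ (oddProd u) = oddProd (φ u) := by
  rw [oddProd, map_infiniteProduct, oddProd]; simp

theorem isUnit_evenProd (u : A) : IsUnit (evenProd u) := isUnit_infiniteProduct _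
theorem isUnit_oddProd (u : A) : IsUnit (oddProd u) := isUnit_infiniteProduct _

/-- Euler's identity between odd and distinct parts. After multiplication by ∏(1 - X^{2j}), the
factors pair up to 1 - X^{4j} and 1 - X^{4j-2}, which together are all the 1 - X^{2j}. -/
theorem euler_odd_parts : evenProd (-1 : A) * oddProd 1 * oddProd (-1) = 1 := by
  have h : evenProd (1 : A) * (evenProd (-1 : A) * oddProd 1 * oddProd (-1)) = evenProd 1 := by
    refine eq_of_modX fun d => ?_
    have h2 : ∀ M : ℕ, ∏ j ∈ Finset.range (2 * M), modX d (1 - X ^ (2 * (j + 1)) * C (1 : A)) =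
        ∏ j ∈ Finset.range M, (modX d (1 - X ^ (2 * (2 * j + 1)) * C (1 : A)) *
          modX d (1 - X ^ (2 * (2 * j + 1 + 1)) * C (1 : A))) := by
      intro M
      induction M with
      | zero => simp
      | succ M ih =>
        rw [show 2 * (M + 1) = 2 * M + 1 + 1 by ring, Finset.prod_range_succ,
          Finset.prod_range_succ, ih, Finset.prod_range_succ _ M, mul_assoc]
    simp only [map_mul]
    conv_rhs => rw [modX_evenProd (M := 2 * d) (1 : A) (by omega), h2]
    rw [modX_evenProd (M := d) (1 : A) (by omega),
      modX_evenProd (M := d) (-1 : A) (by omega), modX_oddProd (M := d) (1 : A) (by omega),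
      modX_oddProd (M := d) (-1 : A) (by omega), ← Finset.prod_mul_distrib,
      ← Finset.prod_mul_distrib, ← Finset.prod_mul_distrib]
    refine Finset.prod_congr rfl fun j _ => ?_
    simp only [← map_mul]
    congr 1
    simp only [map_neg, map_one]
    ring
  exact (isUnit_evenProd 1).mul_left_cancel (h.trans (mul_one _).symm)

end Products

/-! ### The triple product -/

section TripleProduct

open PowerSeries
open scoped PowerSeries.WithPiTopology

variable {A : Type*} [CommRing A]

theorem isUnit_evenEuler (k : ℕ) : IsUnit (evenEuler (X : PowerSeries A) k) := by
  rw [isUnit_iff_constantCoeff, evenEuler, map_prod]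
  simp

theorem modX_evenEuler {d k l : ℕ} (hk : d ≤ k + 1) (hl : d ≤ l + 1) :
    modX d (evenEuler (X : PowerSeries A) k) = modX d (evenEuler X l) := by
  have h : ∀ n, evenEuler (X : PowerSeries A) n =
      ∏ j ∈ Finset.range n, (1 - X ^ (2 * (j + 1)) * C 1) := fun n => by simp [evenEuler]
  rw [h, h, map_prod, map_prod, ← modX_evenProd 1 hk, ← modX_evenProd 1 hl]

/-- The limit m → ∞ of the Gaussian binomial coefficients. If the exponent n(n+r) is below d then
|n| ≤ d, so m ± n ≥ d and all the Euler products involved agree modulo X^d. Otherwise both sides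
vanish modulo X^d. -/
theorem modX_evenEuler_mul_tripleCoeff {r d m : ℕ} (hr : r ≤ 1) (hm : 2 * d ≤ m) (n : ℤ) :
    modX d (evenEuler (X : PowerSeries A) m * tripleCoeff X r m n) =
      modX d (X ^ (n * (n + r)).toNat) := by
  have hr' : (r : ℤ) ≤ 1 := by exact_mod_cast hr
  have hr0 : (0 : ℤ) ≤ r := by positivity
  rcases lt_or_ge m n.natAbs with hn | hn
  · rw [tripleCoeff_eq_zero _ _ _ _ hn, mul_zero, modX_X_pow, map_zero]
    rw [Int.le_toNat (mul_add_nonneg n hr)]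
    rcases le_or_gt 0 n with h0 | h0
    · have : (m : ℤ) < n := by omega
      have h1 : (2 : ℤ) * d ≤ m := by exact_mod_cast hm
      nlinarith
    · have : (m : ℤ) < -n := by omega
      have h1 : (2 : ℤ) * d ≤ m := by exact_mod_cast hm
      nlinarith
  · obtain ⟨j, hj⟩ : ∃ j : ℕ, (j : ℤ) = n + m := ⟨(n + m).toNat, by omega⟩
    obtain ⟨i, hi⟩ : ∃ i : ℕ, (i : ℤ) = m - n := ⟨(m - n).toNat, by omega⟩
    have key := evenEuler_mul_tripleCoeff (X : PowerSeries A) hr m i j (by omega)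
    rw [show (j : ℤ) - m = n by omega] at key
    rcases le_or_gt d (n * (n + r)).toNat with hd | hd
    · have hu := (isUnit_evenEuler (A := A) i).mul (isUnit_evenEuler j)
      have : modX d (tripleCoeff (X : PowerSeries A) r m n) = 0 := by
        refine (hu.map (modX d)).mul_left_cancel ?_
        rw [← map_mul, key, map_mul, modX_X_pow hd, mul_zero, mul_zero]
      rw [map_mul, this, modX_X_pow hd, mul_zero]
    · have hd' : n * (n + r) < d := by
        have := mul_add_nonneg n hr
        omega
      have hn1 : n ≤ d := by
        by_contra hc
        nlinarith
      have hn2 : -n ≤ d := by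
        by_contra hc
        nlinarith
      have h1 := congrArg (modX d) key
      rw [map_mul, map_mul, map_mul, modX_evenEuler (l := m) (show d ≤ i + 1 by omega) (by omega),
        modX_evenEuler (l := m) (show d ≤ j + 1 by omega) (by omega),
        modX_evenEuler (l := m) (show d ≤ 2 * m + 1 by omega) (by omega), mul_assoc, ← map_mul] at h1
      exact ((isUnit_evenEuler (A := A) m).map (modX d)).mul_left_cancel h1

theorem coeff_tsum_monomial [TopologicalSpace A] [DiscreteTopology A] {ι : Type*} (e : ι → ℤ)
    (c : ι → A) (h : ∀ d : ℕ, {i | e i ≤ d}.Finite) (d : ℕ) (s : Finset ι)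
    (hs : ∀ i ∉ s, (d : ℤ) < e i) :
    coeff d (∑' i, (monomial (e i).toNat (c i) : PowerSeries A)) =
      ∑ i ∈ s, if d = (e i).toNat then c i else 0 := by
  have h1 := ((PowerSeries.WithPiTopology.hasSum_iff_hasSum_coeff A).1
    (summable_monomial e c h).hasSum) d
  refine h1.unique ?_
  simp only [coeff_monomial]
  refine hasSum_sum_of_ne_finset_zero fun i hi => if_neg ?_
  have := hs i hi
  omega

theorem lt_gauss {r d m : ℕ} (hr : r ≤ 1) (hd : d ≤ m) (n : ℤ)
    (hn : n ∉ Finset.Icc (-(m : ℤ) - 1) m) : (d : ℤ) < 1 * (n * (n + r)) := by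
  have hr' : (r : ℤ) ≤ 1 := by exact_mod_cast hr
  have hr0 : (0 : ℤ) ≤ r := by positivity
  have hd' : (d : ℤ) ≤ m := by exact_mod_cast hd
  rw [Finset.mem_Icc, not_and_or, not_le, not_le] at hn
  rcases hn with hn | hn <;> nlinarith

theorem modX_tripleProduct [TopologicalSpace A] [DiscreteTopology A] {r d m : ℕ} (hr : r ≤ 1)
    (hm : 2 * d ≤ m) (z : Aˣ) :
    modX d (evenEuler X m * ∏ j ∈ Finset.range m, ((1 + X ^ (2 * j + 1 + r) * C (z : A)) *
      (1 + X ^ (2 * j + 1 - r) * C ((z⁻¹ : Aˣ) : A)))) = modX d (gaussSum 1 r z) := by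
  have hz := prod_eq_finsum_tripleCoeff (X : PowerSeries A) hr
    (Units.map (C (R := A)).toMonoidHom z) m
  simp only [← map_inv, Units.coe_map, RingHom.toMonoidHom_eq_coe, MonoidHom.coe_coe,
    ← map_zpow] at hz
  rw [hz, finsum_eq_sum_of_support_subset (s := Finset.Icc (-(m : ℤ) - 1) m), Finset.mul_sum,
    map_sum]
  · have h1 : ∀ n ∈ Finset.Icc (-(m : ℤ) - 1) m, modX d (evenEuler X m *
        (tripleCoeff X r m n * C ((z ^ n : Aˣ) : A))) =
        modX d (X ^ (n * (n + r)).toNat * C ((z ^ n : Aˣ) : A)) := fun n _ => by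
      rw [← mul_assoc, map_mul, modX_evenEuler_mul_tripleCoeff hr hm, ← map_mul]
    rw [Finset.sum_congr rfl h1, ← map_sum, modX_eq_iff]
    intro k hk
    rw [gaussSum, coeff_tsum_monomial _ _ (finite_quadratic 1 one_pos hr) k _
      (lt_gauss hr (show k ≤ m by omega)), map_sum]
    refine Finset.sum_congr rfl fun n _ => ?_
    rw [coeff_mul_C, coeff_X_pow, one_mul, ite_mul, one_mul, zero_mul]
  · intro n hn
    by_contra hc
    refine hn ?_
    simp only
    rw [tripleCoeff_eq_zero, zero_mul]
    simp only [Finset.coe_Icc, Set.mem_Icc] at hc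
    omega

theorem gaussSum_zero_eq_prod [TopologicalSpace A] [DiscreteTopology A] (z : Aˣ) :
    gaussSum 1 0 z = evenProd 1 * oddProd (-(z : A)) * oddProd (-((z⁻¹ : Aˣ) : A)) := by
  refine eq_of_modX fun d => ?_
  rw [← modX_tripleProduct zero_le_one le_rfl, map_mul, map_mul, map_mul,
    modX_evenProd (M := 2 * d) _ (by omega), modX_oddProd (M := 2 * d) _ (by omega),
    modX_oddProd (M := 2 * d) _ (by omega), evenEuler, ← Finset.prod_mul_distrib,
    ← Finset.prod_mul_distrib, map_prod, map_prod, ← Finset.prod_mul_distrib]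
  refine Finset.prod_congr rfl fun j _ => ?_
  simp only [← map_mul]
  congr 1
  simp only [map_neg, map_one, add_zero, tsub_zero]
  ring

/-- The factors in z⁻¹ begin with exponent 0, which splits off 1 + z⁻¹. The unpaired last factor in
z is 1 modulo X^d. -/
theorem gaussSum_one_eq_prod [TopologicalSpace A] [DiscreteTopology A] (z : Aˣ) :
    gaussSum 1 1 z = C (1 + ((z⁻¹ : Aˣ) : A)) * evenProd 1 * evenProd (-(z : A)) *
      evenProd (-((z⁻¹ : Aˣ) : A)) := by
  refine eq_of_modX fun d => ?_
  have h : ∏ j ∈ Finset.range (2 * d + 1), ((1 + X ^ (2 * j + 1 + 1) * C (z : A)) *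
      (1 + X ^ (2 * j + 1 - 1) * C ((z⁻¹ : Aˣ) : A))) =
      (1 + X ^ (2 * (2 * d) + 1 + 1) * C (z : A)) * C (1 + ((z⁻¹ : Aˣ) : A)) *
      ∏ j ∈ Finset.range (2 * d), ((1 + X ^ (2 * j + 1 + 1) * C (z : A)) *
        (1 + X ^ (2 * (j + 1) + 1 - 1) * C ((z⁻¹ : Aˣ) : A))) := by
    rw [Finset.prod_mul_distrib, Finset.prod_range_succ, Finset.prod_range_succ',
      Finset.prod_mul_distrib]
    simp only [mul_zero, zero_add, tsub_self, pow_zero, one_mul, map_add, map_one]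
    ring
  have h1 : modX d (1 + X ^ (2 * (2 * d) + 1 + 1) * C (z : A)) = 1 := by
    rw [map_add, map_mul, modX_X_pow (by omega), zero_mul, map_one, add_zero]
  rw [← modX_tripleProduct le_rfl (show 2 * d ≤ 2 * d + 1 by omega), h, map_mul, map_mul, map_mul,
    h1, one_mul, modX_evenEuler (l := 2 * d) (by omega) (by omega), map_mul, map_mul, map_mul,
    modX_evenProd (M := 2 * d) _ (by omega), modX_evenProd (M := 2 * d) _ (by omega),
    modX_evenProd (M := 2 * d) _ (by omega), mul_left_comm, mul_assoc, mul_assoc, evenEuler,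
    ← Finset.prod_mul_distrib, map_prod, map_prod, ← Finset.prod_mul_distrib,
    ← Finset.prod_mul_distrib]
  congr 1
  refine Finset.prod_congr rfl fun j _ => ?_
  simp only [← map_mul]
  congr 1
  simp only [map_neg, map_one, add_tsub_cancel_right]
  ring

end TripleProduct

/-! ### The differential equation of the elliptic function -/

section EllipticODE

open PowerSeries
open scoped PowerSeries.WithPiTopology

variable {A : Type*} [CommRing A]

theorem mk_coeff_tsum_monomial [TopologicalSpace A] [DiscreteTopology A] {B : Type*} [CommRing B]
    [TopologicalSpace B] [DiscreteTopology B] {ι : Type*} (f : A →+ B) (e : ι → ℤ) (c : ι → A)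
    (h : ∀ d : ℕ, {i | e i ≤ d}.Finite) :
    (PowerSeries.mk fun d => f (coeff d (∑' i, (monomial (e i).toNat (c i) : PowerSeries A)))) =
      ∑' i, monomial (e i).toNat (f (c i)) := by
  ext d
  have hs : ∀ i ∉ (h d).toFinset, (d : ℤ) < e i := fun i hi => by
    simpa using hi
  rw [coeff_mk, coeff_tsum_monomial e c h d _ hs, coeff_tsum_monomial e _ h d _ hs, map_sum]
  exact Finset.sum_congr rfl fun i _ => by split_ifs <;> simp

variable [Algebra ℂ A]

/-- The action of a derivation on the coefficients of a power series. -/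
def coeffDerivation (D : Derivation ℂ A A) : Derivation ℂ (PowerSeries A) (PowerSeries A) :=
  Derivation.mk'
    { toFun := fun f => PowerSeries.mk fun n => D (coeff n f)
      map_add' := fun f g => by ext; simp
      map_smul' := fun a f => by ext; simp } <| fun f g => by
    ext n
    simp only [LinearMap.coe_mk, AddHom.coe_mk, coeff_mk, smul_eq_mul, map_add, coeff_mul, map_sum,
      Derivation.leibniz]
    rw [Finset.sum_add_distrib, ← Finset.Nat.sum_antidiagonal_swap (n := n)
      (f := fun i => coeff i.1 g * D (coeff i.2 f))]
    rfl

theorem coeff_coeffDerivation (D : Derivation ℂ A A) (f : PowerSeries A) (n : ℕ) :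
    coeff n (coeffDerivation D f) = D (coeff n f) :=
  coeff_mk n fun n => D (coeff n f)

theorem coeffDerivation_C (D : Derivation ℂ A A) (a : A) :
    coeffDerivation D (C a) = C (D a) := by
  ext n
  rw [coeff_coeffDerivation, coeff_C, coeff_C]
  split_ifs <;> simp

theorem coeffDerivation_map (D : Derivation ℂ A A) (f : PowerSeries ℤ) :
    coeffDerivation D (PowerSeries.map (Int.castRingHom A) f) = 0 := by
  ext n
  rw [coeff_coeffDerivation, coeff_map, eq_intCast, Derivation.map_intCast, map_zero]

theorem derivation_zpow (D : Derivation ℂ A A) (z : Aˣ) (hz : D z = z) (n : ℤ) :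
    D ((z ^ n : Aˣ) : A) = n * (z ^ n : Aˣ) := by
  induction n with
  | zero => simp
  | succ n ih =>
    rw [zpow_add_one, Units.val_mul, Derivation.leibniz, ih, hz]
    push_cast; simp only [smul_eq_mul]; ring
  | pred n ih =>
    have h := ih
    rw [show (-(n : ℤ)) = (-(n : ℤ) - 1) + 1 by ring, zpow_add_one, Units.val_mul,
      Derivation.leibniz, hz, smul_eq_mul, smul_eq_mul] at h
    refine z.isUnit.mul_left_cancel ?_
    push_cast at h ⊢
    linear_combination h

variable [TopologicalSpace A] [DiscreteTopology A]

/-- Since D acts as z d/dz, it multiplies zⁿ by n. The shift by r accounts for the missing prefactor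
z^{r/2} of the theta function. -/
theorem coeffDerivation_gaussSum (D : Derivation ℂ A A) (z : Aˣ) (hz : D z = z) (r : ℕ)
    (hr : r ≤ 1) : 2 * coeffDerivation D (gaussSum 1 r z) + r * gaussSum 1 r z = gaussMoment r z := by
  have h1 := mk_coeff_tsum_monomial
    ((2 : A) • (D : A →ₗ[ℂ] A).toAddMonoidHom + (r : A) • AddMonoidHom.id A)
    (fun n : ℤ => 1 * (n * (n + r))) (fun n => ((z ^ n : Aˣ) : A)) (finite_quadratic 1 one_pos hr)
  have h2 : gaussMoment r z = ∑' n : ℤ, (monomial (1 * (n * (n + r))).toNat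
      (((2 : A) • (D : A →ₗ[ℂ] A).toAddMonoidHom + (r : A) • AddMonoidHom.id A)
        ((z ^ n : Aˣ) : A)) : PowerSeries A) := by
    refine tsum_congr fun n => ?_
    congr 1
    simp only [AddMonoidHom.add_apply, AddMonoidHom.smul_apply, LinearMap.toAddMonoidHom_coe,
      Derivation.coeFn_coe, derivation_zpow D z hz, AddMonoidHom.id_apply, smul_eq_mul]
    push_cast; ring
  rw [h2, ← h1]
  ext d
  rw [coeff_mk, map_add, ← map_natCast (C (R := A)), ← map_ofNat (C (R := A)), coeff_C_mul,
    coeff_C_mul, coeff_coeffDerivation]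
  rfl

theorem map_gaussMoment (φ : A →+* A) (z : Aˣ) (r : ℕ) (hr : r ≤ 1) :
    PowerSeries.map φ (gaussMoment r z) = gaussMoment r (Units.map φ.toMonoidHom z) := by
  have h1 := mk_coeff_tsum_monomial φ.toAddMonoidHom
    (fun n : ℤ => 1 * (n * (n + r))) (fun n => ((2 * n + r : ℤ) : A) * ((z ^ n : Aˣ) : A))
    (finite_quadratic 1 one_pos hr)
  have h2 : gaussMoment r (Units.map φ.toMonoidHom z) = ∑' n : ℤ,
      (monomial (1 * (n * (n + r))).toNat (φ.toAddMonoidHom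
        (((2 * n + r : ℤ) : A) * ((z ^ n : Aˣ) : A))) : PowerSeries A) := by
    refine tsum_congr fun n => ?_
    congr 1
    rw [← map_zpow, RingHom.toAddMonoidHom_eq_coe, AddMonoidHom.coe_coe, map_mul, map_intCast]
    rfl
  rw [h2, ← h1]
  ext d
  rw [coeff_mk, coeff_map]
  rfl

theorem gaussSum_one_neg_one : (gaussSum 1 1 (-1) : PowerSeries A) = 0 := by
  rw [gaussSum_one_eq_prod]; simp

/-- The Wronskian of the two theta functions whose quotient is the elliptic function. -/
theorem theta_wronskian (z : Aˣ) :
    2 * (gaussSum 1 1 1 * gaussSum 1 0 1) *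
      (gaussMoment 1 (-z) * gaussSum 1 0 (-z) - gaussSum 1 1 (-z) * gaussMoment 0 (-z)) =
    2 * (gaussMoment 1 (-1) * gaussSum 1 0 (-1)) *
      (gaussSum 1 1 z * gaussSum 1 0 z : PowerSeries A) := by
  -- Replacing z by -z fixes z² and changes the sign of z⁻¹, which turns the difference in the
  -- Wronskian formula into the sum in the product formula. The values at -1 and 1 eliminate the two
  -- series that do not depend on z.
  have h1 := gaussMoment_wronskian (-z)
  have h2 := gaussSum_one_mul_zero z
  have h3 := gaussMoment_wronskian (-1 : Aˣ)
  have h4 := gaussSum_one_mul_zero (1 : Aˣ)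
  rw [gaussSum_one_neg_one, zero_mul, sub_zero] at h3
  simp only [neg_sq, inv_neg, Units.val_neg, map_neg, neg_mul, sub_neg_eq_add, inv_one, one_pow,
    Units.val_one, map_one, one_mul] at h1 h3 h4
  rw [h1, h2, h3, h4]
  ring

/-- The doubling formulas write every square through four series `gaussSum 2 _ _`, at z² and at 1;
what remains is a polynomial identity modulo z z⁻¹ = 1. The same holds for `theta_quadratic_zero`.
-/
theorem theta_quadratic_one (z : Aˣ) :
    C (z : A) * gaussSum 1 1 z ^ 2 * gaussSum 1 0 (-1) ^ 2 =
      gaussSum 1 1 1 ^ 2 * gaussSum 1 0 (-z) ^ 2 +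
      gaussSum 1 0 1 ^ 2 * (C (z : A) * gaussSum 1 1 (-z) ^ 2) := by
  have hz : C (z : A) * C ((z⁻¹ : Aˣ) : A) = 1 := by rw [← map_mul, Units.mul_inv, map_one]
  simp only [gaussSum_one_sq, gaussSum_zero_sq, neg_sq, inv_neg, Units.val_neg, map_neg, neg_mul,
    inv_one, one_pow, Units.val_one, map_one, one_mul, mul_neg]
  generalize (gaussSum 2 0 (z ^ 2) : PowerSeries A) = a
  generalize (gaussSum 2 1 (z ^ 2) : PowerSeries A) = b
  generalize (gaussSum 2 0 1 : PowerSeries A) = a0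
  generalize (gaussSum 2 1 1 : PowerSeries A) = b0
  linear_combination (2 * a * b0 * a0 ^ 2) * hz

theorem theta_quadratic_zero (z : Aˣ) :
    gaussSum 1 0 z ^ 2 * gaussSum 1 0 (-1) ^ 2 =
      gaussSum 1 0 1 ^ 2 * gaussSum 1 0 (-z) ^ 2 +
      X * gaussSum 1 1 1 ^ 2 * (C (z : A) * gaussSum 1 1 (-z) ^ 2) := by
  have hz : C (z : A) * C ((z⁻¹ : Aˣ) : A) = 1 := by rw [← map_mul, Units.mul_inv, map_one]
  simp only [gaussSum_one_sq, gaussSum_zero_sq, neg_sq, inv_neg, Units.val_neg, map_neg, neg_mul,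
    inv_one, one_pow, Units.val_one, map_one, one_mul, mul_neg, mul_one]
  generalize (gaussSum 2 0 (z ^ 2) : PowerSeries A) = a
  generalize (gaussSum 2 1 (z ^ 2) : PowerSeries A) = b
  generalize (gaussSum 2 0 1 : PowerSeries A) = a0
  generalize (gaussSum 2 1 1 : PowerSeries A) = b0
  linear_combination (2 * X * a * b0 ^ 2 * a0) * hz

/-- Jacobi's derivative formula. The theta function is differentiated at its zero z = -1, reached
from z = -y² by the specialisation φ of y to 1, and compared with the derivative of its product. -/
theorem gaussMoment_one_neg_one (D : Derivation ℂ A A) (φ : A →+* A) (y : Aˣ)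
    (hD : D y = (1 / 2 : ℂ) • (y : A)) (hφ : φ y = 1) :
    (gaussMoment 1 (-1) : PowerSeries A) = 2 * evenProd 1 ^ 3 := by
  have hD2 : 2 * D y = y := by
    rw [hD, two_mul, ← add_smul]; norm_num
  have hDz : D ((-(y ^ 2) : Aˣ) : A) = ((-(y ^ 2) : Aˣ) : A) := by
    simp only [Units.val_neg, Units.val_pow_eq_pow_val, map_neg, Derivation.leibniz_pow,
      smul_eq_mul, nsmul_eq_mul, Nat.cast_ofNat]
    linear_combination (-(y : A)) * hD2
  have hDyi : 2 * D ((y⁻¹ : Aˣ) : A) = -((y⁻¹ : Aˣ) : A) := by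
    have h0 : D ((y : A) * ((y⁻¹ : Aˣ) : A)) = 0 := by
      rw [Units.mul_inv]; exact D.map_one_eq_zero
    rw [Derivation.leibniz, smul_eq_mul, smul_eq_mul] at h0
    refine y.isUnit.mul_left_cancel ?_
    linear_combination 2 * h0 - ((y⁻¹ : Aˣ) : A) * hD2
  have hφi : φ ((y⁻¹ : Aˣ) : A) = 1 := by
    have : φ ((y : A) * ((y⁻¹ : Aˣ) : A)) = 1 := by rw [Units.mul_inv, map_one]
    rwa [map_mul, hφ, one_mul] at this
  have hyy : (y : A) * ((y⁻¹ : Aˣ) : A) = 1 := Units.mul_inv y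
  have hyi : (((y ^ 2)⁻¹ : Aˣ) : A) = ((y⁻¹ : Aˣ) : A) ^ 2 := by
    rw [← inv_pow, Units.val_pow_eq_pow_val]
  have h1 := coeffDerivation_gaussSum D (-(y ^ 2)) hDz 1 le_rfl
  have h2 : C (y : A) * gaussSum 1 1 (-(y ^ 2)) = C ((y : A) - ((y⁻¹ : Aˣ) : A)) *
      (evenProd 1 * evenProd ((y : A) ^ 2) * evenProd (((y⁻¹ : Aˣ) : A) ^ 2)) := by
    rw [gaussSum_one_eq_prod]
    simp only [inv_neg, Units.val_neg, neg_neg, Units.val_pow_eq_pow_val, hyi, ← mul_assoc,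
      ← map_mul]
    congr 4
    linear_combination (-((y⁻¹ : Aˣ) : A)) * hyy
  -- At y = 1 the factor y - y⁻¹ vanishes, so only the term in which it is differentiated survives;
  -- twice its derivative is 2 there.
  have h3 := congrArg (fun f => PowerSeries.map φ (2 * coeffDerivation D f)) h2
  simp only [Derivation.leibniz, smul_eq_mul, coeffDerivation_C, map_mul, map_add, map_C, map_sub,
    hφ, hφi, map_one, map_ofNat, sub_self, zero_mul, one_mul, zero_add, map_evenProd, map_pow,
    one_pow] at h3
  have e1 : 2 * C (φ (D y)) = (1 : PowerSeries A) := by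
    rw [← map_ofNat (C (R := A)), ← map_mul, ← map_ofNat φ, ← map_mul, hD2, hφ, map_one]
  have e2 : 2 * C (φ (D ((y⁻¹ : Aˣ) : A))) = (-1 : PowerSeries A) := by
    rw [← map_ofNat (C (R := A)), ← map_mul, ← map_ofNat φ, ← map_mul, hDyi, map_neg, hφi, map_neg,
      map_one]
  have h4 := congrArg (PowerSeries.map φ) h1
  rw [map_gaussMoment φ _ 1 le_rfl, Nat.cast_one, one_mul] at h4
  have h5 : Units.map φ.toMonoidHom (-(y ^ 2)) = -1 := by
    ext; simp [hφ]
  rw [h5] at h4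
  simp only [map_add, map_mul, map_ofNat] at h4
  rw [← h4]
  linear_combination h3 + (evenProd 1 ^ 3 - PowerSeries.map φ (gaussSum 1 1 (-(y ^ 2)))) * e1 -
    (evenProd 1 ^ 3) * e2

/-- The quotient of theta functions `g = 1 / f` satisfies `g'² = 1 - 2 δ₂ g² + ε₂ g⁴`. -/
theorem elliptic_ode (D : Derivation ℂ A A) (φ : A →+* A) (y : Aˣ)
    (hD : D y = (1 / 2 : ℂ) • (y : A)) (hφ : φ y = 1) (g : PowerSeries A)
    (hg : g * (evenProd 1 ^ 2 * oddProd ((y : A) ^ 2) * oddProd (((y⁻¹ : Aˣ) : A) ^ 2)) =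
      oddProd 1 ^ 2 * C ((y : A) - ((y⁻¹ : Aˣ) : A)) * evenProd ((y : A) ^ 2) *
        evenProd (((y⁻¹ : Aˣ) : A) ^ 2)) :
    4 * coeffDerivation D g ^ 2 = (4 + (evenProd 1 * oddProd (-1) ^ 2) ^ 4 * g ^ 2) *
      (1 + 4 * X * (evenProd 1 * evenProd (-1) ^ 2) ^ 4 * g ^ 2) := by
  have hD2 : 2 * D y = y := by
    rw [hD, two_mul, ← add_smul]; norm_num
  have hDz : D ((-(y ^ 2) : Aˣ) : A) = ((-(y ^ 2) : Aˣ) : A) := by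
    simp only [Units.val_neg, Units.val_pow_eq_pow_val, map_neg, Derivation.leibniz_pow,
      smul_eq_mul, nsmul_eq_mul, Nat.cast_ofNat]
    linear_combination (-(y : A)) * hD2
  have hyy : (y : A) * ((y⁻¹ : Aˣ) : A) = 1 := Units.mul_inv y
  have hyi : (((y ^ 2)⁻¹ : Aˣ) : A) = ((y⁻¹ : Aˣ) : A) ^ 2 := by
    rw [← inv_pow, Units.val_pow_eq_pow_val]
  have hU := coeffDerivation_gaussSum D (-(y ^ 2)) hDz 1 le_rfl
  have hT := coeffDerivation_gaussSum D (-(y ^ 2)) hDz 0 zero_le_one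
  have hW := theta_wronskian (y ^ 2)
  have hq1 := theta_quadratic_one (y ^ 2)
  have hq0 := theta_quadratic_zero (y ^ 2)
  rw [gaussMoment_one_neg_one D φ y hD hφ] at hW
  have v2 : (gaussSum 1 1 1 : PowerSeries A) = 2 * (evenProd 1 * evenProd (-1) ^ 2) := by
    rw [gaussSum_one_eq_prod]
    simp only [inv_one, Units.val_one, one_add_one_eq_two, map_ofNat]; ring
  have v3 : (gaussSum 1 0 1 : PowerSeries A) = evenProd 1 * oddProd (-1) ^ 2 := by
    rw [gaussSum_zero_eq_prod]
    simp only [inv_one, Units.val_one]; ring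
  have v4 : (gaussSum 1 0 (-1) : PowerSeries A) = evenProd 1 * oddProd 1 ^ 2 := by
    rw [gaussSum_zero_eq_prod]
    simp only [inv_neg, inv_one, Units.val_neg, Units.val_one, neg_neg]; ring
  have e0 : coeffDerivation D (evenProd 1 : PowerSeries A) = 0 := by
    rw [← map_one (Int.castRingHom A), ← map_evenProd, coeffDerivation_map]
  have o0 : coeffDerivation D (oddProd 1 : PowerSeries A) = 0 := by
    rw [← map_one (Int.castRingHom A), ← map_oddProd, coeffDerivation_map]
  have eul := euler_odd_parts (A := A)
  rw [v2, v3, v4] at hW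
  rw [v2, v3, v4] at hq1
  rw [v2, v3, v4] at hq0
  have h1 : C (y : A) * gaussSum 1 1 (-(y ^ 2)) = C ((y : A) - ((y⁻¹ : Aˣ) : A)) *
      (evenProd 1 * evenProd ((y : A) ^ 2) * evenProd (((y⁻¹ : Aˣ) : A) ^ 2)) := by
    rw [gaussSum_one_eq_prod]
    simp only [inv_neg, Units.val_neg, neg_neg, Units.val_pow_eq_pow_val, hyi, ← mul_assoc,
      ← map_mul]
    congr 4
    linear_combination (-((y⁻¹ : Aˣ) : A)) * hyy
  have h4 : (gaussSum 1 0 (-(y ^ 2)) : PowerSeries A) =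
      evenProd 1 * oddProd ((y : A) ^ 2) * oddProd (((y⁻¹ : Aˣ) : A) ^ 2) := by
    rw [gaussSum_zero_eq_prod]
    simp only [inv_neg, Units.val_neg, neg_neg, Units.val_pow_eq_pow_val, hyi]
  have hg' : g * evenProd 1 ^ 2 * gaussSum 1 0 (-(y ^ 2)) =
      oddProd 1 ^ 2 * (C (y : A) * gaussSum 1 1 (-(y ^ 2))) := by
    rw [h1, h4]
    linear_combination evenProd 1 * hg
  have ut : IsUnit (gaussSum 1 0 (-(y ^ 2)) : PowerSeries A) := by
    rw [gaussSum_zero_eq_prod]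
    exact ((isUnit_evenProd _).mul (isUnit_oddProd _)).mul (isUnit_oddProd _)
  have ue := isUnit_evenProd (1 : A)
  have ue' := isUnit_evenProd (-1 : A)
  have uo := isUnit_oddProd (1 : A)
  have uo' := isUnit_oddProd (-1 : A)
  have hCD : 2 * C (D y) = (C (y : A) : PowerSeries A) := by
    rw [← map_ofNat (C (R := A)), ← map_mul, hD2]
  have hdg := congrArg (coeffDerivation D) hg'
  simp only [Derivation.leibniz, Derivation.leibniz_pow, smul_eq_mul, coeffDerivation_C, e0, o0,
    smul_zero, mul_zero, add_zero, zero_add] at hdg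
  simp only [Nat.cast_one, one_mul, Nat.cast_zero, zero_mul, add_zero] at hU hT
  have hz2 : (C (((y ^ 2 : Aˣ) : A)) : PowerSeries A) = C (y : A) ^ 2 := by
    rw [Units.val_pow_eq_pow_val, map_pow]
  rw [hz2] at hq1 hq0
  clear hg h1 h4 e0 o0 v2 v3 v4 hz2 hDz hD hφ
  generalize (gaussSum 1 0 (-(y ^ 2)) : PowerSeries A) = T at *
  generalize (gaussSum 1 1 (-(y ^ 2)) : PowerSeries A) = U at *
  generalize (gaussSum 1 0 (y ^ 2) : PowerSeries A) = T' at *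
  generalize (gaussSum 1 1 (y ^ 2) : PowerSeries A) = U' at *
  generalize (gaussMoment 1 (-(y ^ 2)) : PowerSeries A) = MU at *
  generalize (gaussMoment 0 (-(y ^ 2)) : PowerSeries A) = MT at *
  generalize (evenProd 1 : PowerSeries A) = e at *
  generalize (evenProd (-1) : PowerSeries A) = e' at *
  generalize (oddProd 1 : PowerSeries A) = o at *
  generalize (oddProd (-1) : PowerSeries A) = o' at *
  generalize coeffDerivation D g = G at *
  generalize coeffDerivation D T = DT at *
  generalize coeffDerivation D U = DU at *
  generalize (C (y : A) : PowerSeries A) = Y at *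
  generalize (C (D y) : PowerSeries A) = DY at *
  -- the derivative of the quotient
  have k1 : 2 * G * e ^ 2 * T ^ 2 = o ^ 2 * (Y * (MU * T - U * MT)) := by
    rw [← hU, ← hT]
    linear_combination (2 * T) * hdg - 2 * DT * hg' + (o ^ 2 * U * T) * hCD
  -- The Wronskian relation with the unit 4e² cancelled, 2 being invertible over ℂ. It replaces the
  -- derivatives by the theta functions at the opposite argument.
  have k2 : e' ^ 2 * o' ^ 2 * (MU * T - U * MT) = e ^ 2 * o ^ 2 * (U' * T') := by
    have : IsUnit (4 * e ^ 2 : PowerSeries A) := (IsUnit.mul (by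
      rw [isUnit_iff_constantCoeff, map_ofNat]
      have h4 := (isUnit_iff_ne_zero.2 (show (4 : ℂ) ≠ 0 by norm_num)).map (algebraMap ℂ A)
      rwa [map_ofNat] at h4) (ue.pow 2))
    refine this.mul_left_cancel ?_
    linear_combination hW
  have k3 : 2 * G * T ^ 2 = o ^ 6 * (Y * (U' * T')) := by
    refine ((ue.pow 2).mul ((ue'.pow 2).mul (uo'.pow 2))).mul_left_cancel ?_
    linear_combination (e' ^ 2 * o' ^ 2) * k1 + o ^ 2 * Y * k2 - (o ^ 4 * e ^ 2 * Y * U' * T') *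
      (e' * o * o' + 1) * eul
  -- The quadratic theta relations, divided by T², make the squares of U' and T' linear in g². They
  -- supply the two factors of the quartic.
  have k4 : Y ^ 2 * U' ^ 2 * o ^ 8 = (4 * e' ^ 4 * o ^ 4 + o' ^ 4 * e ^ 4 * g ^ 2) * T ^ 2 := by
    refine (ue.pow 2).mul_left_cancel ?_
    linear_combination o ^ 4 * hq1 - (e ^ 2 * o' ^ 4) * (g * e ^ 2 * T + o ^ 2 * (Y * U)) * hg'
  have k5 : T' ^ 2 * o ^ 8 = (o' ^ 4 * o ^ 4 + 4 * X * e' ^ 4 * e ^ 4 * g ^ 2) * T ^ 2 := by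
    refine (ue.pow 2).mul_left_cancel ?_
    linear_combination o ^ 4 * hq0 -
      (4 * X * e ^ 2 * e' ^ 4) * (g * e ^ 2 * T + o ^ 2 * (Y * U)) * hg'
  have eul4 : e' ^ 4 * o ^ 4 * o' ^ 4 = 1 := by rw [← mul_pow, ← mul_pow, eul, one_pow]
  have r1 : e' ^ 4 * o ^ 4 * (4 + (e * o' ^ 2) ^ 4 * g ^ 2) =
      4 * e' ^ 4 * o ^ 4 + o' ^ 4 * e ^ 4 * g ^ 2 := by
    linear_combination (e ^ 4 * o' ^ 4 * g ^ 2) * eul4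
  have r2 : o' ^ 4 * o ^ 4 * (1 + 4 * X * (e * e' ^ 2) ^ 4 * g ^ 2) =
      o' ^ 4 * o ^ 4 + 4 * X * e' ^ 4 * e ^ 4 * g ^ 2 := by
    linear_combination (4 * X * e ^ 4 * e' ^ 4 * g ^ 2) * eul4
  -- The square of `k3` involves U' and T' only through their squares, which `k4` and `k5` evaluate.
  refine ((uo.pow 4).mul (ut.pow 4)).mul_left_cancel ?_
  rw [← r1] at k4
  rw [← r2] at k5
  generalize 4 + (e * o' ^ 2) ^ 4 * g ^ 2 = R₁ at *
  generalize 1 + 4 * X * (e * e' ^ 2) ^ 4 * g ^ 2 = R₂ at *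
  linear_combination o ^ 4 * (2 * G * T ^ 2 + o ^ 6 * (Y * (U' * T'))) * k3 +
    (T' ^ 2 * o ^ 8) * k4 + (e' ^ 4 * o ^ 4 * R₁ * T ^ 2) * k5 +
    (o ^ 4 * R₁ * R₂ * T ^ 4) * eul4

end EllipticODE

/-! ### The quotient of theta functions -/

section EllipticFunction

open PowerSeries

/-- The exponential `exp (x / 2)`. -/
def expHalf : (PowerSeries ℂ)ˣ where
  val := rescale (1 / 2) (exp ℂ)
  inv := rescale (-(1 / 2)) (exp ℂ)
  val_inv := by rw [exp_mul_exp_eq_exp_add]; simp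
  inv_val := by rw [exp_mul_exp_eq_exp_add]; simp

theorem coeff_expHalf (n : ℕ) : coeff n (expHalf : PowerSeries ℂ) = (1 / 2) ^ n / n.factorial := by
  simp [expHalf, coeff_rescale, coeff_exp, div_eq_mul_inv]

theorem coeff_expHalf_inv (n : ℕ) :
    coeff n ((expHalf⁻¹ : (PowerSeries ℂ)ˣ) : PowerSeries ℂ) = (-(1 / 2)) ^ n / n.factorial := by
  have : ((expHalf⁻¹ : (PowerSeries ℂ)ˣ) : PowerSeries ℂ) = rescale (-(1 / 2)) (exp ℂ) := rfl
  rw [this]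
  simp [coeff_rescale, coeff_exp, div_eq_mul_inv]

theorem expHalf_sq : (expHalf : PowerSeries ℂ) ^ 2 = exp ℂ := by
  have : (expHalf : PowerSeries ℂ) = rescale (1 / 2) (exp ℂ) := rfl
  rw [sq, this, exp_mul_exp_eq_exp_add]; norm_num

theorem expHalf_inv_sq : ((expHalf⁻¹ : (PowerSeries ℂ)ˣ) : PowerSeries ℂ) ^ 2 =
    evalNegHom (exp ℂ) := by
  have : ((expHalf⁻¹ : (PowerSeries ℂ)ˣ) : PowerSeries ℂ) = rescale (-(1 / 2)) (exp ℂ) := rfl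
  rw [sq, this, exp_mul_exp_eq_exp_add]; norm_num; rfl

/-- `2 sinh (x / 2) / x`. -/
def sinhHalf : PowerSeries ℂ := rescale (1 / 2) sinhDivSeries

theorem expHalf_sub_inv : (expHalf : PowerSeries ℂ) - ((expHalf⁻¹ : (PowerSeries ℂ)ˣ) : PowerSeries ℂ) =
    X * sinhHalf := by
  ext n
  rw [map_sub, coeff_expHalf, coeff_expHalf_inv]
  rcases n with _ | n
  · simp
  · rw [coeff_succ_X_mul, sinhHalf, coeff_rescale, sinhDivSeries, coeff_mk]
    split_ifs with h
    · rw [Odd.neg_pow (Even.add_one h), pow_succ]; ring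
    · rw [Even.neg_pow (by rwa [Nat.even_add_one])]; ring

theorem derivative_expHalf :
    derivative ℂ (expHalf : PowerSeries ℂ) = (1 / 2 : ℂ) • (expHalf : PowerSeries ℂ) := by
  ext n
  rw [coeff_derivative, coeff_expHalf, coeff_smul, coeff_expHalf, Nat.factorial_succ, pow_succ]
  have h1 : ((n : ℂ) + 1) ≠ 0 := by exact_mod_cast n.succ_ne_zero
  have h2 : (n.factorial : ℂ) ≠ 0 := by exact_mod_cast n.factorial_ne_zero
  push_cast
  rw [smul_eq_mul]
  field_simp

theorem constantCoeff_expHalf : constantCoeff (expHalf : PowerSeries ℂ) = 1 := by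
  rw [← coeff_zero_eq_constantCoeff_apply, coeff_expHalf]; simp

/-- The quotient of theta functions divided by the coordinate: `1 / (x f₂(x))`. -/
def thetaQuotient : PowerSeries (PowerSeries ℂ) :=
  oddProd 1 ^ 2 * C sinhHalf * evenProd (exp ℂ) * evenProd (evalNegHom (exp ℂ)) *
    ((((isUnit_evenProd 1).pow 2).mul ((isUnit_oddProd (exp ℂ)).mul
      (isUnit_oddProd (evalNegHom (exp ℂ))))).unit⁻¹).val

theorem thetaQuotient_mul :
    thetaQuotient * (evenProd 1 ^ 2 * (oddProd (exp ℂ) * oddProd (evalNegHom (exp ℂ)))) =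
      oddProd 1 ^ 2 * C sinhHalf * evenProd (exp ℂ) * evenProd (evalNegHom (exp ℂ)) := by
  rw [thetaQuotient, mul_assoc _ _ (evenProd 1 ^ 2 * _), IsUnit.val_inv_mul, mul_one]

/-- The image of an integral power series in `q^{1/2}`. -/
def constSeries (f : PowerSeries ℤ) : PowerSeries (PowerSeries ℂ) :=
  PowerSeries.map (Int.castRingHom _) f

theorem thetaThreeSeries_eq : thetaThreeSeries = evenProd 1 * oddProd (-1) ^ 2 := by
  have h1 : ∀ j, modX (j + 1) (1 - X ^ (2 * (j + 1)) * C (1 : ℤ)) = 1 := fun j =>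
    modX_one_sub_X_pow (by omega) _
  have h2 : ∀ j, modX (j + 1) (1 - X ^ (2 * j + 1) * C (-1 : ℤ)) = 1 := fun j =>
    modX_one_sub_X_pow (by omega) _
  have h3 : ∀ j, modX (j + 1) ((1 - X ^ (2 * j + 1) * C (-1 : ℤ)) *
      (1 - X ^ (2 * j + 1) * C (-1 : ℤ))) = 1 := fun j => by rw [map_mul, h2, one_mul]
  rw [sq, evenProd, oddProd, ← infiniteProduct_mul h2 h2, ← infiniteProduct_mul h1 h3,
    thetaThreeSeries]
  congr 1; funext j
  simp only [map_one, map_neg]; ring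

theorem thetaOneProduct_eq : thetaOneProduct = evenProd 1 * evenProd (-1) ^ 2 := by
  have h1 : ∀ j, modX (j + 1) (1 - X ^ (2 * (j + 1)) * C (1 : ℤ)) = 1 := fun j =>
    modX_one_sub_X_pow (by omega) _
  have h2 : ∀ j, modX (j + 1) (1 - X ^ (2 * (j + 1)) * C (-1 : ℤ)) = 1 := fun j =>
    modX_one_sub_X_pow (by omega) _
  have h3 : ∀ j, modX (j + 1) ((1 - X ^ (2 * (j + 1)) * C (-1 : ℤ)) *
      (1 - X ^ (2 * (j + 1)) * C (-1 : ℤ))) = 1 := fun j => by rw [map_mul, h2, one_mul]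
  rw [sq, evenProd, evenProd, ← infiniteProduct_mul h2 h2, ← infiniteProduct_mul h1 h3,
    thetaOneProduct]
  congr 1; funext j
  simp only [map_one, map_neg]; ring

/-- The case y = exp(x/2) of `elliptic_ode`, with D = d/dx and φ the value at x = 0. -/
theorem thetaQuotient_ode_first :
    4 * coeffDerivation (derivative ℂ) (C X * thetaQuotient) ^ 2 =
      4 - constSeries eightDeltaTwo * (C X * thetaQuotient) ^ 2 +
        4 * constSeries epsilonTwo * (C X * thetaQuotient) ^ 4 := by
  let _ : TopologicalSpace (PowerSeries ℂ) := ⊥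
  have _ : DiscreteTopology (PowerSeries ℂ) := ⟨rfl⟩
  have h := elliptic_ode (derivative ℂ) ((C (R := ℂ)).comp constantCoeff) expHalf
    derivative_expHalf (by rw [RingHom.comp_apply, constantCoeff_expHalf, map_one])
    (C X * thetaQuotient) (by
      rw [expHalf_sq, expHalf_inv_sq, expHalf_sub_inv, map_mul]
      linear_combination C X * thetaQuotient_mul)
  rw [h, eightDeltaTwo, epsilonTwo, thetaThreeSeries_eq, thetaOneProduct_eq]
  simp only [constSeries, map_neg, map_add, map_mul, map_pow, map_ofNat, PowerSeries.map_X,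
    map_evenProd, map_oddProd, map_one]
  ring

theorem constSeries_deriv (f : PowerSeries ℤ) :
    coeffDerivation (derivative ℂ) (constSeries f) = 0 := coeffDerivation_map _ f

/-- The square `h` of the quotient of theta functions satisfies `h'' = 2 - 8 δ₂ h + 6 ε₂ h²`. -/
theorem thetaQuotient_ode :
    coeffDerivation (derivative ℂ) (coeffDerivation (derivative ℂ) ((C X * thetaQuotient) ^ 2)) =
      2 - constSeries eightDeltaTwo * (C X * thetaQuotient) ^ 2 +
        6 * constSeries epsilonTwo * ((C X * thetaQuotient) ^ 2) ^ 2 := by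
  have h1 := thetaQuotient_ode_first
  have h0 : constantCoeff (constantCoeff (C X * thetaQuotient)) = (0 : ℂ) := by simp
  have hE := constSeries_deriv eightDeltaTwo
  have hε := constSeries_deriv epsilonTwo
  set D := coeffDerivation (derivative ℂ) with hD
  generalize constSeries eightDeltaTwo = E at *
  generalize constSeries epsilonTwo = ε at *
  generalize C X * thetaQuotient = g at *
  -- The equation gives 4 g'² the constant term 4, so g' is a unit. It can be cancelled after
  -- differentiating, which yields the second-order equation.
  have hu : IsUnit (D g) := by
    have h2 : IsUnit (4 * D g ^ 2) := by
      rw [h1, isUnit_iff_constantCoeff, isUnit_iff_constantCoeff]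
      simp [h0, map_ofNat]
    exact (isUnit_pow_iff two_ne_zero).1 (isUnit_of_mul_isUnit_right h2)
  have h3 := congrArg D h1
  have h4 : D 4 = 0 := by
    have := D.map_natCast 4
    simpa using this
  simp only [Derivation.leibniz, Derivation.leibniz_pow, map_add, map_sub, hE, hε, h4,
    zero_sub, smul_eq_mul, nsmul_eq_mul] at h3
  have h6 : (2 : PowerSeries (PowerSeries ℂ)) ≠ 0 := fun h => by
    have := congrArg (fun f => constantCoeff (constantCoeff f)) h
    simp [map_ofNat] at this
  have h5 : 4 * D (D g) = -E * g + 8 * ε * g ^ 3 := by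
    refine (hu.mul (hu.pow 0)).mul_left_cancel ?_
    refine mul_left_cancel₀ h6 ?_
    push_cast at h3
    linear_combination h3
  refine mul_left_cancel₀ h6 ?_
  simp only [Derivation.leibniz, Derivation.leibniz_pow,
    smul_eq_mul, nsmul_eq_mul]
  have h7 : D (2 : PowerSeries (PowerSeries ℂ)) = 0 := by
    have := D.map_natCast 2
    simpa using this
  push_cast
  rw [h7]
  linear_combination h1 + g * h5

end EllipticFunction

/-! ### Evaluation at nilpotent elements -/

section NilpotentEvaluation

open PowerSeries

variable {S : Type*} [CommRing S] {A : Type*} [Ring A] [Algebra S A]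

/-- Evaluation of power series at an element with `x ^ (N + 1) = 0`. -/
def nilEval (N : ℕ) (x : A) (h : x ^ (N + 1) = 0) : PowerSeries S →+* A where
  toFun f := Polynomial.aeval x (trunc (N + 1) f)
  map_one' := by rw [trunc_one, map_one]
  map_zero' := by rw [map_zero, map_zero]
  map_add' f g := by rw [map_add, map_add]
  map_mul' f g := by
    -- Truncation is multiplicative only modulo X^{N+1}, and the error term dies at x because
    -- x^{N+1} = 0.
    have key : (Polynomial.X : Polynomial S) ^ (N + 1) ∣
        trunc (N + 1) f * trunc (N + 1) g - trunc (N + 1) (f * g) := by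
      rw [Polynomial.X_pow_dvd_iff]
      intro d hd
      rw [Polynomial.coeff_sub, coeff_trunc, if_pos hd, coeff_mul_eq_coeff_trunc_mul_trunc f g hd,
        ← Polynomial.coe_mul, Polynomial.coeff_coe, sub_self]
    obtain ⟨r, hr⟩ := key
    have h2 := congrArg (Polynomial.aeval x) hr
    rw [map_sub, _root_.map_mul, _root_.map_mul (Polynomial.aeval x) (_ ^ _), map_pow, Polynomial.aeval_X, h, zero_mul,
      sub_eq_zero] at h2
    exact h2.symm

theorem nilEval_apply (N : ℕ) (x : A) (h : x ^ (N + 1) = 0) (f : PowerSeries S) :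
    nilEval N x h f = ∑ m ∈ Finset.range (N + 1), coeff m f • x ^ m := by
  simp only [nilEval, RingHom.coe_mk, MonoidHom.coe_mk, OneHom.coe_mk, trunc_apply, map_sum,
    Polynomial.aeval_monomial, Finset.range_eq_Ico, Algebra.smul_def]

theorem evalNilpotent_eq_nilEval {A : Type*} [Ring A] [Algebra ℂ A] (N : ℕ) (x : A)
    (h : x ^ (N + 1) = 0) (f : PowerSeries ℂ) : evalNilpotent N f x = nilEval N x h f := by
  rw [nilEval_apply, evalNilpotent]

theorem nilEval_C (N : ℕ) (x : A) (h : x ^ (N + 1) = 0) (a : S) :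
    nilEval N x h (C a) = algebraMap S A a := by
  rw [nilEval_apply, Finset.sum_range_succ', Finset.sum_eq_zero (fun m _ => by simp)]
  simp [Algebra.smul_def]

theorem nilEval_X (N : ℕ) (x : A) (h : x ^ (N + 1) = 0) :
    nilEval N x h (X : PowerSeries S) = x := by
  rcases N with _ | N
  · rw [zero_add, pow_one] at h
    simp [nilEval_apply, h]
  · rw [nilEval_apply, Finset.sum_eq_single 1]
    · simp
    · intro m _ hm; simp [coeff_X, hm]
    · intro hm; simp at hm

theorem nilEval_rescale (N : ℕ) (x : A) (h : x ^ (N + 1) = 0) (a : S)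
    (h' : (a • x) ^ (N + 1) = 0) (f : PowerSeries S) :
    nilEval N x h (rescale a f) = nilEval N (a • x) h' f := by
  simp only [nilEval_apply, coeff_rescale, smul_pow, mul_comm (a ^ _), mul_smul]

theorem map_nilEval {T : Type*} [CommRing T] {ι : Type*} [Fintype ι] [DecidableEq ι]
    (φ : S →+* T) (N : ℕ) (F : Matrix ι ι S) (h : F ^ (N + 1) = 0) (h' : F.map φ ^ (N + 1) = 0)
    (f : PowerSeries S) :
    (nilEval N F h f).map φ = nilEval N (F.map φ) h' (PowerSeries.map φ f) := by
  have e : ∀ M : Matrix ι ι S, M.map φ = φ.mapMatrix M := fun _ => rfl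
  simp only [e, nilEval_apply, map_sum, coeff_map]
  refine Finset.sum_congr rfl fun m _ => ?_
  rw [← map_pow]
  ext i j
  simp

theorem nilEval_transpose {ι : Type*} [Fintype ι] [DecidableEq ι]
    (N : ℕ) (F : Matrix ι ι S) (h : F ^ (N + 1) = 0) (h' : F.transpose ^ (N + 1) = 0)
    (f : PowerSeries S) : (nilEval N F h f).transpose = nilEval N F.transpose h' f := by
  simp only [nilEval_apply, Matrix.transpose_sum, Matrix.transpose_smul, Matrix.transpose_pow]

/-- If `Fᵀ = -G F G⁻¹`, then `det f(F) = det f(-F)`. -/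
theorem det_nilEval_neg {ι : Type*} [Fintype ι] [DecidableEq ι]
    (N : ℕ) (F G : Matrix ι ι S) (hG : IsUnit G) (hF : F.transpose * G + G * F = 0)
    (h : F ^ (N + 1) = 0) (f : PowerSeries S) :
    (nilEval N F h (evalNegHom f)).det = (nilEval N F h f).det := by
  have h1 : F.transpose ^ (N + 1) = 0 := by rw [← Matrix.transpose_pow, h, Matrix.transpose_zero]
  have h2 : ((-1 : S) • F) ^ (N + 1) = 0 := by rw [smul_pow, h, smul_zero]
  have h3 : ∀ m, F.transpose ^ m * G = G * ((-1 : S) • F) ^ m := by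
    intro m
    induction m with
    | zero => simp
    | succ m ih =>
      rw [pow_succ, mul_assoc, eq_neg_of_add_eq_zero_left hF, mul_neg, ← mul_assoc, ih, pow_succ,
        neg_one_smul, mul_neg, mul_neg, mul_assoc]
  have h4 : nilEval N F.transpose h1 f * G = G * nilEval N ((-1 : S) • F) h2 f := by
    simp only [nilEval_apply, Finset.sum_mul, Finset.mul_sum, smul_mul_assoc, h3, mul_smul_comm]
  have h5 := congrArg Matrix.det h4
  rw [Matrix.det_mul, Matrix.det_mul, mul_comm, ← nilEval_transpose N F h h1,
    Matrix.det_transpose] at h5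
  have h6 := ((Matrix.isUnit_iff_isUnit_det G).1 hG).mul_left_cancel h5
  rw [evalNegHom, nilEval_rescale N F h (-1) h2]
  exact h6.symm

end NilpotentEvaluation

/-! ### Exchange of the variables x and q^{1/2} -/

section Swap

open PowerSeries

/-- Interchange of the variables of power series in two variables. -/
def swapSeries (R : Type*) [CommRing R] : PowerSeries (PowerSeries R) →+* PowerSeries (PowerSeries R) where
  toFun f := PowerSeries.mk fun n => PowerSeries.mk fun m => coeff n (coeff m f)
  map_one' := by
    ext n m
    simp only [coeff_mk, coeff_one]
    split_ifs <;> simp_all [coeff_one]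
  map_zero' := by ext; simp
  map_add' f g := by ext; simp
  map_mul' f g := by
    ext n m
    simp only [coeff_mk, coeff_mul, map_sum]
    rw [Finset.sum_comm]

theorem coeff_swapSeries {R : Type*} [CommRing R] (f : PowerSeries (PowerSeries R)) (n m : ℕ) :
    coeff m (coeff n (swapSeries R f)) = coeff n (coeff m f) := by
  simp [swapSeries]

theorem swapSeries_C {R : Type*} [CommRing R] (f : PowerSeries R) :
    swapSeries R (C f) = PowerSeries.map C f := by
  ext n m
  rw [coeff_swapSeries, coeff_map, coeff_C, coeff_C]
  split_ifs <;> simp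

theorem swapSeries_map_C {R : Type*} [CommRing R] (f : PowerSeries R) :
    swapSeries R (PowerSeries.map C f) = C f := by
  ext n m
  rw [coeff_swapSeries, coeff_map, coeff_C, coeff_C]
  split_ifs <;> simp

theorem swapSeries_X {R : Type*} [CommRing R] : swapSeries R X = C X := by
  rw [← swapSeries_map_C, PowerSeries.map_X]

theorem swapSeries_derivative (f : PowerSeries (PowerSeries ℂ)) :
    swapSeries ℂ (coeffDerivation (derivative ℂ) f) = derivative _ (swapSeries ℂ f) := by
  ext n m
  rw [coeff_swapSeries, coeff_coeffDerivation, coeff_derivative, coeff_derivative]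
  have : ((n : PowerSeries ℂ) + 1) = C ((n : ℂ) + 1) := by simp
  rw [this, coeff_mul_C, coeff_swapSeries]

end Swap

/-! ### The universal solution of the elliptic equation -/

section UniversalSolution

open MvPolynomial

/-- The coefficients of the solution `h = x² + ⋯` of `h'' = 2 - X₀ h + 6 X₁ h²`. -/
def solutionCoeff : ℕ → MvPolynomial (Fin 2) ℂ
  | 0 => 0
  | 1 => 0
  | n + 2 => C (1 / ((n + 1) * (n + 2)) : ℂ) * ((if n = 0 then 2 else 0) - X 0 * solutionCoeff n +
      6 * X 1 * ∑ i : Fin (n + 1), solutionCoeff i * solutionCoeff (n - i))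
termination_by n => n
decreasing_by all_goals omega

theorem solutionCoeff_zero : solutionCoeff 0 = 0 := by rw [solutionCoeff]
theorem solutionCoeff_one : solutionCoeff 1 = 0 := by rw [solutionCoeff]
theorem solutionCoeff_two : solutionCoeff 2 = 1 := by
  rw [solutionCoeff]
  simp only [CharP.cast_eq_zero, zero_add, ↓reduceIte, solutionCoeff_zero, mul_zero, sub_zero,
    Fin.val_eq_zero, zero_mul, Finset.sum_const_zero, add_zero]
  rw [← map_ofNat C 2, ← C_mul]
  norm_num

/-- Reflects the scaling symmetry of the equation under x ↦ λx. The truncated weight n - 2 does no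
harm for n < 2, where the coefficients vanish. -/
theorem isWeightedHomogeneous_solutionCoeff (n : ℕ) :
    IsWeightedHomogeneous ![2, 4] (solutionCoeff n) (n - 2) := by
  induction n using Nat.strong_induction_on with
  | _ n ih =>
    match n with
    | 0 => rw [solutionCoeff_zero]; exact isWeightedHomogeneous_zero _ _ _
    | 1 => rw [solutionCoeff_one]; exact isWeightedHomogeneous_zero _ _ _
    | n + 2 =>
      rw [solutionCoeff, Nat.add_sub_cancel]
      have hX0 : IsWeightedHomogeneous ![2, 4] (X 0 : MvPolynomial (Fin 2) ℂ) 2 :=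
        isWeightedHomogeneous_X ℂ ![2, 4] 0
      have hX1 : IsWeightedHomogeneous ![2, 4] (X 1 : MvPolynomial (Fin 2) ℂ) 4 :=
        isWeightedHomogeneous_X ℂ ![2, 4] 1
      have hC : ∀ c : ℂ, IsWeightedHomogeneous ![2, 4] (C c : MvPolynomial (Fin 2) ℂ) 0 :=
        fun c => isWeightedHomogeneous_C _ c
      have h0 : IsWeightedHomogeneous ![2, 4]
          ((if n = 0 then 2 else 0 : MvPolynomial (Fin 2) ℂ)) n := by
        split_ifs with h
        · rw [h, ← map_ofNat C 2]; exact hC 2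
        · exact isWeightedHomogeneous_zero _ _ _
      have h1 : IsWeightedHomogeneous ![2, 4] (X 0 * solutionCoeff n) n := by
        by_cases hn : n < 2
        · have : solutionCoeff n = 0 := by
            interval_cases n
            exacts [solutionCoeff_zero, solutionCoeff_one]
          rw [this, mul_zero]; exact isWeightedHomogeneous_zero _ _ _
        · have := hX0.mul (ih n (by omega))
          rwa [show 2 + (n - 2) = n by omega] at this
      have h2 : ∀ i : Fin (n + 1), IsWeightedHomogeneous ![2, 4]
          (6 * X 1 * (solutionCoeff i * solutionCoeff (n - i))) n := by
        intro i
        by_cases hi : 2 ≤ (i : ℕ) ∧ 2 ≤ n - i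
        · have := ((hC 6).mul hX1).mul ((ih i (by omega)).mul (ih (n - i) (by omega)))
          rwa [show 0 + 4 + ((i : ℕ) - 2 + (n - i - 2)) = n by omega,
            map_ofNat C 6] at this
        · have hz : ∀ j, j < 2 → solutionCoeff j = 0 := by
            intro j hj
            interval_cases j
            exacts [solutionCoeff_zero, solutionCoeff_one]
          have : solutionCoeff i * solutionCoeff (n - i) = 0 := by
            rcases not_and_or.1 hi with h | h
            · rw [hz _ (by omega), zero_mul]
            · rw [hz (n - i) (by omega), mul_zero]
          rw [this, mul_zero]; exact isWeightedHomogeneous_zero _ _ _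
      have h3 := (hC (1 / ((n + 1) * (n + 2)))).mul ((h0.sub h1).add
        (IsWeightedHomogeneous.sum (Finset.univ : Finset (Fin (n + 1))) _ n fun i _ => h2 i))
      rw [zero_add, ← Finset.mul_sum] at h3
      exact h3

/-- The solution of `h'' = 2 - a h + 6 b h²` with `h(0) = h'(0) = 0` is unique. -/
theorem coeff_eq_solutionCoeff {S : Type*} [CommRing S] (i : ℂ →+* S) (a b : S)
    (h : PowerSeries S) (h0 : PowerSeries.coeff 0 h = 0) (h1 : PowerSeries.coeff 1 h = 0)
    (hode : PowerSeries.derivative S (PowerSeries.derivative S h) =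
      2 - PowerSeries.C a * h + 6 * PowerSeries.C b * h ^ 2) (n : ℕ) :
    PowerSeries.coeff n h = eval₂ i ![a, b] (solutionCoeff n) := by
  induction n using Nat.strong_induction_on with
  | _ n ih =>
    match n with
    | 0 => rw [h0, solutionCoeff_zero, eval₂_zero]
    | 1 => rw [h1, solutionCoeff_one, eval₂_zero]
    | n + 2 =>
      have key := congrArg (PowerSeries.coeff n) hode
      rw [PowerSeries.coeff_derivative, PowerSeries.coeff_derivative, map_add, map_sub,
        PowerSeries.coeff_C_mul, ← map_ofNat PowerSeries.C 6,
        ← map_ofNat PowerSeries.C 2, ← map_mul, PowerSeries.coeff_C_mul,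
        PowerSeries.coeff_C, sq, PowerSeries.coeff_mul,
        Finset.Nat.sum_antidiagonal_eq_sum_range_succ
          (fun i j => PowerSeries.coeff i h * PowerSeries.coeff j h), Finset.sum_range,
        ih n (by omega)] at key
      have e : ∀ j : Fin n.succ, PowerSeries.coeff (j : ℕ) h * PowerSeries.coeff (n - j) h =
          eval₂ i ![a, b] (solutionCoeff j * solutionCoeff (n - j)) := fun j => by
        rw [eval₂_mul, ih j (by omega), ih (n - j) (by omega)]
      simp only [e] at key
      rw [solutionCoeff, eval₂_mul, eval₂_add, eval₂_sub, eval₂_mul, eval₂_mul, eval₂_mul,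
        eval₂_sum, eval₂_C, eval₂_X, eval₂_X]
      have h2 : eval₂ i ![a, b] ((if n = 0 then 2 else 0 : MvPolynomial (Fin 2) ℂ)) =
          if n = 0 then 2 else 0 := by
        split_ifs
        · exact map_ofNat (eval₂Hom i ![a, b]) 2
        · exact eval₂_zero _ _
      have h6 : eval₂ i ![a, b] (6 : MvPolynomial (Fin 2) ℂ) = 6 :=
        map_ofNat (eval₂Hom i ![a, b]) 6
      rw [h2, h6]
      simp only [Matrix.cons_val_zero, Matrix.cons_val_one]
      rw [← key]
      have h3 : i (1 / ((n + 1) * (n + 2))) * i ((n + 1) * (n + 2)) = 1 := by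
        rw [← map_mul, one_div_mul_cancel, map_one]
        exact mul_ne_zero (by exact_mod_cast n.succ_ne_zero) (by exact_mod_cast (n + 1).succ_ne_zero)
      have h4 : i ((n + 1) * (n + 2)) = (n + 1) * (n + 2) := by simp [map_ofNat]
      rw [h4] at h3
      push_cast
      linear_combination (-PowerSeries.coeff (n + 2) h) * h3

end UniversalSolution

/-! ### Fourth roots near 1, existence and uniqueness -/

section FourthRoot

/-- The characteristic polynomial of a nilpotent matrix differs from a power of the variable by a
nilpotent polynomial; evaluate it at -1. -/
theorem isNilpotent_det_one_add {R : Type*} [CommRing R] {ι : Type*} [Fintype ι] [DecidableEq ι]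
    (A : Matrix ι ι R) (hA : IsNilpotent A) : IsNilpotent ((1 + A).det - 1) := by
  have h := (Matrix.isNilpotent_charpoly_sub_pow_of_isNilpotent hA).map
    (Polynomial.evalRingHom (-1 : R))
  rw [map_sub, Polynomial.coe_evalRingHom, Matrix.eval_charpoly, Polynomial.eval_pow,
    Polynomial.eval_X] at h
  have h2 : (Matrix.scalar ι (-1 : R) - A).det = (-1) ^ Fintype.card ι * (1 + A).det := by
    rw [← Matrix.det_neg, map_neg, map_one]; congr 1
    abel
  rw [h2] at h
  have h3 := (Commute.all ((-1 : R) ^ Fintype.card ι) _).isNilpotent_mul_left h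
  rwa [mul_sub, ← mul_assoc, ← mul_pow, neg_one_mul, neg_neg, one_pow, one_mul] at h3

theorem isUnit_of_isNilpotent_sub_one {R : Type*} [CommRing R] (u : R) (hu : IsNilpotent (u - 1)) :
    IsUnit u := by
  have := IsNilpotent.isUnit_add_one hu
  rwa [sub_add_cancel] at this

/-- Newton iteration for u t⁴ - 1 starting at t = 1, where the value u - 1 is nilpotent and the
derivative 4u is a unit. -/
theorem exists_inverse_fourth_root {R : Type*} [CommRing R] [Algebra ℂ R] (u : R)
    (hu : IsNilpotent (u - 1)) : ∃ v : R, IsNilpotent (v - 1) ∧ v ^ 4 * u = 1 := by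
  have hu' := isUnit_of_isNilpotent_sub_one u hu
  have h4 : IsUnit (4 : R) := by
    have : IsUnit (algebraMap ℂ R 4) := (isUnit_iff_ne_zero.2 (by norm_num)).map _
    rwa [map_ofNat] at this
  obtain ⟨v, ⟨hv, hv'⟩, -⟩ := Polynomial.existsUnique_nilpotent_sub_and_aeval_eq_zero
    (P := Polynomial.C u * Polynomial.X ^ 4 - 1) (x := (1 : R)) (by simpa using hu)
    (by
      have h5 := hu'.mul h4
      simp only [Polynomial.derivative_sub, Polynomial.derivative_C_mul_X_pow,
        Polynomial.derivative_one, sub_zero, map_mul, Polynomial.aeval_C, map_pow,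
        Polynomial.aeval_X, one_pow, mul_one]
      simpa using h5)
  refine ⟨v, by rw [← neg_sub]; exact hv.neg, ?_⟩
  simp only [map_sub, map_mul, Polynomial.aeval_C, Algebra.algebraMap_self, RingHom.id_apply,
    map_pow, Polynomial.aeval_X, map_one] at hv'
  linear_combination hv'

/-- In u⁴ - v⁴ the cofactor of u - v maps to 4 π(v)³ ≠ 0, hence is a unit because π is local. -/
theorem eq_of_pow_four_eq {R K : Type*} [CommRing R] [Field K] [CharZero K] (π : R →+* K)
    [IsLocalHom π] {u v : R} (huv : u ^ 4 = v ^ 4) (h : π u = π v) (h0 : π v ≠ 0) : u = v := by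
  have hunit : IsUnit (u ^ 3 + u ^ 2 * v + u * v ^ 2 + v ^ 3) := by
    refine IsUnit.of_map π _ (isUnit_iff_ne_zero.2 ?_)
    simp only [map_add, map_mul, map_pow, h]
    have : π v ^ 3 + π v ^ 2 * π v + π v * π v ^ 2 + π v ^ 3 = 4 * π v ^ 3 := by ring
    rw [this]
    exact mul_ne_zero (by norm_num) (pow_ne_zero _ h0)
  have : (u ^ 3 + u ^ 2 * v + u * v ^ 2 + v ^ 3) * (u - v) = 0 := by linear_combination huv
  exact sub_eq_zero.1 (hunit.mul_left_eq_zero.1 (by rwa [mul_comm] at this))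

end FourthRoot

/-! ### Polynomials whose weight matches the form degree, and the universal root -/

section Diagonal

open MvPolynomial

variable {E : Type*} [CommRing E] [Algebra ℂ E] (𝒢 : ℕ → Submodule ℂ E) [SetLike.GradedMonoid 𝒢]

/-- The polynomials in two variables of weights `4` and `8` in which the weight of each monomial is
the degree of its coefficient. -/
def diagonal : Subalgebra ℂ (MvPolynomial (Fin 2) E) where
  carrier := {P | ∀ m, coeff m P ∈ 𝒢 (2 * Finsupp.weight ![2, 4] m)}
  mul_mem' {P Q} hP hQ m := by
    classical
    rw [coeff_mul]
    refine Submodule.sum_mem _ fun x hx => ?_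
    rw [← Finset.HasAntidiagonal.mem_antidiagonal.1 hx, map_add, mul_add]
    exact SetLike.mul_mem_graded (hP x.1) (hQ x.2)
  add_mem' {P Q} hP hQ m := by rw [coeff_add]; exact Submodule.add_mem _ (hP m) (hQ m)
  algebraMap_mem' c m := by
    classical
    rw [IsScalarTower.algebraMap_apply ℂ E, algebraMap_eq, coeff_C]
    split_ifs with h
    · rw [← h, map_zero, mul_zero, Algebra.algebraMap_eq_smul_one]
      exact Submodule.smul_mem _ _ (SetLike.GradedOne.one_mem)
    · exact Submodule.zero_mem _

variable {ι : Type*} [Fintype ι] [DecidableEq ι] (N : ℕ) (F : Matrix ι ι E) (hF : F ^ (N + 1) = 0)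

theorem pow_apply_mem (hF : ∀ i j, F i j ∈ 𝒢 2) (n : ℕ) (i j : ι) : (F ^ n) i j ∈ 𝒢 (2 * n) := by
  induction n generalizing i j with
  | zero =>
    rw [pow_zero, Matrix.one_apply]
    split_ifs
    · exact SetLike.GradedOne.one_mem (A := 𝒢)
    · exact Submodule.zero_mem _
  | succ n ih =>
    rw [pow_succ, Matrix.mul_apply, mul_add, mul_one]
    exact Submodule.sum_mem _ fun l _ => SetLike.mul_mem_graded (ih i l) (hF l j)

/-- The power series `h / x²` with universal coefficients. -/
def solutionSeries (E : Type*) [CommRing E] [Algebra ℂ E] : PowerSeries (MvPolynomial (Fin 2) E) :=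
  PowerSeries.mk fun n => MvPolynomial.map (algebraMap ℂ E) (solutionCoeff (n + 2))

theorem map_pow_eq_zero {R S : Type*} [CommRing R] [CommRing S] (φ : R →+* S) {m : ℕ}
    {F : Matrix ι ι R} (h : F ^ m = 0) : F.map φ ^ m = 0 := by
  change φ.mapMatrix F ^ m = 0
  rw [← map_pow, h, map_zero]

/-- The determinant of `h(F) / F²`. -/
def solutionDet : MvPolynomial (Fin 2) E :=
  (nilEval N (F.map C) (map_pow_eq_zero C hF) (solutionSeries E)).det

/-- The coefficient of xⁿ in h/x² has weight n and multiplies an entry of Fⁿ, which has degree 2n.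
Sums and products preserve this matching, hence so does the determinant. -/
theorem solutionDet_mem (h2 : ∀ i j, F i j ∈ 𝒢 2) : solutionDet N F hF ∈ diagonal 𝒢 := by
  rw [solutionDet, Matrix.det_apply]
  refine Subalgebra.sum_mem _ fun σ _ => ?_
  refine (diagonal 𝒢).toSubmodule.smul_of_tower_mem _ (Subalgebra.prod_mem _ fun i _ => ?_)
  rw [nilEval_apply, Matrix.sum_apply]
  refine Subalgebra.sum_mem _ fun n _ => ?_
  rw [solutionSeries, PowerSeries.coeff_mk, Matrix.smul_apply, smul_eq_mul,
    show F.map C ^ n = (F ^ n).map C from (map_pow (RingHom.mapMatrix C) F n).symm,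
    Matrix.map_apply]
  intro m
  rw [mul_comm (MvPolynomial.map _ _), coeff_C_mul, coeff_map, mul_comm ((F ^ n) _ _)]
  by_cases hm : coeff m (solutionCoeff (n + 2)) = 0
  · rw [hm, map_zero, zero_mul]; exact Submodule.zero_mem _
  · rw [isWeightedHomogeneous_solutionCoeff (n + 2) hm, Nat.add_sub_cancel, ← Algebra.smul_def]
    exact Submodule.smul_mem _ _ (pow_apply_mem 𝒢 F h2 n _ _)

theorem isNilpotent_solutionDet_sub_one : IsNilpotent (solutionDet N F hF - 1) := by
  obtain ⟨g, hg⟩ : ∃ g, solutionSeries E = 1 + PowerSeries.X * g := by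
    obtain ⟨g, hg⟩ : PowerSeries.X ∣ solutionSeries E - 1 := by
      rw [PowerSeries.X_dvd_iff, map_sub, map_one, ← PowerSeries.coeff_zero_eq_constantCoeff_apply,
        solutionSeries, PowerSeries.coeff_mk, zero_add, solutionCoeff_two, map_one, sub_self]
    exact ⟨g, by rw [← hg]; ring⟩
  rw [solutionDet, hg, map_add, map_one]
  refine isNilpotent_det_one_add _ ⟨N + 1, ?_⟩
  rw [← map_pow, mul_pow, map_mul, map_pow, nilEval_X, map_pow_eq_zero C hF, zero_mul]

/-- By uniqueness of the solution, G is the specialisation of `solutionSeries` at (a, b), and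
evaluation at F commutes with change of rings. Theta functions and hyperbolic functions are compared
through this lemma. -/
theorem eval_solutionDet {S : Type*} [CommRing S] [Algebra E S] (a b : S) (G : PowerSeries S)
    (hode : PowerSeries.derivative S (PowerSeries.derivative S (PowerSeries.X ^ 2 * G)) =
      2 - PowerSeries.C a * (PowerSeries.X ^ 2 * G) +
        6 * PowerSeries.C b * (PowerSeries.X ^ 2 * G) ^ 2) :
    aeval ![a, b] (solutionDet N F hF) = (nilEval N (F.map (algebraMap E S))
      (map_pow_eq_zero (algebraMap E S) hF) G).det := by
  have hG : G = PowerSeries.map (aeval ![a, b] : MvPolynomial (Fin 2) E →ₐ[E] S).toRingHom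
      (solutionSeries E) := by
    ext n
    have := coeff_eq_solutionCoeff ((algebraMap E S).comp (algebraMap ℂ E)) a b
      (PowerSeries.X ^ 2 * G) (by simp) (by
        rw [PowerSeries.coeff_X_pow_mul']; simp) hode (n + 2)
    rw [PowerSeries.coeff_X_pow_mul] at this
    rw [this, PowerSeries.coeff_map, solutionSeries, PowerSeries.coeff_mk]
    simp only [AlgHom.toRingHom_eq_coe, RingHom.coe_coe, aeval_def]
    rw [eval₂_map]
  have hmap : F.map (algebraMap E S) =
      (F.map C).map (aeval ![a, b] : MvPolynomial (Fin 2) E →ₐ[E] S).toRingHom := by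
    ext i j; simp
  rw [solutionDet]
  change (aeval ![a, b] : MvPolynomial (Fin 2) E →ₐ[E] S).toRingHom _ = _
  rw [RingHom.map_det, RingHom.mapMatrix_apply,
    map_nilEval _ N (F.map C) _ (hmap ▸ map_pow_eq_zero (algebraMap E S) hF), ← hG]
  simp only [← hmap]

/-- The universal fourth root: a diagonal polynomial `Φ` with `Φ⁴ det (h(F) / F²) = 1`. -/
theorem exists_solutionRoot (h2 : ∀ i j, F i j ∈ 𝒢 2) : ∃ Φ ∈ diagonal 𝒢,
    IsNilpotent (Φ - 1) ∧ Φ ^ 4 * solutionDet N F hF = 1 := by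
  have hnil : IsNilpotent ((⟨solutionDet N F hF, solutionDet_mem 𝒢 N F hF h2⟩ : diagonal 𝒢) - 1) := by
    obtain ⟨m, hm⟩ := isNilpotent_solutionDet_sub_one N F hF
    exact ⟨m, Subtype.ext hm⟩
  obtain ⟨Φ, hΦ, hΦ'⟩ := exists_inverse_fourth_root _ hnil
  exact ⟨Φ, Φ.2, hΦ.map (diagonal 𝒢).val, congrArg Subtype.val hΦ'⟩

end Diagonal

/-! ### The degeneration to the hyperbolic tangent -/

section Tanh

/-- If `u = tanh (x / 2)` and `v = sinh² (x / 2)`, then `h = 4 u² (1 - 16 η v)` satisfies, to first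
order in `η`, the equation `h'' = 2 - (2 + 48 η) h + 6 (1 / 16 - η) h²`. -/
theorem tanh_ode {S A : Type*} [CommRing S] [CommRing A] [Algebra S A] [Algebra ℂ A]
    (D : Derivation S A A) (u v η b : A) (hu : 2 * D u = 1 - u ^ 2) (hv : D v = u * (1 + v))
    (huv : v = u ^ 2 * (1 + v)) (hη : η ^ 2 = 0) (hDη : D η = 0) (hb : 16 * b = 1 - 16 * η) :
    D (D (4 * u ^ 2 * (1 - 16 * η * v))) =
      2 - (2 + 48 * η) * (4 * u ^ 2 * (1 - 16 * η * v)) +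
        6 * b * (4 * u ^ 2 * (1 - 16 * η * v)) ^ 2 := by
  have c2 : ∀ m : ℕ, D (OfNat.ofNat (m + 2)) = 0 := fun m => by
    rw [← Nat.cast_ofNat]; exact D.map_natCast _
  have hinj : ∀ {x y : A}, 8 * x = 8 * y → x = y := fun {x y} h => by
    have h8 : IsUnit (8 : A) := by
      have : IsUnit (algebraMap ℂ A 8) := (isUnit_iff_ne_zero.2 (by norm_num)).map _
      rwa [map_ofNat] at this
    exact h8.mul_left_cancel h
  have h1 : D (4 * u ^ 2 * (1 - 16 * η * v)) =
      4 * u * (1 - u ^ 2) - 64 * η * (u * v + u ^ 3) := by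
    have : D (4 * u ^ 2 * (1 - 16 * η * v)) =
        8 * u * D u * (1 - 16 * η * v) - 64 * u ^ 2 * η * D v := by
      have e4 : D (4 : A) = 0 := c2 2
      have e16 : D (16 : A) = 0 := c2 14
      have e1 : D (1 : A) = 0 := D.map_one_eq_zero
      simp only [Derivation.leibniz, Derivation.leibniz_pow, map_sub, smul_eq_mul, nsmul_eq_mul,
        hDη, e4, e16, e1]
      push_cast; ring
    rw [this, hv]
    linear_combination 4 * u * (1 - 16 * η * v) * hu
  rw [h1]
  have h2 : D (4 * u * (1 - u ^ 2) - 64 * η * (u * v + u ^ 3)) =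
      4 * (1 - 3 * u ^ 2) * D u - 64 * η * (D u * v + u * D v + 3 * u ^ 2 * D u) := by
    have e4 : D (4 : A) = 0 := c2 2
    have e16 : D (64 : A) = 0 := c2 62
    have e1 : D (1 : A) = 0 := D.map_one_eq_zero
    simp only [Derivation.leibniz, Derivation.leibniz_pow, map_sub, map_add, smul_eq_mul,
      nsmul_eq_mul, hDη, e4, e16, e1]
    push_cast; ring
  rw [h2, hv]
  -- The factor 8 clears the denominators hidden in `hu` and `hb`: 8 · 6b = 3 · 16b.
  refine hinj ?_
  linear_combination (16 * (1 - 3 * u ^ 2) - 256 * η * (v + 3 * u ^ 2)) * hu -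
    3 * (4 * u ^ 2 * (1 - 16 * η * v)) ^ 2 * hb -
    256 * η * (1 + 6 * u ^ 2) * huv + (196608 * u ^ 4 * v ^ 2 * η - 24576 * u ^ 2 * v -
      24576 * u ^ 4 * v - 12288 * u ^ 4 * v ^ 2) * hη

end Tanh

/-! ### Top-degree coefficients of diagonal polynomials -/

section Extraction

open MvPolynomial

/-- The exponents of `X₀ ^ (2k+1-2r) X₁ ^ r`. -/
def weightIndex (k r : ℕ) : Fin 2 →₀ ℕ := Finsupp.single 0 (2 * k + 1 - 2 * r) + Finsupp.single 1 r

/-- The monomial a^i b^j has a coefficient of degree 4i + 8j, and L sees only degree 8k+4, so i = 2k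
+ 1 - 2j with j ≤ k. The map ψ stands for a coefficient of a power series or a component of a dual
number; the vectors L(coeff Φ) do not depend on it. -/
theorem linear_aeval_diagonal {E : Type*} [CommRing E] [Algebra ℂ E] (𝒢 : ℕ → Submodule ℂ E)
    [SetLike.GradedMonoid 𝒢] {S V : Type*} [CommRing S] [Algebra E S] [AddCommGroup V] [Module ℂ V]
    (k : ℕ) (L : E →ₗ[ℂ] V) (hL : ∀ d, d ≠ 8 * k + 4 → ∀ x ∈ 𝒢 d, L x = 0) (a b : S)
    (ψ : S →ₗ[E] E) (c : ℕ → ℕ → ℂ) (hψ : ∀ i j, ψ (a ^ i * b ^ j) = algebraMap ℂ E (c i j))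
    {Φ : MvPolynomial (Fin 2) E} (hΦ : Φ ∈ diagonal 𝒢) :
    L (ψ (aeval ![a, b] Φ)) =
      ∑ r ∈ Finset.range (k + 1), c (2 * k + 1 - 2 * r) r • L (coeff (weightIndex k r) Φ) := by
  classical
  have h1 : L (ψ (aeval ![a, b] Φ)) = ∑ m ∈ Φ.support, c (m 0) (m 1) • L (coeff m Φ) := by
    rw [aeval_def, eval₂_eq', map_sum, map_sum]
    refine Finset.sum_congr rfl fun m _ => ?_
    rw [Fin.prod_univ_two, ← Algebra.smul_def, map_smul]
    simp only [Matrix.cons_val_zero, Matrix.cons_val_one]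
    rw [hψ, smul_eq_mul, mul_comm, ← Algebra.smul_def, map_smul]
  have h2 : ∀ r, weightIndex k r 0 = 2 * k + 1 - 2 * r := fun r => by simp [weightIndex]
  have h3 : ∀ r, weightIndex k r 1 = r := fun r => by simp [weightIndex]
  have hinj : Function.Injective (weightIndex k) := fun r s h => by
    rw [← h3 r, h, h3]
  have h4 : ∑ r ∈ Finset.range (k + 1), c (2 * k + 1 - 2 * r) r • L (coeff (weightIndex k r) Φ) =
      ∑ m ∈ (Finset.range (k + 1)).image (weightIndex k), c (m 0) (m 1) • L (coeff m Φ) := by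
    rw [Finset.sum_image fun _ _ _ _ h => hinj h]
    simp only [h2, h3]
  rw [h1, h4, ← finsum_eq_sum_of_support_subset, ← finsum_eq_sum_of_support_subset]
  · intro m hm
    have hw : Finsupp.weight ![2, 4] m = 2 * m 0 + 4 * m 1 := by
      rw [Finsupp.weight_apply, Finsupp.sum_fintype _ _ (by simp), Fin.sum_univ_two]
      simp [mul_comm]
    have hm2 : 2 * (2 * m 0 + 4 * m 1) = 8 * k + 4 := by
      by_contra hne
      refine hm ?_
      beta_reduce
      rw [hL _ hne _ (hw ▸ hΦ m), smul_zero]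
    simp only [Finset.coe_image, Set.mem_image, Finset.coe_range, Set.mem_Iio]
    refine ⟨m 1, by omega, ?_⟩
    ext i
    fin_cases i
    · change weightIndex k (m 1) 0 = m 0
      rw [h2]; omega
    · exact h3 _
  · intro m hm
    rw [Finset.mem_coe, mem_support_iff]
    intro h0
    refine hm ?_
    beta_reduce
    rw [h0, L.map_zero, smul_zero]

end Extraction

/-! ### Inversion of the recursion for b_r, and its first values -/

section Recursion

open PowerSeries

/-- The coefficient of `q^{j/2}` in `(8 δ₂)^{2k+1-2s} ε₂^s`. -/
def basisCoeff (k j s : ℕ) : ℤ := coeff j (eightDeltaTwo ^ (2 * k + 1 - 2 * s) * epsilonTwo ^ s)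

theorem constantCoeff_thetaOneProduct : constantCoeff thetaOneProduct = 1 := by
  rw [← coeff_zero_eq_constantCoeff_apply, thetaOneProduct, infiniteProduct, coeff_mk]
  simp

theorem constantCoeff_thetaThreeSeries : constantCoeff thetaThreeSeries = 1 := by
  rw [← coeff_zero_eq_constantCoeff_apply, thetaThreeSeries, infiniteProduct, coeff_mk]
  simp

theorem constantCoeff_eightDeltaTwo : constantCoeff eightDeltaTwo = -1 := by
  simp [eightDeltaTwo, constantCoeff_thetaThreeSeries]

theorem basisCoeff_of_lt (k : ℕ) {j s : ℕ} (h : j < s) : basisCoeff k j s = 0 := by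
  rw [basisCoeff, epsilonTwo, mul_assoc X, mul_pow, mul_left_comm, coeff_X_pow_mul',
    if_neg (by omega)]

theorem basisCoeff_self {k s : ℕ} (h : s ≤ k) : basisCoeff k s s = -1 := by
  rw [basisCoeff, epsilonTwo, mul_assoc X, mul_pow, mul_left_comm, coeff_X_pow_mul', if_pos le_rfl,
    Nat.sub_self, coeff_zero_eq_constantCoeff_apply]
  simp only [map_mul, map_pow, constantCoeff_eightDeltaTwo, constantCoeff_thetaOneProduct,
    constantCoeff_thetaThreeSeries, one_pow, mul_one]
  exact Odd.neg_one_pow ⟨k - s, by omega⟩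

theorem coeffB_eq (k r j : ℕ) : coeffB k r j = (if r = j then -1 else 0) +
    ∑ s ∈ Finset.range r, basisCoeff k r s * coeffB k s j := by
  rw [coeffB, Finset.sum_range]; rfl

theorem coeffB_of_lt (k : ℕ) {r j : ℕ} (h : r < j) : coeffB k r j = 0 := by
  induction r using Nat.strong_induction_on with
  | _ r ih =>
    rw [coeffB_eq, if_neg (by omega), Finset.sum_eq_zero, add_zero]
    intro s hs
    have := Finset.mem_range.1 hs
    rw [ih s this (by omega), mul_zero]

/-- The recursion for `b_r` inverts the expansion in powers of `8 δ₂` and `ε₂`. -/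
theorem sum_coeffB_smul {V : Type*} [AddCommGroup V] (k : ℕ) (α β : ℕ → V)
    (h : ∀ j ≤ k, β j = ∑ s ∈ Finset.range (k + 1), basisCoeff k j s • α s) {r : ℕ} (hr : r ≤ k) :
    ∑ j ∈ Finset.range (r + 1), coeffB k r j • β j = α r := by
  induction r using Nat.strong_induction_on with
  | _ r ih =>
    have h1 : ∀ s < r, ∑ j ∈ Finset.range (r + 1), coeffB k s j • β j = α s := by
      intro s hs
      rw [← ih s hs (by omega)]
      symm
      refine Finset.sum_subset (Finset.range_subset_range.2 (by omega)) fun j _ hj => ?_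
      rw [coeffB_of_lt k (by simpa using hj), zero_smul]
    have h2 : β r = ∑ s ∈ Finset.range r, basisCoeff k r s • α s - α r := by
      rw [h r hr, ← Finset.sum_subset (Finset.range_subset_range.2 (show r + 1 ≤ k + 1 by omega))
        fun s _ hs => by rw [basisCoeff_of_lt k (by simpa using hs), zero_smul],
        Finset.sum_range_succ, basisCoeff_self hr, neg_one_smul, sub_eq_add_neg]
    simp only [coeffB_eq k r, add_smul, Finset.sum_smul, Finset.sum_add_distrib, ite_smul, zero_smul,
      mul_smul]
    rw [Finset.sum_comm]
    simp only [← Finset.smul_sum]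
    have h3 : ∑ s ∈ Finset.range r, basisCoeff k r s • ∑ j ∈ Finset.range (r + 1),
        coeffB k s j • β j = ∑ s ∈ Finset.range r, basisCoeff k r s • α s :=
      Finset.sum_congr rfl fun s hs => by rw [h1 s (Finset.mem_range.1 hs)]
    rw [h3, Finset.sum_ite_eq, if_pos (by simp), h2]
    simp

theorem coeff_one_thetaThreeSeries : coeff 1 thetaThreeSeries = 2 := by
  rw [thetaThreeSeries, infiniteProduct, coeff_mk]
  have : (1 - X ^ (2 * (0 + 1))) * (1 + X ^ (2 * 0 + 1)) ^ 2 =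
      (1 + C 2 * X ^ 1 - C 2 * X ^ 3 - X ^ 4 : PowerSeries ℤ) := by
    rw [show (C 2 : PowerSeries ℤ) = 2 from map_ofNat C 2]; ring
  rw [Finset.prod_range_one, this, map_sub, map_sub, map_add, coeff_C_mul, coeff_C_mul]
  simp [coeff_X_pow, coeff_one]

theorem coeff_one_eightDeltaTwo : coeff 1 eightDeltaTwo = -24 := by
  have h : coeff 1 (16 * X * thetaOneProduct ^ 4) = 16 := by
    rw [mul_comm (16 : PowerSeries ℤ), mul_assoc, show 1 = 0 + 1 from rfl, coeff_succ_X_mul]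
    simp [constantCoeff_thetaOneProduct, map_ofNat]
  rw [eightDeltaTwo, map_neg, map_add, h, coeff_one_pow, coeff_one_thetaThreeSeries]
  simp [constantCoeff_thetaThreeSeries]

theorem coeffB_zero_zero (k : ℕ) : coeffB k 0 0 = -1 := by
  rw [coeffB_eq]; simp

theorem coeffB_one_one (k : ℕ) : coeffB k 1 1 = -1 := by
  rw [coeffB_eq, Finset.sum_range_one, coeffB_of_lt k one_pos]; simp

/-- The coefficient of q^{1/2} in (8δ₂)⁵ = (-1 - 24q^{1/2} - ⋯)⁵ is -120, and it is multiplied by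
`coeffB 2 0 0`, which is -1. -/
theorem coeffB_two_one_zero : coeffB 2 1 0 = 120 := by
  rw [coeffB_eq, Finset.sum_range_one, coeffB_zero_zero, basisCoeff, pow_zero, mul_one,
    coeff_one_pow, coeff_one_eightDeltaTwo, constantCoeff_eightDeltaTwo]
  norm_num

end Recursion

/-! ### Matrix functors -/

section MatrixFunctors

/-- A natural multiplicative map from `ι × ι` matrices to `I × I` matrices over commutative rings,
together with its differential at the identity. -/
structure MatrixFunctor (ι I : Type) [Fintype ι] [DecidableEq ι] [Fintype I] [DecidableEq I] where
  /-- The multiplicative map. -/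
  act : ∀ (R : Type) [CommRing R], Matrix ι ι R →* Matrix I I R
  /-- The differential at the identity. -/
  lin : ∀ (R : Type) [CommRing R], Matrix ι ι R →ₗ[R] Matrix I I R
  act_map : ∀ {R S : Type} [CommRing R] [CommRing S] (f : R →+* S) (A : Matrix ι ι R),
    (act R A).map f = act S (A.map f)
  lin_map : ∀ {R S : Type} [CommRing R] [CommRing S] (f : R →+* S) (A : Matrix ι ι R),
    (lin R A).map f = lin S (A.map f)
  act_one_add : ∀ {R : Type} [CommRing R] (s : R), s * s = 0 → ∀ A : Matrix ι ι R,
    act R (1 + s • A) = 1 + s • lin R A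

namespace MatrixFunctor

variable {ι I : Type} [Fintype ι] [DecidableEq ι] [Fintype I] [DecidableEq I]

/-- As s² = t² = 0, the inverses of 1 + sA and 1 + tB are 1 - sA and 1 - tB, and only the term in st
survives. -/
theorem group_commutator {S : Type} [CommRing S] {κ : Type} [Fintype κ] [DecidableEq κ] (s t : S)
    (hs : s * s = 0) (ht : t * t = 0) (A B : Matrix κ κ S) :
    (1 + s • A) * (1 + t • B) * (1 + s • -A) * (1 + t • -B) = 1 + (s * t) • (A * B - B * A) := by
  have e1 : ∀ X Y : Matrix κ κ S, (s • X) * (s • Y) = 0 := fun X Y => by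
    rw [smul_mul_smul_comm, hs, zero_smul]
  have e2 : ∀ X Y : Matrix κ κ S, (t • X) * (t • Y) = 0 := fun X Y => by
    rw [smul_mul_smul_comm, ht, zero_smul]
  have e3 : (1 + t • B) * (1 + s • -A) = (1 + s • -A) * (1 + t • B) + (s * t) • (A * B - B * A) := by
    simp only [mul_add, add_mul, one_mul, mul_one, smul_mul_smul_comm, smul_sub, mul_neg, neg_mul,
      smul_neg, mul_comm t s]
    abel
  have e4 : (1 + s • A) * (1 + s • -A) = 1 := by
    simp only [mul_add, add_mul, one_mul, mul_one, e1, smul_neg, mul_neg]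
    simp
  have e5 : (1 + t • B) * (1 + t • -B) = 1 := by
    simp only [mul_add, add_mul, one_mul, mul_one, e2, smul_neg, mul_neg]
    simp
  have e6 : ∀ X Y Z : Matrix κ κ S, (1 + s • X) * ((s * t) • Y) * (1 + t • Z) = (s * t) • Y := by
    intro X Y Z
    simp only [mul_add, add_mul, one_mul, mul_one, smul_mul_smul_comm]
    rw [← mul_assoc, hs, show s * t * t = 0 by rw [mul_assoc, ht, mul_zero]]
    simp
  rw [mul_assoc (1 + s • A), e3, mul_add (1 + s • A), add_mul _ _ (1 + t • -B), ← mul_assoc, e4,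
    one_mul, e5, e6]

/-- The differential of a multiplicative natural map respects commutators. -/
theorem lin_commutator (ρ : MatrixFunctor ι I) {R : Type} [CommRing R] (A B : Matrix ι ι R) :
    ρ.lin R (A * B - B * A) = ρ.lin R A * ρ.lin R B - ρ.lin R B * ρ.lin R A := by
  -- The ring R[s, t]/(s², t²): a multiplicative map respects the group commutator of 1 + sA and 1 +
  -- tB, and comparing the coefficients of st gives the Lie bracket.
  let f : R →+* DualNumber (DualNumber R) := (TrivSqZeroExt.inlHom _ _).comp
    (TrivSqZeroExt.inlHom R R)
  let s : DualNumber (DualNumber R) := DualNumber.eps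
  let t : DualNumber (DualNumber R) := TrivSqZeroExt.inl DualNumber.eps
  have hs : s * s = 0 := DualNumber.eps_mul_eps
  have ht : t * t = 0 := by
    simp only [t, ← TrivSqZeroExt.inl_mul, DualNumber.eps_mul_eps, TrivSqZeroExt.inl_zero]
  have hst : (s * t) * (s * t) = 0 := by
    rw [show s * t * (s * t) = s * s * (t * t) by ring, hs, zero_mul]
  have h1 := congrArg (ρ.act _) (group_commutator s t hs ht (A.map f) (B.map f))
  rw [map_mul, map_mul, map_mul, ρ.act_one_add s hs, ρ.act_one_add t ht, ρ.act_one_add s hs,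
    ρ.act_one_add t ht, ρ.act_one_add _ hst, map_neg, map_neg, group_commutator s t hs ht,
    ← ρ.lin_map, ← ρ.lin_map, add_right_inj] at h1
  have h2 : A.map f * B.map f - B.map f * A.map f = (A * B - B * A).map f := by
    simp only [← RingHom.mapMatrix_apply, map_mul, map_sub]
  have h3 : (ρ.lin R A).map f * (ρ.lin R B).map f - (ρ.lin R B).map f * (ρ.lin R A).map f =
      (ρ.lin R A * ρ.lin R B - ρ.lin R B * ρ.lin R A).map f := by
    simp only [← RingHom.mapMatrix_apply, map_mul, map_sub]
  rw [h2, h3, ← ρ.lin_map] at h1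
  ext i j
  have h4 := congrArg (fun M : Matrix I I (DualNumber (DualNumber R)) => (M i j).snd.snd) h1
  have h5 : ∀ x : R, ((s * t) * f x).snd.snd = x := by
    intro x; simp [s, t, f]
  simp only [Matrix.smul_apply, smul_eq_mul, Matrix.map_apply, h5] at h4
  exact h4.symm

/-- Translation of the variable of a polynomial by a number of square zero. -/
def taylorDual (R : Type) [CommRing R] : Polynomial R →+* DualNumber (Polynomial R) where
  toFun p := TrivSqZeroExt.inl p + TrivSqZeroExt.inr (Polynomial.derivative p)
  map_one' := by simp
  map_zero' := by simp
  map_add' p q := by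
    rw [TrivSqZeroExt.inl_add, map_add, TrivSqZeroExt.inr_add]; abel
  map_mul' p q := by
    ext
    · simp
    · simp [Polynomial.derivative_mul]; ring

theorem taylorDual_apply {R : Type} [CommRing R] (p : Polynomial R) :
    taylorDual R p = TrivSqZeroExt.inl p + TrivSqZeroExt.inr (Polynomial.derivative p) := rfl

theorem taylorDual_snd {R : Type} [CommRing R] (p : Polynomial R) :
    (taylorDual R p).snd = Polynomial.derivative p := by
  rw [taylorDual_apply, TrivSqZeroExt.snd_add, TrivSqZeroExt.snd_inl, TrivSqZeroExt.snd_inr, zero_add]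

theorem rescale_eps_exp {S : Type} [CommRing S] [Algebra ℚ S] (s : S) (hs : s * s = 0) :
    PowerSeries.rescale s (PowerSeries.exp S) = 1 + PowerSeries.C s * PowerSeries.X := by
  ext n
  rw [PowerSeries.coeff_rescale, map_add, PowerSeries.coeff_C_mul, PowerSeries.coeff_X,
    PowerSeries.coeff_one, PowerSeries.coeff_exp]
  match n with
  | 0 => simp
  | 1 => simp
  | n + 2 =>
    rw [pow_add, sq, hs]; simp

theorem map_rescale_exp {R S : Type} [CommRing R] [CommRing S] [Algebra ℚ R] [Algebra ℚ S]
    (φ : R →+* S) (r : R) : PowerSeries.map φ (PowerSeries.rescale r (PowerSeries.exp R)) =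
      PowerSeries.rescale (φ r) (PowerSeries.exp S) := by
  ext1 n
  rw [PowerSeries.coeff_map, PowerSeries.coeff_rescale, PowerSeries.coeff_rescale, map_mul,
    map_pow, PowerSeries.coeff_exp, PowerSeries.coeff_exp]
  congr 1
  exact congrFun (congrArg DFunLike.coe (Subsingleton.elim
    (φ.comp (algebraMap ℚ R)) (algebraMap ℚ S))) _

/-- A multiplicative natural map takes the exponential of a nilpotent matrix to the exponential of
its differential. -/
theorem act_exp (ρ : MatrixFunctor ι I) {R : Type} [CommRing R] [Algebra ℚ R] (N : ℕ)
    (F : Matrix ι ι R) (hF : F ^ (N + 1) = 0) (hL : ρ.lin R F ^ (N + 1) = 0) :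
    ρ.act R (nilEval N F hF (PowerSeries.exp R)) =
      nilEval N (ρ.lin R F) hL (PowerSeries.exp R) := by
  -- Y is the image under ρ of the one-parameter group exp(tF), with the parameter t as polynomial
  -- variable.
  set Y : Matrix I I (Polynomial R) := ρ.act (Polynomial R) (nilEval N (F.map Polynomial.C)
    (map_pow_eq_zero Polynomial.C hF)
    (PowerSeries.rescale Polynomial.X (PowerSeries.exp (Polynomial R)))) with hY
  have heval : ∀ r : R, Y.map (Polynomial.evalRingHom r) =
      ρ.act R (nilEval N F hF (PowerSeries.rescale r (PowerSeries.exp R))) := by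
    intro r
    have e : (F.map Polynomial.C).map (Polynomial.evalRingHom r) = F := by ext; simp
    rw [hY, ρ.act_map, map_nilEval _ _ _ _ (by rw [e]; exact hF), map_rescale_exp,
      show Polynomial.evalRingHom r Polynomial.X = r from Polynomial.eval_X]
    simp only [e]
  -- The equation Y' = Y · `lin` F comes from Y(t + ε) = Y(t) ρ(exp(εF)) with exp(εF) = 1 + εF,
  -- multiplicativity being used over the dual numbers.
  have hderiv : Y.map Polynomial.derivative = Y * (ρ.lin R F).map Polynomial.C := by
    let inl : Polynomial R →+* DualNumber (Polynomial R) := TrivSqZeroExt.inlHom _ _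
    let ε : DualNumber (Polynomial R) := DualNumber.eps
    have hε : ε * ε = 0 := DualNumber.eps_mul_eps
    have e : (F.map Polynomial.C).map (taylorDual R) = (F.map Polynomial.C).map inl := by
      ext1 i j
      rw [Matrix.map_apply, Matrix.map_apply, Matrix.map_apply, taylorDual_apply,
        Polynomial.derivative_C, TrivSqZeroExt.inr_zero, add_zero]
      rfl
    have e2 : taylorDual R Polynomial.X = inl Polynomial.X + ε := by
      rw [taylorDual_apply, Polynomial.derivative_X]
      rfl
    have hF' := map_pow_eq_zero inl (map_pow_eq_zero Polynomial.C hF)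
    have h1 : Y.map (taylorDual R) = Y.map inl * (1 + ε • ((ρ.lin R F).map Polynomial.C).map inl) := by
      rw [ρ.lin_map, ρ.lin_map, ← ρ.act_one_add ε hε, hY, ρ.act_map, ρ.act_map,
        map_nilEval (taylorDual R) _ _ _ (by rw [e]; exact hF'), map_rescale_exp, e2,
        ← PowerSeries.exp_mul_exp_eq_exp_add, map_mul, map_nilEval inl _ _ _ hF', map_rescale_exp]
      simp only [e]
      rw [map_mul, rescale_eps_exp ε hε, map_add, map_mul, map_one, nilEval_C, nilEval_X,
        ← Algebra.smul_def]
    ext1 i j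
    have h2 := congrArg (fun M : Matrix I I (DualNumber (Polynomial R)) => (M i j).snd) h1
    have h3 : Y.map inl * (1 + ε • ((ρ.lin R F).map Polynomial.C).map inl) =
        Y.map inl + ε • (Y * (ρ.lin R F).map Polynomial.C).map inl := by
      simp only [← RingHom.mapMatrix_apply, map_mul]
      rw [mul_add, mul_one, mul_smul_comm]
    rw [h3] at h2
    rw [Matrix.add_apply, Matrix.smul_apply, Matrix.map_apply, Matrix.map_apply,
      Matrix.map_apply, taylorDual_snd] at h2
    have h4 : ∀ x y : Polynomial R, (inl x + ε • inl y).snd = y := by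
      intro x y
      simp [inl, ε]
    rw [h4] at h2
    exact h2
  have hcoeff : ∀ m, Y.map (fun p => p.coeff m) = algebraMap ℚ R (1 / m.factorial) • ρ.lin R F ^ m := by
    intro m
    induction m with
    | zero =>
      have h0 := heval 0
      rw [PowerSeries.rescale_zero_apply, PowerSeries.constantCoeff_exp, map_one, map_one,
        map_one] at h0
      have : Y.map (fun p => p.coeff 0) = Y.map (Polynomial.evalRingHom 0) := by
        ext i j; simp [Polynomial.coeff_zero_eq_eval_zero]
      rw [this, h0]; simp
    | succ m ih =>
      have h1 : ((m : R) + 1) • Y.map (fun p => p.coeff (m + 1)) =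
          Y.map (fun p => p.coeff m) * ρ.lin R F := by
        ext i j
        have := congrArg (fun M : Matrix I I (Polynomial R) => (M i j).coeff m) hderiv
        simp only [Matrix.map_apply, Polynomial.coeff_derivative, Matrix.mul_apply,
          Polynomial.finsetSum_coeff, Polynomial.coeff_mul_C] at this
        simp only [Matrix.smul_apply, Matrix.map_apply, Matrix.mul_apply, smul_eq_mul]
        rw [mul_comm, this]
      have h2 : algebraMap ℚ R (1 / (m + 1)) * ((m : R) + 1) = 1 := by
        have : ((m : R) + 1) = algebraMap ℚ R (m + 1) := by simp
        rw [this, ← map_mul, one_div_mul_cancel (by exact_mod_cast m.succ_ne_zero), map_one]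
      have h3 := congrArg (fun M => algebraMap ℚ R (1 / (m + 1)) • M) h1
      simp only [smul_smul, h2, one_smul] at h3
      rw [h3, ih, smul_mul_assoc, smul_smul, ← pow_succ, ← map_mul, Nat.factorial_succ]
      congr 2
      push_cast
      rw [one_div_mul_one_div]
  have h1 := heval 1
  rw [PowerSeries.rescale_one, RingHom.id_apply] at h1
  rw [← h1, nilEval_apply]
  ext i j
  -- Nilpotency of `lin` F bounds the degree in t, so setting t = 1 gives the same finite sum as
  -- `nilEval`.
  have hdeg : (Y i j).natDegree < N + 1 := by
    rw [Nat.lt_succ_iff, Polynomial.natDegree_le_iff_coeff_eq_zero]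
    intro m hm
    have := congrArg (fun M : Matrix I I R => M i j) (hcoeff m)
    simp only [Matrix.map_apply] at this
    rw [this, ← Nat.sub_add_cancel (Nat.succ_le_of_lt hm), pow_add, hL]
    simp
  rw [Matrix.map_apply, Polynomial.coe_evalRingHom, Polynomial.eval_eq_sum_range' hdeg,
    Matrix.sum_apply]
  refine Finset.sum_congr rfl fun m _ => ?_
  have := congrArg (fun M : Matrix I I R => M i j) (hcoeff m)
  simp only [Matrix.map_apply] at this
  rw [this, PowerSeries.coeff_exp, one_pow, mul_one]

end MatrixFunctor

theorem prod_add_smul_of_sq_zero {S α : Type*} [CommRing S] [DecidableEq α] (t : Finset α) (s : S)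
    (hs : s * s = 0) (a b : α → S) : ∏ i ∈ t, (a i + s * b i) =
      ∏ i ∈ t, a i + s * ∑ i ∈ t, b i * ∏ j ∈ t.erase i, a j := by
  induction t using Finset.induction_on with
  | empty => simp
  | insert i t hi ih =>
    rw [Finset.prod_insert hi, ih, Finset.prod_insert hi, Finset.sum_insert hi,
      Finset.erase_insert hi]
    have : ∑ x ∈ t, b x * ∏ j ∈ (insert i t).erase x, a j =
        a i * ∑ x ∈ t, b x * ∏ j ∈ t.erase x, a j := by
      rw [Finset.mul_sum]
      refine Finset.sum_congr rfl fun x hx => ?_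
      have hxi : i ≠ x := fun h => hi (h ▸ hx)
      rw [Finset.erase_insert_of_ne hxi, Finset.prod_insert (by simp [hi])]
      ring
    rw [this]
    linear_combination (b i * ∑ x ∈ t, b x * ∏ j ∈ t.erase x, a j) * hs

namespace MatrixFunctor

variable {ι : Type} [Fintype ι] [DecidableEq ι]

/-- The tensor product of a finite family of functors. -/
def tensor {α : Type} [Fintype α] [DecidableEq α] {I : α → Type} [∀ a, Fintype (I a)]
    [∀ a, DecidableEq (I a)] (ρ : ∀ a, MatrixFunctor ι (I a)) : MatrixFunctor ι (∀ a, I a) where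
  act R _ :=
    { toFun := fun A => Matrix.of fun f f' => ∏ a, (ρ a).act R A (f a) (f' a)
      map_one' := by
        ext f f'
        simp only [map_one, Matrix.of_apply, Matrix.one_apply]
        rw [Finset.prod_ite_zero]
        simp [funext_iff]
      map_mul' := fun A B => by
        ext f f'
        simp only [map_mul, Matrix.of_apply, Matrix.mul_apply]
        rw [Finset.prod_univ_sum, Fintype.piFinset_univ]
        simp only [Finset.prod_mul_distrib] }
  lin R _ :=
    { toFun := fun A => Matrix.of fun f f' =>
        ∑ a, if ∀ b, b ≠ a → f b = f' b then (ρ a).lin R A (f a) (f' a) else 0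
      map_add' := fun A B => by
        ext f f'
        simp only [map_add, Matrix.of_apply, Matrix.add_apply, ← Finset.sum_add_distrib]
        refine Finset.sum_congr rfl fun a _ => ?_
        split_ifs <;> simp
      map_smul' := fun c A => by
        ext f f'
        simp only [map_smul, Matrix.of_apply, Matrix.smul_apply, RingHom.id_apply, Finset.smul_sum]
        refine Finset.sum_congr rfl fun a _ => ?_
        split_ifs <;> simp }
  act_map f A := by
    ext g g'
    simp [← (ρ _).act_map]
  lin_map f A := by
    ext g g'
    simp only [Matrix.map_apply, LinearMap.coe_mk, AddHom.coe_mk, Matrix.of_apply, map_sum,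
      ← (ρ _).lin_map]
    refine Finset.sum_congr rfl fun a _ => ?_
    split_ifs <;> simp
  act_one_add s hs A := by
    ext f f'
    simp only [MonoidHom.coe_mk, OneHom.coe_mk, Matrix.of_apply, (ρ _).act_one_add s hs,
      Matrix.add_apply, Matrix.smul_apply, smul_eq_mul, LinearMap.coe_mk, AddHom.coe_mk]
    rw [prod_add_smul_of_sq_zero _ _ hs]
    congr 1
    · simp only [Matrix.one_apply]
      rw [Finset.prod_ite_zero]
      simp [funext_iff]
    · congr 1
      refine Finset.sum_congr rfl fun a _ => ?_
      simp only [Matrix.one_apply]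
      rw [Finset.prod_ite_zero]
      simp

theorem trace_act_tensor {α : Type} [Fintype α] [DecidableEq α] {I : α → Type} [∀ a, Fintype (I a)]
    [∀ a, DecidableEq (I a)] (ρ : ∀ a, MatrixFunctor ι (I a)) {R : Type} [CommRing R]
    (A : Matrix ι ι R) : ((tensor ρ).act R A).trace = ∏ a, ((ρ a).act R A).trace := by
  simp only [Matrix.trace, Matrix.diag]
  rw [Finset.prod_univ_sum, Fintype.piFinset_univ]
  rfl

end MatrixFunctor

end MatrixFunctors

/-! ### Exterior powers -/

/-- Leibniz rule in the columns. It identifies the derivative of a minor with the sum of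
determinants defining the connection of `extPower`. -/
theorem det_add_smul_of_sq_zero {S κ : Type*} [CommRing S] [Fintype κ] [DecidableEq κ] (s : S)
    (hs : s * s = 0) (M A : Matrix κ κ S) :
    (M + s • A).det = M.det + s * ∑ a, (M.updateCol a fun b => A b a).det := by
  simp only [Matrix.det_apply', Matrix.add_apply, Matrix.smul_apply, smul_eq_mul,
    prod_add_smul_of_sq_zero _ _ hs, mul_add, Finset.sum_add_distrib]
  rw [Finset.sum_comm, Finset.mul_sum]
  congr 1
  refine Finset.sum_congr rfl fun σ _ => ?_
  rw [mul_left_comm, ← Finset.mul_sum]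
  congr 2
  refine Finset.sum_congr rfl fun a _ => ?_
  rw [← Finset.mul_prod_erase _ _ (Finset.mem_univ a), Matrix.updateCol_self]
  congr 1
  refine Finset.prod_congr rfl fun j hj => ?_
  rw [Matrix.updateCol_ne (Finset.ne_of_mem_erase hj)]

section Exterior

variable {N : ℕ} (p : ℕ)

/-- The matrix of the action on the `p`-th exterior power: its entries are minors. -/
def minorMatrix {R : Type*} [CommRing R] (A : Matrix (Fin N) (Fin N) R) :
    Matrix {S : Finset (Fin N) // S.card = p} {S : Finset (Fin N) // S.card = p} R :=
  Matrix.of fun S' S => (A.submatrix (S'.1.orderEmbOfFin S'.2) (S.1.orderEmbOfFin S.2)).det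

/-- The basis of the exterior power of `Rᴺ`. -/
def extBasis (N p : ℕ) (R : Type*) [CommRing R] :
    Module.Basis {S : Finset (Fin N) // S.card = p} R (⋀[R]^p (Fin N → R)) :=
  ((Pi.basisFun R (Fin N)).exteriorPower p).reindex
    { toFun := fun s => ⟨s.1, s.2⟩
      invFun := fun s => ⟨s.1, s.2⟩
      left_inv := fun _ => rfl
      right_inv := fun _ => rfl }

/-- Recognising the minors as the matrix of Λ^p A makes their multiplicativity, the Cauchy–Binet
formula, a consequence of functoriality. -/
theorem toMatrix_exteriorPower_map {R : Type*} [CommRing R] (A : Matrix (Fin N) (Fin N) R) :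
    LinearMap.toMatrix (extBasis N p R) (extBasis N p R)
      (exteriorPower.map p (Matrix.toLin' A)) = minorMatrix p A := by
  ext S' S
  rw [LinearMap.toMatrix_apply, extBasis, Module.Basis.reindex_apply, Module.Basis.repr_reindex,
    Finsupp.mapDomain_equiv_apply, exteriorPower.basis_apply,
    exteriorPower.map_apply_ιMulti_family, exteriorPower.basis_repr_apply,
    exteriorPower.ιMulti_family, exteriorPower.ιMultiDual_apply_ιMulti, minorMatrix,
    Matrix.of_apply, ← Matrix.det_transpose]
  congr 1
  ext a b
  simp [Set.powersetCard.ofFinEmbEquiv_symm_apply]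

theorem minorMatrix_mul {R : Type*} [CommRing R] (A B : Matrix (Fin N) (Fin N) R) :
    minorMatrix p (A * B) = minorMatrix p A * minorMatrix p B := by
  simp only [← toMatrix_exteriorPower_map]
  rw [Matrix.toLin'_mul, exteriorPower.map_comp, LinearMap.toMatrix_comp _ (extBasis N p R)]

theorem minorMatrix_one {R : Type*} [CommRing R] :
    minorMatrix p (1 : Matrix (Fin N) (Fin N) R) = 1 := by
  rw [← toMatrix_exteriorPower_map, Matrix.toLin'_one, exteriorPower.map_id, LinearMap.toMatrix_id]

/-- The exterior power as a functor of matrices. -/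
def MatrixFunctor.exterior (N p : ℕ) :
    MatrixFunctor (Fin N) {S : Finset (Fin N) // S.card = p} where
  act R _ :=
    { toFun := minorMatrix p
      map_one' := minorMatrix_one p
      map_mul' := minorMatrix_mul p }
  lin R _ :=
    { toFun := fun A => Matrix.of fun S' S => ∑ a : Fin p, Matrix.det
        (((1 : Matrix (Fin N) (Fin N) R).submatrix
          (S'.1.orderEmbOfFin S'.2) (S.1.orderEmbOfFin S.2)).updateCol a
            fun b => A (S'.1.orderEmbOfFin S'.2 b) (S.1.orderEmbOfFin S.2 a))
      map_add' := fun A B => by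
        ext S' S
        simp only [Matrix.of_apply, Matrix.add_apply, ← Finset.sum_add_distrib]
        exact Finset.sum_congr rfl fun a _ => Matrix.det_updateCol_add _ _ _ _
      map_smul' := fun c A => by
        ext S' S
        simp only [Matrix.of_apply, Matrix.smul_apply, RingHom.id_apply, Finset.smul_sum]
        exact Finset.sum_congr rfl fun a _ => Matrix.det_updateCol_smul _ _ _ _ }
  act_map f A := by
    ext S' S
    simp only [MonoidHom.coe_mk, OneHom.coe_mk, minorMatrix, Matrix.map_apply, Matrix.of_apply,
      RingHom.map_det]
    rfl
  lin_map f A := by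
    ext S' S
    simp only [LinearMap.coe_mk, AddHom.coe_mk, Matrix.map_apply, Matrix.of_apply, map_sum,
      RingHom.map_det]
    refine Finset.sum_congr rfl fun a _ => congrArg _ ?_
    ext i j
    simp only [RingHom.mapMatrix_apply, Matrix.map_apply, Matrix.updateCol_apply,
      Matrix.submatrix_apply, Matrix.one_apply]
    split_ifs <;> simp
  act_one_add s hs A := by
    ext S' S
    simp only [MonoidHom.coe_mk, OneHom.coe_mk, LinearMap.coe_mk, AddHom.coe_mk]
    rw [← minorMatrix_one p]
    simp only [minorMatrix, Matrix.add_apply, Matrix.smul_apply, Matrix.of_apply, smul_eq_mul]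
    exact det_add_smul_of_sq_zero s hs
      ((1 : Matrix (Fin N) (Fin N) _).submatrix (S'.1.orderEmbOfFin S'.2) (S.1.orderEmbOfFin S.2))
      (A.submatrix (S'.1.orderEmbOfFin S'.2) (S.1.orderEmbOfFin S.2))

theorem trace_exterior {R : Type} [CommRing R] (A : Matrix (Fin N) (Fin N) R) :
    ((MatrixFunctor.exterior N p).act R A).trace =
      (1 + (Polynomial.X : Polynomial R) • A.map Polynomial.C).det.coeff p := by
  rw [Matrix.coeff_det_one_add_X_smul_eq_sum_minors]
  have h : ∀ S : {S : Finset (Fin N) // S.card = p},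
      ((MatrixFunctor.exterior N p).act R A) S S =
        (A.submatrix (Subtype.val : S.1 → Fin N) (Subtype.val : S.1 → Fin N)).det := by
    intro S
    change (A.submatrix (S.1.orderEmbOfFin S.2) (S.1.orderEmbOfFin S.2)).det = _
    rw [← Matrix.det_submatrix_equiv_self (S.1.orderIsoOfFin S.2).toEquiv, Matrix.submatrix_submatrix]
    rfl
  simp only [Matrix.trace, Matrix.diag, h]
  refine Finset.sum_bij (fun S _ => S.1) (fun S _ => ?_) (fun S _ T _ h => Subtype.ext h)
    (fun S hS => ?_) (fun S _ => rfl)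
  · simp [Finset.mem_powersetCard, S.2]
  · exact ⟨⟨S, (Finset.mem_powersetCard.1 hS).2⟩, Finset.mem_univ _, rfl⟩

end Exterior

/-! ### Symmetric powers -/

section Symmetric

open MvPolynomial

variable {N : ℕ} {R : Type*} [CommRing R]

/-- The algebra endomorphism of the polynomial ring induced by a matrix. -/
def substHom (A : Matrix (Fin N) (Fin N) R) : MvPolynomial (Fin N) R →ₐ[R] MvPolynomial (Fin N) R :=
  aeval fun j => ∑ i, C (A i j) * X i

theorem substHom_X (A : Matrix (Fin N) (Fin N) R) (j : Fin N) :
    substHom A (X j) = ∑ i, C (A i j) * X i := by rw [substHom, aeval_X]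

theorem substHom_mul (A B : Matrix (Fin N) (Fin N) R) :
    substHom (A * B) = (substHom A).comp (substHom B) := by
  refine algHom_ext fun j => ?_
  simp only [AlgHom.comp_apply, substHom_X, map_sum, map_mul, Matrix.mul_apply, Finset.sum_mul,
    Finset.mul_sum, algHom_C, MvPolynomial.algebraMap_eq]
  rw [Finset.sum_comm]
  exact Finset.sum_congr rfl fun i _ => Finset.sum_congr rfl fun l _ => by ring

theorem substHom_one : substHom (1 : Matrix (Fin N) (Fin N) R) = AlgHom.id R _ := by
  refine algHom_ext fun j => ?_
  rw [substHom_X, Finset.sum_eq_single j]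
  · simp
  · intro i _ hi; simp [Matrix.one_apply_ne hi]
  · simp

theorem isHomogeneous_substHom (A : Matrix (Fin N) (Fin N) R) (s : Fin N →₀ ℕ) :
    (substHom A (monomial s 1)).IsHomogeneous (Finsupp.degree s) := by
  rw [substHom, aeval_monomial, map_one, one_mul, Finsupp.prod, Finsupp.degree]
  refine IsHomogeneous.prod _ _ _ fun j _ => ?_
  have : (∑ i, C (A i j) * X i : MvPolynomial (Fin N) R).IsHomogeneous 1 :=
    IsHomogeneous.sum _ _ _ fun i _ => by simpa using (isHomogeneous_C _ (A i j)).mul (isHomogeneous_X R i)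
  simpa using this.pow (s j)

/-- The exponents of the monomial with the given variables. -/
def symExp {p : ℕ} (s : Sym (Fin N) p) : Fin N →₀ ℕ := (s : Multiset (Fin N)).toFinsupp

theorem symExp_injective {p : ℕ} : Function.Injective (symExp (N := N) (p := p)) := fun _ _ h =>
  Subtype.ext (Multiset.toFinsupp.injective h)

theorem degree_symExp {p : ℕ} (s : Sym (Fin N) p) : Finsupp.degree (symExp s) = p := by
  have := Multiset.toFinsupp_sum_eq (s : Multiset (Fin N))
  exact this.trans s.2

theorem exists_symExp {p : ℕ} (m : Fin N →₀ ℕ) (h : Finsupp.degree m = p) :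
    ∃ s : Sym (Fin N) p, symExp s = m := by
  refine ⟨⟨Finsupp.toMultiset m, ?_⟩, ?_⟩
  · rw [Finsupp.card_toMultiset]; exact h
  · exact Finsupp.toMultiset_toFinsupp m

theorem symExp_cons {p : ℕ} (i : Fin N) (s : Sym (Fin N) p) :
    symExp (i ::ₛ s) = Finsupp.single i 1 + symExp s := by
  rw [symExp, Sym.coe_cons, ← Multiset.singleton_add, Multiset.toFinsupp_add,
    Multiset.toFinsupp_singleton]
  rfl

theorem sum_monomial_symExp {p : ℕ} {f : MvPolynomial (Fin N) R} (hf : f.IsHomogeneous p) :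
    ∑ s : Sym (Fin N) p, monomial (symExp s) (coeff (symExp s) f) = f := by
  ext m
  simp only [coeff_sum, coeff_monomial]
  by_cases hm : Finsupp.degree m = p
  · obtain ⟨t, rfl⟩ := exists_symExp m hm
    rw [Finset.sum_eq_single t (fun s _ hs => if_neg fun h => hs (symExp_injective h))
      (fun h => absurd (Finset.mem_univ _) h), if_pos rfl]
  · rw [Finset.sum_eq_zero fun s _ => if_neg fun h => hm (by rw [← h, degree_symExp])]
    by_contra h
    exact hm (by rw [Finsupp.degree_eq_weight_one]; exact hf (Ne.symm h))

variable (p : ℕ)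

/-- The matrix of the action on the `p`-th symmetric power in the basis of monomials. -/
def symMatrix (A : Matrix (Fin N) (Fin N) R) : Matrix (Sym (Fin N) p) (Sym (Fin N) p) R :=
  Matrix.of fun s' s => coeff (symExp s') (substHom A (monomial (symExp s) 1))

theorem symMatrix_mul (A B : Matrix (Fin N) (Fin N) R) :
    symMatrix p (A * B) = symMatrix p A * symMatrix p B := by
  ext s' s
  have h0 := isHomogeneous_substHom B (symExp s)
  rw [degree_symExp] at h0
  have h := sum_monomial_symExp h0
  rw [symMatrix, Matrix.of_apply, substHom_mul, AlgHom.comp_apply, ← h, map_sum, coeff_sum,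
    Matrix.mul_apply]
  refine Finset.sum_congr rfl fun t _ => ?_
  rw [← mul_one (coeff (symExp t) _), ← smul_eq_mul, ← smul_monomial, map_smul, coeff_smul,
    smul_eq_mul, mul_comm]
  rfl

theorem symMatrix_one : symMatrix p (1 : Matrix (Fin N) (Fin N) R) = 1 := by
  ext s' s
  rw [symMatrix, Matrix.of_apply, substHom_one, AlgHom.id_apply, coeff_monomial, Matrix.one_apply]
  simp only [symExp_injective.eq_iff, eq_comm]

/-- To first order, a linear substitution of the variables is the identity plus the derivation that
sends each variable to its increment. On monomials this derivation gives the connection matrices of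
`symPower`. -/
theorem substHom_one_add (s : R) (hs : s * s = 0) (A : Matrix (Fin N) (Fin N) R)
    (f : MvPolynomial (Fin N) R) : substHom (1 + s • A) f =
      f + C s * mkDerivation R (fun j => ∑ i, C (A i j) * X i) f := by
  have hs' : (C s * C s : MvPolynomial (Fin N) R) = 0 := by rw [← C_mul, hs, C_0]
  induction f using MvPolynomial.induction_on with
  | C a => rw [algHom_C, MvPolynomial.algebraMap_eq, derivation_C, mul_zero, add_zero]
  | add f g hf hg => rw [map_add, hf, hg, map_add]; ring
  | mul_X f j hf =>
    have hX : substHom (1 + s • A) (X j) = X j + C s * ∑ i, C (A i j) * X i := by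
      rw [substHom_X, Finset.mul_sum]
      simp only [Matrix.add_apply, Matrix.smul_apply, C_add, add_mul, Finset.sum_add_distrib,
        smul_eq_mul, C_mul, mul_assoc]
      congr 1
      rw [← substHom_X, substHom_one, AlgHom.id_apply]
    rw [map_mul, hf, hX, Derivation.leibniz, mkDerivation_X, smul_eq_mul, smul_eq_mul]
    linear_combination (mkDerivation R (fun j => ∑ i, C (A i j) * X i) f *
      ∑ i, C (A i j) * X i) * hs'

theorem symExp_eq_iff (s' s : Sym (Fin N) p) (i j : Fin N) :
    (s' : Multiset (Fin N)) = i ::ₘ (s : Multiset (Fin N)).erase j ↔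
      symExp s - Finsupp.single j 1 + Finsupp.single i 1 = symExp s' := by
  rw [← Multiset.toFinsupp.injective.eq_iff, eq_comm]
  have : Multiset.toFinsupp (i ::ₘ (s : Multiset (Fin N)).erase j) =
      symExp s - Finsupp.single j 1 + Finsupp.single i 1 := by
    ext l
    rw [Multiset.toFinsupp_apply, Multiset.count_cons, Finsupp.add_apply, Finsupp.tsub_apply,
      Finsupp.single_apply, Finsupp.single_apply, symExp, Multiset.toFinsupp_apply]
    by_cases h : l = j
    · subst h; rw [Multiset.count_erase_self]; simp [eq_comm]
    · rw [Multiset.count_erase_of_ne h, if_neg (Ne.symm h)]; simp [eq_comm]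
  rw [this]
  rfl

theorem coeff_mkDerivation_monomial (A : Matrix (Fin N) (Fin N) R) (s' s : Sym (Fin N) p) :
    coeff (symExp s') (mkDerivation R (fun j => ∑ i, C (A i j) * X i) (monomial (symExp s) 1)) =
      ∑ j, ∑ i, if (s' : Multiset (Fin N)) = i ::ₘ (s : Multiset (Fin N)).erase j then
        ((s : Multiset (Fin N)).count j : R) * A i j else 0 := by
  rw [mkDerivation_monomial, one_smul, Finsupp.sum_fintype _ _ (by simp), coeff_sum]
  refine Finset.sum_congr rfl fun j _ => ?_
  rw [smul_eq_mul, Finset.mul_sum, coeff_sum]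
  refine Finset.sum_congr rfl fun i _ => ?_
  rw [mul_left_comm, coeff_C_mul, X, monomial_mul, coeff_monomial, mul_one, mul_comm]
  simp only [symExp_eq_iff, ite_mul, zero_mul]
  rfl

end Symmetric

/-- The symmetric power as a functor of matrices. -/
def MatrixFunctor.symmetric (N p : ℕ) : MatrixFunctor (Fin N) (Sym (Fin N) p) where
  act R _ :=
    { toFun := symMatrix p
      map_one' := symMatrix_one p
      map_mul' := symMatrix_mul p }
  lin R _ :=
    { toFun := fun A => Matrix.of fun s' s => ∑ j, ∑ i,
        if (s' : Multiset (Fin N)) = i ::ₘ (s : Multiset (Fin N)).erase j then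
          ((s : Multiset (Fin N)).count j : R) * A i j else 0
      map_add' := fun A B => by
        ext s' s
        simp only [Matrix.of_apply, Matrix.add_apply, ← Finset.sum_add_distrib]
        refine Finset.sum_congr rfl fun j _ => Finset.sum_congr rfl fun i _ => ?_
        split_ifs
        · rw [mul_add]
        · rw [add_zero]
      map_smul' := fun c A => by
        ext s' s
        simp only [Matrix.of_apply, Matrix.smul_apply, RingHom.id_apply, Finset.smul_sum]
        refine Finset.sum_congr rfl fun j _ => Finset.sum_congr rfl fun i _ => ?_
        split_ifs
        · rw [smul_eq_mul, smul_eq_mul, mul_left_comm]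
        · rw [smul_zero] }
  act_map {R S} _ _ f A := by
    ext s' s
    have h : (MvPolynomial.map f).comp (substHom A).toRingHom =
        (substHom (A.map f)).toRingHom.comp (MvPolynomial.map f) := by
      refine MvPolynomial.ringHom_ext (fun r => ?_) (fun j => ?_)
      · simp
      · simp [substHom_X]
    have h2 := congrArg (MvPolynomial.coeff (symExp s'))
      (RingHom.congr_fun h (MvPolynomial.monomial (symExp s) 1))
    simp only [AlgHom.toRingHom_eq_coe, RingHom.coe_comp, RingHom.coe_coe, Function.comp_apply,
      MvPolynomial.map_monomial, map_one, MvPolynomial.coeff_map] at h2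
    exact h2
  lin_map f A := by
    ext s' s
    simp only [LinearMap.coe_mk, AddHom.coe_mk, Matrix.map_apply, Matrix.of_apply, map_sum]
    refine Finset.sum_congr rfl fun j _ => Finset.sum_congr rfl fun i _ => ?_
    split_ifs <;> simp
  act_one_add s hs A := by
    ext s' s₀
    simp only [MonoidHom.coe_mk, OneHom.coe_mk, LinearMap.coe_mk, AddHom.coe_mk]
    rw [← symMatrix_one p]
    simp only [symMatrix, Matrix.add_apply, Matrix.smul_apply, Matrix.of_apply, smul_eq_mul]
    rw [substHom_one_add s hs, MvPolynomial.coeff_add, MvPolynomial.coeff_C_mul,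
      coeff_mkDerivation_monomial, substHom_one, AlgHom.id_apply]

/-! ### Newton's identities for traces on symmetric powers -/

section TraceSymmetric

open MvPolynomial

variable {N : ℕ} {R : Type*} [CommRing R]

/-- The trace of a linear endomorphism of the polynomial ring on the polynomials of degree `p`. -/
def degreeTrace (p : ℕ) (T : MvPolynomial (Fin N) R →ₗ[R] MvPolynomial (Fin N) R) : R :=
  ∑ s : Sym (Fin N) p, coeff (symExp s) (T (monomial (symExp s) 1))

theorem degreeTrace_add (p : ℕ) (T U : MvPolynomial (Fin N) R →ₗ[R] MvPolynomial (Fin N) R) :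
    degreeTrace p (T + U) = degreeTrace p T + degreeTrace p U := by
  simp [degreeTrace, Finset.sum_add_distrib]

theorem degreeTrace_smul (p : ℕ) (c : R) (T : MvPolynomial (Fin N) R →ₗ[R] MvPolynomial (Fin N) R) :
    degreeTrace p (c • T) = c * degreeTrace p T := by
  simp [degreeTrace, Finset.mul_sum]

theorem degreeTrace_sum {α : Type*} (p : ℕ) (t : Finset α)
    (T : α → MvPolynomial (Fin N) R →ₗ[R] MvPolynomial (Fin N) R) :
    degreeTrace p (∑ a ∈ t, T a) = ∑ a ∈ t, degreeTrace p (T a) := by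
  simp only [degreeTrace, LinearMap.sum_apply, coeff_sum]
  exact Finset.sum_comm

/-- Cyclicity of the trace across degrees p and p + 1: the diagonal entries on the left vanish
except at monomials divisible by X_i, and these are X_i times the monomials of degree p. -/
theorem degreeTrace_X_mul (p : ℕ) (i : Fin N)
    (V : MvPolynomial (Fin N) R →ₗ[R] MvPolynomial (Fin N) R) :
    degreeTrace (p + 1) (LinearMap.mulLeft R (X i) ∘ₗ V) =
      degreeTrace p (V ∘ₗ LinearMap.mulLeft R (X i)) := by
  symm
  refine Fintype.sum_of_injective (fun t : Sym (Fin N) p => i ::ₛ t) (fun s t h => ?_) _ _ ?_ ?_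
  · exact Sym.cons_inj_right i s t |>.1 h
  · intro s hs
    rw [LinearMap.comp_apply, LinearMap.mulLeft_apply, coeff_X_mul', if_neg]
    intro hi
    refine hs ⟨s.erase i (by simpa [symExp] using hi), Sym.cons_erase _⟩
  · intro t
    rw [LinearMap.comp_apply, LinearMap.comp_apply, LinearMap.mulLeft_apply,
      LinearMap.mulLeft_apply, symExp_cons, coeff_X_mul, X, monomial_mul, one_mul]

variable (B : Matrix (Fin N) (Fin N) R)

/-- The trace on degree `p` of the action of `B` composed with the derivation given by `A`. -/
def derivTrace (p : ℕ) (A : Matrix (Fin N) (Fin N) R) : R :=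
  ∑ i, ∑ j, A i j * degreeTrace p ((substHom B).toLinearMap ∘ₗ LinearMap.mulLeft R (X i) ∘ₗ
    (MvPolynomial.pderiv (R := R) j).toLinearMap)

/-- The action of B turns X_i into ∑ B_{li} X_l; cyclicity moves X_l to the right of ∂_j, and ∂_j
X_l = δ_{lj} + X_l ∂_j produces the two terms. -/
theorem derivTrace_succ (p : ℕ) (A : Matrix (Fin N) (Fin N) R) :
    derivTrace B (p + 1) A =
      (B * A).trace * degreeTrace p (substHom B).toLinearMap + derivTrace B p (B * A) := by
  have h1 : ∀ i j, degreeTrace (p + 1) ((substHom B).toLinearMap ∘ₗ LinearMap.mulLeft R (X i) ∘ₗ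
      (MvPolynomial.pderiv (R := R) j).toLinearMap) =
      ∑ l, B l i * ((if l = j then degreeTrace p (substHom B).toLinearMap else 0) +
        degreeTrace p ((substHom B).toLinearMap ∘ₗ LinearMap.mulLeft R (X l) ∘ₗ
      (MvPolynomial.pderiv (R := R) j).toLinearMap)) := by
    intro i j
    have e1 : (substHom B).toLinearMap ∘ₗ LinearMap.mulLeft R (X i) ∘ₗ
        (MvPolynomial.pderiv (R := R) j).toLinearMap =
        ∑ l, B l i • (LinearMap.mulLeft R (X l) ∘ₗ ((substHom B).toLinearMap ∘ₗ
        (MvPolynomial.pderiv (R := R) j).toLinearMap)) := by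
      refine LinearMap.ext fun f => ?_
      simp only [LinearMap.comp_apply, LinearMap.mulLeft_apply, LinearMap.sum_apply,
        LinearMap.smul_apply, AlgHom.toLinearMap_apply, map_mul, substHom_X, Finset.sum_mul,
        smul_eq_C_mul, mul_assoc]
    rw [e1, degreeTrace_sum]
    refine Finset.sum_congr rfl fun l _ => ?_
    rw [degreeTrace_smul, degreeTrace_X_mul]
    congr 1
    have e2 : ((substHom B).toLinearMap ∘ₗ
        (MvPolynomial.pderiv (R := R) j).toLinearMap) ∘ₗ
          LinearMap.mulLeft R (X l) = (if l = j then (1 : R) else 0) • (substHom B).toLinearMap +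
        (substHom B).toLinearMap ∘ₗ LinearMap.mulLeft R (X l) ∘ₗ
        (MvPolynomial.pderiv (R := R) j).toLinearMap := by
      refine LinearMap.ext fun f => ?_
      simp only [LinearMap.comp_apply, LinearMap.mulLeft_apply, LinearMap.add_apply,
        LinearMap.smul_apply, AlgHom.toLinearMap_apply, Derivation.coeFn_coe, Derivation.leibniz,
        MvPolynomial.pderiv_X, smul_eq_mul, map_add, map_mul, Pi.single_apply]
      split_ifs <;> simp [add_comm]
    rw [e2, degreeTrace_add, degreeTrace_smul]
    split_ifs <;> simp
  simp only [derivTrace, h1, mul_add, Finset.mul_sum, Finset.sum_add_distrib, Matrix.trace,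
    Matrix.diag, Matrix.mul_apply, Finset.sum_mul, mul_ite, mul_zero]
  congr 1
  · rw [Finset.sum_comm]
    exact Finset.sum_congr rfl fun i _ => Finset.sum_congr rfl fun j _ => by
      rw [Finset.sum_ite_eq', if_pos (Finset.mem_univ _)]; ring
  · rw [Finset.sum_comm]
    conv_rhs => rw [Finset.sum_comm]
    refine Finset.sum_congr rfl fun j _ => ?_
    rw [Finset.sum_comm]
    exact Finset.sum_congr rfl fun i _ => Finset.sum_congr rfl fun l _ => by ring

theorem derivTrace_zero (A : Matrix (Fin N) (Fin N) R) : derivTrace B 0 A = 0 := by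
  refine Finset.sum_eq_zero fun i _ => Finset.sum_eq_zero fun j _ => ?_
  have : ∀ s : Sym (Fin N) 0, symExp s = 0 := fun s => by
    rw [← Finsupp.degree_eq_zero_iff, degree_symExp]
  simp [degreeTrace, this, ← C_apply]

theorem derivTrace_eq (p : ℕ) (A : Matrix (Fin N) (Fin N) R) :
    derivTrace B p A = ∑ r ∈ Finset.range p,
      (B ^ (r + 1) * A).trace * degreeTrace (p - 1 - r) (substHom B).toLinearMap := by
  induction p generalizing A with
  | zero => simp [derivTrace_zero]
  | succ p ih =>
    rw [derivTrace_succ, ih, Finset.sum_range_succ', add_comm]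
    congr 1
    · refine Finset.sum_congr rfl fun r hr => ?_
      rw [← mul_assoc, ← pow_succ]
      congr 2
      have := Finset.mem_range.1 hr
      omega
    · simp

/-- Euler's identity: ∑ X_i ∂_i is multiplication by p on polynomials of degree p. Together with
`derivTrace_eq` this is Newton's identity for the traces. -/
theorem derivTrace_one (p : ℕ) :
    derivTrace B p 1 = p * degreeTrace p (substHom B).toLinearMap := by
  have h : derivTrace B p 1 = ∑ i, degreeTrace p ((substHom B).toLinearMap ∘ₗ
      LinearMap.mulLeft R (X i) ∘ₗ
      (MvPolynomial.pderiv (R := R) i).toLinearMap) := by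
    refine Finset.sum_congr rfl fun i _ => ?_
    rw [Finset.sum_eq_single i]
    · simp
    · intro j _ hj; rw [Matrix.one_apply_ne hj.symm, zero_mul]
    · simp
  rw [h, ← degreeTrace_sum, degreeTrace, degreeTrace, Finset.mul_sum]
  refine Finset.sum_congr rfl fun s _ => ?_
  have e := (isHomogeneous_monomial (σ := Fin N) (R := R) (1 : R) (degree_symExp s)).sum_X_mul_pderiv
  simp only [LinearMap.sum_apply, LinearMap.comp_apply, LinearMap.mulLeft_apply,
    Derivation.coeFn_coe]
  rw [← map_sum, e, map_nsmul, coeff_smul, nsmul_eq_mul]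

end TraceSymmetric

/-! ### Traces on exterior and symmetric powers -/

section TraceSeries

open PowerSeries

/-- A power series at a translate of the variable by a number of square zero. -/
def taylorDualSeries (R : Type*) [CommRing R] : PowerSeries R →+* DualNumber (PowerSeries R) where
  toFun p := TrivSqZeroExt.inl p + TrivSqZeroExt.inr (derivative R p)
  map_one' := by simp
  map_zero' := by simp
  map_add' p q := by
    rw [TrivSqZeroExt.inl_add, map_add, TrivSqZeroExt.inr_add]; abel
  map_mul' p q := by
    refine TrivSqZeroExt.ext ?_ ?_
    · simp
    · simp [Derivation.leibniz]; ring

theorem taylorDualSeries_apply {R : Type*} [CommRing R] (p : PowerSeries R) :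
    taylorDualSeries R p = TrivSqZeroExt.inl p + TrivSqZeroExt.inr (derivative R p) := rfl

variable {R : Type*} [CommRing R] {ι : Type*} [Fintype ι] [DecidableEq ι]

/-- The matrix `∑ Bʳ⁺¹ zʳ`. -/
def resolventSeries (B : Matrix ι ι R) : Matrix ι ι (PowerSeries R) :=
  Matrix.of fun i j => PowerSeries.mk fun r => (B ^ (r + 1)) i j

theorem one_sub_mul_resolventSeries (B : Matrix ι ι R) :
    (1 - (X : PowerSeries R) • B.map C) * resolventSeries B = B.map C := by
  rw [sub_mul, one_mul, smul_mul_assoc]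
  ext i j n
  rw [Matrix.sub_apply, Matrix.smul_apply, smul_eq_mul, map_sub, Matrix.map_apply, coeff_C]
  rcases n with _ | n
  · simp [resolventSeries]
  · rw [coeff_succ_X_mul, Matrix.mul_apply, map_sum]
    simp only [resolventSeries, Matrix.of_apply, Matrix.map_apply, coeff_C_mul, coeff_mk]
    rw [← Matrix.mul_apply, ← pow_succ', sub_self, if_neg n.succ_ne_zero]

/-- Jacobi's formula for `det (1 - z B)`. -/
theorem derivative_det_one_sub (B : Matrix ι ι R) :
    derivative R (1 - (X : PowerSeries R) • B.map C).det =
      -((1 - (X : PowerSeries R) • B.map C).det * (resolventSeries B).trace) := by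
  let inl : PowerSeries R →+* DualNumber (PowerSeries R) := TrivSqZeroExt.inlHom _ _
  let ε : DualNumber (PowerSeries R) := DualNumber.eps
  have hε : ε * ε = 0 := DualNumber.eps_mul_eps
  set M := 1 - (X : PowerSeries R) • B.map C with hM
  -- The shift z ↦ z + ε changes M = 1 - zB by -εB, and B = M · `resolventSeries B`. Taking
  -- determinants turns the factor into 1 - ε times a trace.
  have h1 : M.map (taylorDualSeries R) = M.map inl * (1 + ε • -(resolventSeries B).map inl) := by
    have h2 : M.map (taylorDualSeries R) = M.map inl - ε • (B.map C).map inl := by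
      ext1 i j
      have hd : derivative R (M i j) = - C (B i j) := by
        rw [hM, Matrix.sub_apply, Matrix.smul_apply, Matrix.map_apply, map_sub, smul_eq_mul,
          Derivation.leibniz, derivative_C, derivative_X, smul_zero, zero_add, smul_eq_mul, mul_one,
          Matrix.one_apply]
        split_ifs <;> simp
      rw [Matrix.map_apply, taylorDualSeries_apply, hd, Matrix.sub_apply, Matrix.smul_apply,
        Matrix.map_apply, Matrix.map_apply, Matrix.map_apply]
      refine TrivSqZeroExt.ext ?_ ?_ <;> simp [inl, ε]
    have h3 := congrArg inl.mapMatrix (one_sub_mul_resolventSeries B)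
    rw [map_mul] at h3
    simp only [RingHom.mapMatrix_apply] at h3
    rw [h2, mul_add, mul_one, mul_smul_comm, mul_neg, h3, smul_neg, sub_eq_add_neg]
  have h4 := congrArg Matrix.det h1
  rw [Matrix.det_mul, Matrix.det_one_add_smul, sq, hε, mul_zero, add_zero] at h4
  have h5 : (M.map (taylorDualSeries R)).det = taylorDualSeries R M.det :=
    ((taylorDualSeries R).map_det M).symm
  have h6 : (M.map inl).det = inl M.det := (inl.map_det M).symm
  have h7 : (-(resolventSeries B).map inl).trace = -inl (resolventSeries B).trace := by
    rw [Matrix.trace_neg, Matrix.trace, Matrix.trace, map_sum]; rfl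
  rw [h5, h6, h7, taylorDualSeries_apply] at h4
  have h8 := congrArg TrivSqZeroExt.snd h4
  simpa [inl, ε] using h8

/-- The generating function of the traces of the symmetric powers is inverse to the
characteristic polynomial. -/
theorem degreeTraceSeries_mul_det [IsAddTorsionFree R] {N : ℕ} (B : Matrix (Fin N) (Fin N) R) :
    (PowerSeries.mk fun p => degreeTrace p (substHom B).toLinearMap) *
      (1 - (X : PowerSeries R) • B.map C).det = 1 := by
  set H : PowerSeries R := PowerSeries.mk fun p => degreeTrace p (substHom B).toLinearMap with hH
  -- Newton's identities in generating form. The logarithmic derivatives of H and of the determinant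
  -- are opposite, so their product has derivative zero.
  have hder : derivative R H = H * (resolventSeries B).trace := by
    ext n
    have h := derivTrace_one B (n + 1)
    rw [derivTrace_eq] at h
    rw [coeff_derivative, hH, coeff_mk, mul_comm H, coeff_mul,
      Finset.Nat.sum_antidiagonal_eq_sum_range_succ
        (fun i j => coeff i (resolventSeries B).trace * coeff j H), mul_comm]
    push_cast at h
    rw [← h]
    refine Finset.sum_congr rfl fun r _ => ?_
    rw [mul_one, hH, coeff_mk, Matrix.trace, Matrix.trace, map_sum]
    simp only [Matrix.diag, resolventSeries, Matrix.of_apply, coeff_mk]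
  refine derivative.ext ?_ ?_
  · rw [Derivation.leibniz, derivative_det_one_sub, hder, derivative_one]
    simp only [smul_eq_mul]; ring
  · rw [map_mul, RingHom.map_det, RingHom.mapMatrix_apply]
    have h1 : (1 - (X : PowerSeries R) • B.map C).map (constantCoeff (R := R)) = 1 := by
      ext i j
      rw [Matrix.map_apply, Matrix.sub_apply, Matrix.one_apply, Matrix.one_apply]
      split_ifs <;> simp
    have h2 : ∀ s : Sym (Fin N) 0, symExp s = 0 := fun s => by
      rw [← Finsupp.degree_eq_zero_iff, degree_symExp]
    rw [h1, Matrix.det_one, mul_one, map_one, ← coeff_zero_eq_constantCoeff_apply, hH, coeff_mk,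
      degreeTrace]
    simp [h2, ← MvPolynomial.C_apply]

theorem traceSeries_symmetric {R : Type} [CommRing R] [IsAddTorsionFree R] {N : ℕ}
    (B : Matrix (Fin N) (Fin N) R) :
    (PowerSeries.mk fun p => ((MatrixFunctor.symmetric N p).act R B).trace) *
      (1 - (X : PowerSeries R) • B.map C).det = 1 :=
  degreeTraceSeries_mul_det B

theorem traceSeries_exterior {R : Type} [CommRing R] {N : ℕ} (B : Matrix (Fin N) (Fin N) R) :
    (PowerSeries.mk fun p => ((MatrixFunctor.exterior N p).act R B).trace) =
      (1 + (X : PowerSeries R) • B.map C).det := by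
  have h : (1 + (X : PowerSeries R) • B.map C).det = Polynomial.coeToPowerSeries.ringHom
      (1 + (Polynomial.X : Polynomial R) • B.map Polynomial.C).det := by
    rw [RingHom.map_det, RingHom.mapMatrix_apply]
    congr 1
    ext1 i j
    simp only [Matrix.map_apply, Matrix.add_apply, Matrix.smul_apply,
      smul_eq_mul, map_add, map_mul, Polynomial.coeToPowerSeries.ringHom_apply, Polynomial.coe_X,
      Polynomial.coe_C, Matrix.one_apply]
    split_ifs <;> simp
  ext p
  rw [coeff_mk, trace_exterior, h, Polynomial.coeToPowerSeries.ringHom_apply, Polynomial.coeff_coe]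

end TraceSeries

/-! ### The curvature of the Levi-Civita connection -/

section TheCurvatureOfTheLeviCivitaConnection

variable {n : ℕ} {M : Type*} [TopologicalSpace M] [ChartedSpace (EuclideanSpace ℝ (Fin n)) M]
  [IsManifold (𝓡 n) ∞ M]
variable (g : RiemannianMetricOn n M) (e : OpenPartialHomeomorph M (EuclideanSpace ℝ (Fin n)))

theorem contMDiffOn_coordVector (he : e ∈ IsManifold.maximalAtlas (𝓡 n) ∞ M) (i : Fin n) :
    ContMDiffOn (𝓡 n) ((𝓡 n).prod 𝓘(ℝ, EuclideanSpace ℝ (Fin n))) ∞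
      (fun y => (⟨e.symm y, coordVector e i y⟩ : TangentBundle (𝓡 n) M)) e.target := by
  have h1 := (contMDiffOn_symm_of_mem_maximalAtlas he).contMDiffOn_tangentMapWithin
    (m := ∞) (by simp) e.open_target.uniqueMDiffOn
  have h2 : ContMDiff (𝓡 n) ((𝓡 n).prod 𝓘(ℝ, EuclideanSpace ℝ (Fin n))) ∞
      (fun y : EuclideanSpace ℝ (Fin n) => (⟨y, EuclideanSpace.single i (1 : ℝ)⟩ :
        TangentBundle (𝓡 n) (EuclideanSpace ℝ (Fin n)))) := by
    intro y
    exact contMDiffAt_vectorSpace_iff_contDiffAt.2 contDiffAt_const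
  refine (h1.comp h2.contMDiffOn fun y hy => hy).congr fun y hy => ?_
  rw [Function.comp_apply, tangentMapWithin]
  rw [mfderivWithin_of_isOpen e.open_target hy]
  rfl

theorem contDiffOn_metricMatrix (he : e ∈ IsManifold.maximalAtlas (𝓡 n) ∞ M) (i j : Fin n) :
    ContDiffOn ℝ ∞ (fun y => metricMatrix g e y i j) e.target := by
  intro y hy
  have hv := contMDiffOn_coordVector e he i y hy
  have hw := contMDiffOn_coordVector e he j y hy
  have hb : ContMDiffWithinAt (𝓡 n) (𝓡 n) ∞ e.symm e.target y :=
    contMDiffOn_symm_of_mem_maximalAtlas he y hy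
  have h : ContMDiffWithinAt (𝓡 n) ((𝓡 n).prod 𝓘(ℝ, ℝ)) ∞ (fun m => Bundle.TotalSpace.mk' ℝ
      (E := Bundle.Trivial M ℝ) (e.symm m)
      (g.inner (e.symm m) (coordVector e i m) (coordVector e j m))) e.target y := by
    apply ContMDiffWithinAt.clm_bundle_apply₂ (F₁ := EuclideanSpace ℝ (Fin n))
      (F₂ := EuclideanSpace ℝ (Fin n))
    · exact ContMDiffAt.comp_contMDiffWithinAt y g.contMDiff.contMDiffAt hb
    · exact hv
    · exact hw
  simp only [Bundle.contMDiffWithinAt_totalSpace] at h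
  exact contMDiffWithinAt_iff_contDiffWithinAt.1 h.2

theorem mdifferentiable_of_mem_maximalAtlas (he : e ∈ IsManifold.maximalAtlas (𝓡 n) ∞ M) :
    e.MDifferentiable (𝓡 n) (𝓡 n) :=
  ⟨(contMDiffOn_of_mem_maximalAtlas he).mdifferentiableOn (by simp),
    (contMDiffOn_symm_of_mem_maximalAtlas he).mdifferentiableOn (by simp)⟩

theorem metricMatrix_transpose (y : EuclideanSpace ℝ (Fin n)) :
    (metricMatrix g e y).transpose = metricMatrix g e y := by
  ext i j
  exact g.symm _ _ _

/-- A null vector of the Gram matrix would give a tangent vector of length zero, which is nonzero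
because the differential of the inverse chart is injective. -/
theorem det_metricMatrix_ne_zero (he : e ∈ IsManifold.maximalAtlas (𝓡 n) ∞ M)
    {y : EuclideanSpace ℝ (Fin n)} (hy : y ∈ e.target) : (metricMatrix g e y).det ≠ 0 := by
  intro hdet
  obtain ⟨v, hv, hMv⟩ := Matrix.exists_mulVec_eq_zero_iff.2 hdet
  let w : TangentSpace (𝓡 n) (e.symm y) := ∑ i, v i • coordVector e i y
  have hw : w = mfderiv (𝓡 n) (𝓡 n) e.symm y
      (∑ i, v i • (EuclideanSpace.single i (1 : ℝ) : EuclideanSpace ℝ (Fin n)) :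
        EuclideanSpace ℝ (Fin n)) := by
    simp only [w, coordVector]
    erw [map_sum]
    refine Finset.sum_congr rfl fun i _ => ?_
    erw [map_smul]
  have hw0 : w ≠ 0 := by
    rw [hw]
    intro h0
    have hinj := (mdifferentiable_of_mem_maximalAtlas e he).symm.mfderiv_injective hy
    have h1 : (∑ i, v i • (EuclideanSpace.single i (1 : ℝ) : EuclideanSpace ℝ (Fin n)) :
        EuclideanSpace ℝ (Fin n)) = 0 := hinj (h0.trans (map_zero _).symm)
    refine hv (funext fun i => ?_)
    have := congrArg (fun u : EuclideanSpace ℝ (Fin n) => u i) h1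
    simpa [Finset.sum_apply, Pi.single_apply] using this
  refine (g.pos (e.symm y) w hw0).ne' ?_
  have h2 : g.inner (e.symm y) w w = ∑ i, v i * (metricMatrix g e y).mulVec v i := by
    simp only [w, map_sum, map_smul, _root_.sum_apply, _root_.smul_apply,
      smul_eq_mul, Matrix.mulVec, dotProduct, metricMatrix, Matrix.of_apply, Finset.mul_sum]
    rw [Finset.sum_comm]
    refine Finset.sum_congr rfl fun i _ => Finset.sum_congr rfl fun j _ => ?_
    ring
  rw [h2, hMv]
  simp

theorem contDiffAt_pderiv {f : EuclideanSpace ℝ (Fin n) → ℝ} {y : EuclideanSpace ℝ (Fin n)}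
    (hf : ContDiffAt ℝ ∞ f y) (k : Fin n) : ContDiffAt ℝ ∞ (fun z => pderiv k f z) y :=
  (hf.fderiv_right (m := ∞) (by simp)).clm_apply contDiffAt_const

theorem contDiffAt_det {ι : Type*} [Fintype ι] [DecidableEq ι]
    {A : EuclideanSpace ℝ (Fin n) → Matrix ι ι ℝ} {y : EuclideanSpace ℝ (Fin n)}
    (hA : ∀ i j, ContDiffAt ℝ ∞ (fun z => A z i j) y) : ContDiffAt ℝ ∞ (fun z => (A z).det) y := by
  simp only [Matrix.det_apply']
  exact ContDiffAt.sum fun σ _ => contDiffAt_const.mul (contDiffAt_prod fun i _ => hA _ _)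

theorem contDiffAt_inv {ι : Type*} [Fintype ι] [DecidableEq ι]
    {A : EuclideanSpace ℝ (Fin n) → Matrix ι ι ℝ} {y : EuclideanSpace ℝ (Fin n)}
    (hA : ∀ i j, ContDiffAt ℝ ∞ (fun z => A z i j) y) (hdet : (A y).det ≠ 0) (i j : ι) :
    ContDiffAt ℝ ∞ (fun z => (A z)⁻¹ i j) y := by
  simp only [Matrix.inv_def, Matrix.smul_apply, Ring.inverse_eq_inv', smul_eq_mul,
    Matrix.adjugate_apply]
  refine ((contDiffAt_det hA).inv hdet).mul (contDiffAt_det fun a b => ?_)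
  simp only [Matrix.updateRow_apply]
  split_ifs
  · exact contDiffAt_const
  · exact hA _ _

theorem contDiffAt_metricMatrix (he : e ∈ IsManifold.maximalAtlas (𝓡 n) ∞ M)
    {y : EuclideanSpace ℝ (Fin n)} (hy : y ∈ e.target) (i j : Fin n) :
    ContDiffAt ℝ ∞ (fun y => metricMatrix g e y i j) y :=
  (contDiffOn_metricMatrix g e he i j).contDiffAt (e.open_target.mem_nhds hy)

theorem contDiffAt_christoffel (he : e ∈ IsManifold.maximalAtlas (𝓡 n) ∞ M)
    {y : EuclideanSpace ℝ (Fin n)} (hy : y ∈ e.target) (i k j : Fin n) :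
    ContDiffAt ℝ ∞ (fun y => christoffel g e y i k j) y := by
  have h := fun i j => contDiffAt_metricMatrix g e he hy i j
  refine contDiffAt_const.mul (ContDiffAt.sum fun m _ => ?_)
  refine (contDiffAt_inv h (det_metricMatrix_ne_zero g e he hy) i m).mul ?_
  exact ((contDiffAt_pderiv (h j m) k).add (contDiffAt_pderiv (h k m) j)).sub
    (contDiffAt_pderiv (h k j) m)

/-- The matrices of the Levi-Civita connection. -/
def christoffelMatrix (y : EuclideanSpace ℝ (Fin n)) (k : Fin n) : Matrix (Fin n) (Fin n) ℝ :=
  Matrix.of fun i j => christoffel g e y i k j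

theorem metricMatrix_mul_christoffelMatrix (he : e ∈ IsManifold.maximalAtlas (𝓡 n) ∞ M)
    {y : EuclideanSpace ℝ (Fin n)} (hy : y ∈ e.target) (k i j : Fin n) :
    (metricMatrix g e y * christoffelMatrix g e y k) i j = (1 / 2) *
      (pderiv k (fun z => metricMatrix g e z j i) y + pderiv j (fun z => metricMatrix g e z k i) y -
        pderiv i (fun z => metricMatrix g e z k j) y) := by
  have hdet := (det_metricMatrix_ne_zero g e he hy).isUnit
  set c : Fin n → ℝ := fun m => pderiv k (fun z => metricMatrix g e z j m) y +
    pderiv j (fun z => metricMatrix g e z k m) y - pderiv m (fun z => metricMatrix g e z k j) y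
  have h : ∀ l, christoffelMatrix g e y k l j = (1 / 2) * ((metricMatrix g e y)⁻¹.mulVec c) l :=
    fun l => rfl
  rw [Matrix.mul_apply]
  simp only [h]
  have h2 : ∑ l, metricMatrix g e y i l * (1 / 2 * ((metricMatrix g e y)⁻¹.mulVec c) l) =
      1 / 2 * (metricMatrix g e y).mulVec ((metricMatrix g e y)⁻¹.mulVec c) i := by
    rw [Matrix.mulVec, dotProduct, Finset.mul_sum]
    exact Finset.sum_congr rfl fun l _ => by ring
  rw [h2, Matrix.mulVec_mulVec, Matrix.mul_nonsing_inv _ hdet, Matrix.one_mulVec]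

/-- The Levi-Civita connection is compatible with the metric. -/
theorem pderiv_metricMatrix (he : e ∈ IsManifold.maximalAtlas (𝓡 n) ∞ M)
    {y : EuclideanSpace ℝ (Fin n)} (hy : y ∈ e.target) (k i j : Fin n) :
    pderiv k (fun z => metricMatrix g e z i j) y =
      ((christoffelMatrix g e y k).transpose * metricMatrix g e y +
        metricMatrix g e y * christoffelMatrix g e y k) i j := by
  have h1 : (christoffelMatrix g e y k).transpose * metricMatrix g e y =
      (metricMatrix g e y * christoffelMatrix g e y k).transpose := by
    rw [Matrix.transpose_mul, metricMatrix_transpose]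
  have hs : ∀ a b, (fun z => metricMatrix g e z a b) = fun z => metricMatrix g e z b a :=
    fun a b => funext fun z => g.symm _ _ _
  rw [h1, Matrix.add_apply, Matrix.transpose_apply, metricMatrix_mul_christoffelMatrix g e he hy,
    metricMatrix_mul_christoffelMatrix g e he hy, hs j i]
  ring

section Pderiv

variable {y : EuclideanSpace ℝ (Fin n)}

theorem pderiv_add {f h : EuclideanSpace ℝ (Fin n) → ℝ} (hf : DifferentiableAt ℝ f y)
    (hh : DifferentiableAt ℝ h y) (k : Fin n) :
    pderiv k (fun z => f z + h z) y = pderiv k f y + pderiv k h y := by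
  rw [pderiv, fderiv_fun_add hf hh]; rfl

theorem pderiv_mul {f h : EuclideanSpace ℝ (Fin n) → ℝ} (hf : DifferentiableAt ℝ f y)
    (hh : DifferentiableAt ℝ h y) (k : Fin n) :
    pderiv k (fun z => f z * h z) y = pderiv k f y * h y + f y * pderiv k h y := by
  rw [pderiv, fderiv_fun_mul hf hh]
  simp [pderiv]; ring

theorem pderiv_sum {ι : Type*} (s : Finset ι) {f : ι → EuclideanSpace ℝ (Fin n) → ℝ}
    (hf : ∀ i ∈ s, DifferentiableAt ℝ (f i) y) (k : Fin n) :
    pderiv k (fun z => ∑ i ∈ s, f i z) y = ∑ i ∈ s, pderiv k (f i) y := by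
  rw [pderiv, fderiv_fun_sum hf, _root_.sum_apply]; rfl

/-- The entrywise partial derivative of a matrix. -/
def matrixPderiv {ι : Type*} (k : Fin n) (A : EuclideanSpace ℝ (Fin n) → Matrix ι ι ℝ)
    (y : EuclideanSpace ℝ (Fin n)) : Matrix ι ι ℝ :=
  Matrix.of fun i j => pderiv k (fun z => A z i j) y

variable {ι : Type*} [Fintype ι] {A B : EuclideanSpace ℝ (Fin n) → Matrix ι ι ℝ}

theorem matrixPderiv_mul (hA : ∀ i j, DifferentiableAt ℝ (fun z => A z i j) y)
    (hB : ∀ i j, DifferentiableAt ℝ (fun z => B z i j) y) (k : Fin n) :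
    matrixPderiv k (fun z => A z * B z) y = matrixPderiv k A y * B y + A y * matrixPderiv k B y := by
  ext i j
  simp only [matrixPderiv, Matrix.of_apply, Matrix.mul_apply, Matrix.add_apply]
  rw [pderiv_sum Finset.univ (f := fun l z => A z i l * B z l j)
    fun l _ => (hA i l).fun_mul (hB l j), ← Finset.sum_add_distrib]
  exact Finset.sum_congr rfl fun l _ => pderiv_mul (hA i l) (hB l j) k

theorem matrixPderiv_add (hA : ∀ i j, DifferentiableAt ℝ (fun z => A z i j) y)
    (hB : ∀ i j, DifferentiableAt ℝ (fun z => B z i j) y) (k : Fin n) :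
    matrixPderiv k (fun z => A z + B z) y = matrixPderiv k A y + matrixPderiv k B y := by
  ext i j
  exact pderiv_add (hA i j) (hB i j) k

theorem pderiv_comm {f : EuclideanSpace ℝ (Fin n) → ℝ} (hf : ContDiffAt ℝ ∞ f y) (k l : Fin n) :
    pderiv k (fun z => pderiv l f z) y = pderiv l (fun z => pderiv k f z) y := by
  have hs : IsSymmSndFDerivAt ℝ f y := hf.isSymmSndFDerivAt (by
    rw [minSmoothness_of_isRCLikeNormedField]
    exact ENat.LEInfty.out)
  have hd : DifferentiableAt ℝ (fderiv ℝ f) y :=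
    (hf.fderiv_right (m := ∞) (by simp)).differentiableAt (by simp)
  have e : ∀ a b : Fin n, pderiv a (fun z => pderiv b f z) y =
      fderiv ℝ (fderiv ℝ f) y (EuclideanSpace.single a 1) (EuclideanSpace.single b 1) := by
    intro a b
    simp only [pderiv]
    rw [fderiv_clm_apply hd (differentiableAt_const _)]
    simp
  rw [e, e, hs.eq]

end Pderiv

/-- The curvature of the Levi-Civita connection, with real coefficients. -/
def realCurvature (y : EuclideanSpace ℝ (Fin n)) (k l : Fin n) : Matrix (Fin n) (Fin n) ℝ :=
  matrixPderiv k (fun z => christoffelMatrix g e z l) y -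
    matrixPderiv l (fun z => christoffelMatrix g e z k) y +
    christoffelMatrix g e y k * christoffelMatrix g e y l -
    christoffelMatrix g e y l * christoffelMatrix g e y k

/-- The curvature of the Levi-Civita connection is skew with respect to the metric. -/
theorem realCurvature_skew (he : e ∈ IsManifold.maximalAtlas (𝓡 n) ∞ M)
    {y : EuclideanSpace ℝ (Fin n)} (hy : y ∈ e.target) (k l : Fin n) :
    (realCurvature g e y k l).transpose * metricMatrix g e y +
      metricMatrix g e y * realCurvature g e y k l = 0 := by
  have hG : ∀ i j, DifferentiableAt ℝ (fun z => metricMatrix g e z i j) y := fun i j =>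
    (contDiffAt_metricMatrix g e he hy i j).differentiableAt (by simp)
  have hA : ∀ m i j, DifferentiableAt ℝ (fun z => christoffelMatrix g e z m i j) y := fun m i j =>
    (contDiffAt_christoffel g e he hy i m j).differentiableAt (by simp)
  have hP : ∀ m, matrixPderiv m (fun z => metricMatrix g e z) y =
      (christoffelMatrix g e y m).transpose * metricMatrix g e y +
        metricMatrix g e y * christoffelMatrix g e y m := fun m => by
    ext i j; exact pderiv_metricMatrix g e he hy m i j
  have hprod : ∀ {A B : EuclideanSpace ℝ (Fin n) → Matrix (Fin n) (Fin n) ℝ},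
      (∀ i j, DifferentiableAt ℝ (fun z => A z i j) y) →
      (∀ i j, DifferentiableAt ℝ (fun z => B z i j) y) →
      ∀ i j, DifferentiableAt ℝ (fun z => (A z * B z) i j) y := fun hA hB i j => by
    simp only [Matrix.mul_apply]
    exact DifferentiableAt.fun_sum fun l _ => (hA i l).mul (hB l j)
  have hPP : ∀ a b, matrixPderiv a (fun z => matrixPderiv b (fun z => metricMatrix g e z) z) y =
      ((matrixPderiv a (fun z => christoffelMatrix g e z b) y).transpose * metricMatrix g e y +
        (christoffelMatrix g e y b).transpose * matrixPderiv a (fun z => metricMatrix g e z) y) +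
      (matrixPderiv a (fun z => metricMatrix g e z) y * christoffelMatrix g e y b +
        metricMatrix g e y * matrixPderiv a (fun z => christoffelMatrix g e z b) y) := by
    intro a b
    have hev : matrixPderiv a (fun z => matrixPderiv b (fun z => metricMatrix g e z) z) y =
        matrixPderiv a (fun z => (christoffelMatrix g e z b).transpose * metricMatrix g e z +
          metricMatrix g e z * christoffelMatrix g e z b) y := by
      ext i j
      simp only [matrixPderiv, Matrix.of_apply, pderiv]
      congr 1
      refine Filter.EventuallyEq.fderiv_eq ?_
      -- Compatibility with the metric holds on the whole open chart domain, hence can be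
      -- differentiated once more at y.
      filter_upwards [e.open_target.mem_nhds hy] with z hz
      exact pderiv_metricMatrix g e he hz b i j
    have hT : ∀ i j, DifferentiableAt ℝ (fun z => (christoffelMatrix g e z b).transpose i j) y :=
      fun i j => hA b j i
    rw [hev, matrixPderiv_add (hprod hT hG) (hprod hG (hA b)), matrixPderiv_mul hT hG,
      matrixPderiv_mul hG (hA b)]
    rfl
  have hcomm : matrixPderiv k (fun z => matrixPderiv l (fun z => metricMatrix g e z) z) y =
      matrixPderiv l (fun z => matrixPderiv k (fun z => metricMatrix g e z) z) y := by
    ext i j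
    exact pderiv_comm (contDiffAt_metricMatrix g e he hy i j) k l
  -- Symmetry of the second derivatives of the metric: with ∂G = ΓᵀG + GΓ inserted, the mixed terms
  -- ΓᵀGΓ cancel and the remainder is the skewness of the curvature.
  rw [hPP, hPP, hP, hP] at hcomm
  have h0 := sub_eq_zero.2 hcomm
  rw [← h0, realCurvature]
  simp only [Matrix.transpose_add, Matrix.transpose_sub, Matrix.transpose_mul, mul_add, add_mul,
    mul_sub, sub_mul, mul_assoc]
  abel

end TheCurvatureOfTheLeviCivitaConnection

/-! ### The curvature of associated bundles -/

section TheCurvatureOfAssociatedBundles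

section ComplexPderiv

variable {n : ℕ} {y : EuclideanSpace ℝ (Fin n)}

theorem pderiv_ofReal {f : EuclideanSpace ℝ (Fin n) → ℝ} (hf : DifferentiableAt ℝ f y) (k : Fin n) :
    pderiv k (fun z => (f z : ℂ)) y = ((pderiv k f y : ℝ) : ℂ) := by
  have := (Complex.ofRealCLM.hasFDerivAt.comp y hf.hasFDerivAt).fderiv
  rw [pderiv, show (fun z => (f z : ℂ)) = Complex.ofRealCLM ∘ f from rfl, this]
  rfl

theorem pderiv_linear {ι I : Type*} [Fintype ι] [DecidableEq ι]
    (L : Matrix ι ι ℂ →ₗ[ℂ] Matrix I I ℂ) {A : EuclideanSpace ℝ (Fin n) → Matrix ι ι ℂ}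
    (hA : ∀ a b, DifferentiableAt ℝ (fun z => A z a b) y) (k : Fin n) (i j : I) :
    pderiv k (fun z => L (A z) i j) y = L (Matrix.of fun a b => pderiv k (fun z => A z a b) y) i j := by
  have h : ∀ B : Matrix ι ι ℂ, L B i j = ∑ a, ∑ b, B a b * L (Matrix.single a b 1) i j := by
    intro B
    conv_lhs => rw [Matrix.matrix_eq_sum_single B]
    simp only [map_sum, Matrix.sum_apply]
    refine Finset.sum_congr rfl fun a _ => Finset.sum_congr rfl fun b _ => ?_
    rw [show Matrix.single a b (B a b) = B a b • Matrix.single a b (1 : ℂ) by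
      rw [Matrix.smul_single, smul_eq_mul, mul_one], map_smul, Matrix.smul_apply, smul_eq_mul]
  obtain ⟨c, hc⟩ : ∃ c : ι → ι → ℂ, ∀ B : Matrix ι ι ℂ, L B i j = ∑ a, ∑ b, B a b * c a b :=
    ⟨fun a b => L (Matrix.single a b 1) i j, h⟩
  have hd : ∀ a b, DifferentiableAt ℝ (fun z => A z a b * c a b) y :=
    fun a b => (hA a b).mul_const _
  simp only [hc, Matrix.of_apply]
  rw [pderiv, fderiv_fun_sum fun a _ => DifferentiableAt.fun_sum fun b _ => hd a b, _root_.sum_apply]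
  refine Finset.sum_congr rfl fun a _ => ?_
  rw [fderiv_fun_sum fun b _ => hd a b, _root_.sum_apply]
  refine Finset.sum_congr rfl fun b _ => ?_
  rw [fderiv_mul_const (hA a b), _root_.smul_apply, pderiv, smul_eq_mul, mul_comm]

end ComplexPderiv

variable {n : ℕ} {M : Type*} [TopologicalSpace M] [ChartedSpace (EuclideanSpace ℝ (Fin n)) M]
  [IsManifold (𝓡 n) ∞ M]
variable (g : RiemannianMetricOn n M) (e : OpenPartialHomeomorph M (EuclideanSpace ℝ (Fin n)))

theorem differentiableAt_leviCivita (he : e ∈ IsManifold.maximalAtlas (𝓡 n) ∞ M)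
    {y : EuclideanSpace ℝ (Fin n)} (hy : y ∈ e.target) (k i j : Fin n) :
    DifferentiableAt ℝ (fun z => leviCivita g e z k i j) y :=
  Complex.ofRealCLM.differentiableAt.comp y
    ((contDiffAt_christoffel g e he hy i k j).differentiableAt (by simp))

/-- The curvature coefficients of the complexified tangent bundle. -/
def tangentCurvature (y : EuclideanSpace ℝ (Fin n)) (k l : Fin n) : Matrix (Fin n) (Fin n) ℂ :=
  Matrix.of (fun i j => pderiv k (fun z => leviCivita g e z l i j) y -
      pderiv l (fun z => leviCivita g e z k i j) y)
    + leviCivita g e y k * leviCivita g e y l - leviCivita g e y l * leviCivita g e y k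

theorem tangentCurvature_eq (he : e ∈ IsManifold.maximalAtlas (𝓡 n) ∞ M)
    {y : EuclideanSpace ℝ (Fin n)} (hy : y ∈ e.target) (k l : Fin n) :
    tangentCurvature g e y k l = (realCurvature g e y k l).map Complex.ofRealHom := by
  have h : ∀ a b i j, pderiv a (fun z => leviCivita g e z b i j) y =
      ((pderiv a (fun z => christoffelMatrix g e z b i j) y : ℝ) : ℂ) := fun a b i j =>
    pderiv_ofReal ((contDiffAt_christoffel g e he hy i b j).differentiableAt (by simp)) a
  rw [← RingHom.mapMatrix_apply, realCurvature, map_sub, map_add, map_mul, map_mul, tangentCurvature]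
  simp only [h]
  congr 2
  ext i j
  simp [matrixPderiv]

/-- The differential of ρ is a constant linear map, so it commutes with ∂_k, and it respects
commutators. The curvature of the induced connection is therefore the image of the curvature. -/
theorem curvCoeff_of_functor (he : e ∈ IsManifold.maximalAtlas (𝓡 n) ∞ M)
    {y : EuclideanSpace ℝ (Fin n)} (hy : y ∈ e.target) (B : LocalBundle n)
    (ρ : MatrixFunctor (Fin n) B.idx) (hB : ∀ z k, B.conn z k = ρ.lin ℂ (leviCivita g e z k))
    (k l : Fin n) : B.curvCoeff y k l = ρ.lin ℂ (tangentCurvature g e y k l) := by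
  rw [tangentCurvature, add_sub_assoc, map_add, ρ.lin_commutator, ← add_sub_assoc,
    LocalBundle.curvCoeff]
  simp only [hB]
  congr 2
  ext i j
  rw [Matrix.of_apply,
    pderiv_linear (ρ.lin ℂ) (fun a b => differentiableAt_leviCivita g e he hy l a b),
    pderiv_linear (ρ.lin ℂ) (fun a b => differentiableAt_leviCivita g e he hy k a b),
    ← Matrix.sub_apply, ← map_sub]
  rfl

/-- The curvature form of the complexified tangent bundle. -/
def tangentCurvatureForm (x : M) : Matrix (Fin n) (Fin n) (EvenForms (Covector n x)) :=
  ∑ k, ∑ l ∈ Finset.Ioi k, wedge (coordCovector e k x) (coordCovector e l x) •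
    (tangentCurvature g e (e x) k l).map (algebraMap ℂ (EvenForms (Covector n x)))

theorem curvature_of_functor (he : e ∈ IsManifold.maximalAtlas (𝓡 n) ∞ M) {x : M} (hx : x ∈ e.source)
    (B : LocalBundle n) (ρ : MatrixFunctor (Fin n) B.idx)
    (hB : ∀ z k, B.conn z k = ρ.lin ℂ (leviCivita g e z k)) :
    curvature e B x = ρ.lin _ (tangentCurvatureForm g e x) := by
  simp only [tangentCurvatureForm, map_sum, map_smul, ← ρ.lin_map]
  ext1 i j
  simp only [curvature, Matrix.of_apply, Matrix.sum_apply, Matrix.smul_apply, Matrix.map_apply]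
  refine Finset.sum_congr rfl fun k _ => Finset.sum_congr rfl fun l _ => ?_
  rw [curvCoeff_of_functor g e he (e.map_source hx) B ρ hB, smul_eq_mul, mul_comm, Algebra.smul_def]

theorem curvature_tangentC (x : M) :
    curvature e (tangentC g e) x = tangentCurvatureForm g e x := by
  change Matrix.of (fun i j : Fin n => ∑ k, ∑ l ∈ Finset.Ioi k, tangentCurvature g e (e x) k l i j •
    wedge (coordCovector e k x) (coordCovector e l x)) = _
  ext1 i j
  simp only [tangentCurvatureForm, Matrix.of_apply, Matrix.sum_apply, Matrix.smul_apply,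
    Matrix.map_apply]
  refine Finset.sum_congr rfl fun k _ => Finset.sum_congr rfl fun l _ => ?_
  rw [smul_eq_mul, mul_comm, Algebra.smul_def]

/-- The metric as a matrix of even forms. -/
def metricForm (x : M) : Matrix (Fin n) (Fin n) (EvenForms (Covector n x)) :=
  (metricMatrix g e (e x)).map ((algebraMap ℂ (EvenForms (Covector n x))).comp Complex.ofRealHom)

theorem isUnit_metricForm (he : e ∈ IsManifold.maximalAtlas (𝓡 n) ∞ M) {x : M} (hx : x ∈ e.source) :
    IsUnit (metricForm g e x) :=
  ((Matrix.isUnit_iff_isUnit_det _).2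
    (det_metricMatrix_ne_zero g e he (e.map_source hx)).isUnit).map (RingHom.mapMatrix _)

theorem tangentCurvatureForm_skew (he : e ∈ IsManifold.maximalAtlas (𝓡 n) ∞ M) {x : M}
    (hx : x ∈ e.source) : (tangentCurvatureForm g e x).transpose * metricForm g e x +
      metricForm g e x * tangentCurvatureForm g e x = 0 := by
  simp only [tangentCurvatureForm, Matrix.transpose_sum, Matrix.transpose_smul, Finset.sum_mul,
    Finset.mul_sum, smul_mul_assoc, mul_smul_comm, ← Finset.sum_add_distrib, ← smul_add]
  refine Finset.sum_eq_zero fun k _ => Finset.sum_eq_zero fun l _ => ?_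
  have h := congrArg (RingHom.mapMatrix ((algebraMap ℂ (EvenForms (Covector n x))).comp
    Complex.ofRealHom)) (realCurvature_skew g e he (e.map_source hx) k l)
  rw [map_add, map_mul, map_mul, map_zero] at h
  rw [tangentCurvature_eq g e he (e.map_source hx)]
  exact (congrArg _ h).trans (smul_zero _)

/-- The functor defining a power of a bundle. -/
def powerFunctor : ∀ a : PowerName, MatrixFunctor (Fin n) (powerBundle g e a).idx
  | .ext p => MatrixFunctor.exterior n p
  | .sym p => MatrixFunctor.symmetric n p

theorem conn_powerBundle (a : PowerName) (z : EuclideanSpace ℝ (Fin n)) (k : Fin n) :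
    (powerBundle g e a).conn z k = (powerFunctor g e a).lin ℂ (leviCivita g e z k) := by
  cases a <;> rfl

open scoped Classical in
/-- The functor defining a tensor product of powers of a bundle. -/
def tensorFunctor (w : Multiset PowerName) : MatrixFunctor (Fin n) (tensorBundle g e w).idx :=
  MatrixFunctor.tensor fun a : w.ToType => powerFunctor g e a.1

theorem conn_tensorBundle (w : Multiset PowerName) (z : EuclideanSpace ℝ (Fin n)) (k : Fin n) :
    (tensorBundle g e w).conn z k = (tensorFunctor g e w).lin ℂ (leviCivita g e z k) := by
  classical
  have h : ∀ a : w.ToType, (powerBundle g e a.1).conn z k =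
    (powerFunctor g e a.1).lin ℂ (leviCivita g e z k) := fun a => conn_powerBundle g e a.1 z k
  refine Matrix.ext fun f f' => ?_
  simp only [tensorBundle, LocalBundle.tensor, h]
  rfl

theorem trace_tensorFunctor (w : Multiset PowerName) {R : Type} [CommRing R]
    (A : Matrix (Fin n) (Fin n) R) : ((tensorFunctor g e w).act R A).trace =
      (w.map fun a => ((powerFunctor g e a).act R A).trace).prod := by
  classical
  rw [tensorFunctor]
  refine (MatrixFunctor.trace_act_tensor _ A).trans ?_
  exact congrArg Multiset.prod
    (w.map_univ_comp_coe fun a => ((powerFunctor g e a).act R A).trace)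

end TheCurvatureOfAssociatedBundles

/-! ### The ring of even forms -/

section TheRingOfEvenForms

section EvenFormsRing

variable (W : Type*) [AddCommGroup W] [Module ℂ W]

/-- The even forms of degree `d`. -/
def evenGrading (d : ℕ) : Submodule ℂ (EvenForms W) :=
  (⋀[ℂ]^d W).comap (EvenForms.incl W).toLinearMap

variable {W}

theorem mem_evenGrading {d : ℕ} {η : EvenForms W} :
    η ∈ evenGrading W d ↔ EvenForms.incl W η ∈ ⋀[ℂ]^d W := Iff.rfl

instance : SetLike.GradedMonoid (evenGrading W) where
  one_mem := by
    rw [mem_evenGrading, map_one]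
    exact SetLike.GradedOne.one_mem (A := fun i : ℕ => ⋀[ℂ]^i W)
  mul_mem i j a b ha hb := by
    rw [mem_evenGrading] at *
    rw [map_mul]
    exact SetLike.GradedMul.mul_mem (A := fun i : ℕ => ⋀[ℂ]^i W) ha hb

theorem wedge_mem_evenGrading (u v : W) : wedge u v ∈ evenGrading W 2 := by
  have h : ∀ u : W, ExteriorAlgebra.ι ℂ u ∈ ⋀[ℂ]^1 W := fun u => by
    change _ ∈ LinearMap.range (ExteriorAlgebra.ι ℂ) ^ 1
    rw [pow_one]; exact LinearMap.mem_range_self _ u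
  exact SetLike.GradedMul.mul_mem (A := fun i : ℕ => ⋀[ℂ]^i W) (h u) (h v)

theorem evenGrading_eq_bot [Module.Finite ℂ W] {d : ℕ} (h : Module.finrank ℂ W < d) :
    evenGrading W d = ⊥ := by
  have h0 : ⋀[ℂ]^d W = ⊥ := by
    rw [← Submodule.finrank_eq_zero, exteriorPower.finrank_eq, Nat.choose_eq_zero_of_lt h]
  rw [evenGrading, h0]
  exact LinearMap.ker_eq_bot.2 Subtype.val_injective

/-- The component of degree `d` as a linear map. -/
def degreePartLinear (d : ℕ) : EvenForms W →ₗ[ℂ] ExteriorAlgebra ℂ W :=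
  (GradedAlgebra.proj (fun i : ℕ => ⋀[ℂ]^i W) d) ∘ₗ (EvenForms.incl W).toLinearMap

theorem degreePartLinear_apply (d : ℕ) (η : EvenForms W) :
    degreePartLinear d η = degreePart d η := rfl

theorem degreePartLinear_eq_zero {d d' : ℕ} (h : d' ≠ d) {η : EvenForms W}
    (hη : η ∈ evenGrading W d') : degreePartLinear d η = 0 := by
  rw [degreePartLinear_apply, degreePart, GradedAlgebra.proj_apply]
  exact DirectSum.decompose_of_mem_ne _ hη h

/-- The constant term as a ring homomorphism. -/
def constantTermHom : EvenForms W →ₐ[ℂ] ℂ :=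
  ExteriorAlgebra.algebraMapInv.comp (EvenForms.incl W)

theorem constantTermHom_apply (η : EvenForms W) : constantTermHom η = constantTerm η := rfl

variable (W) in
/-- The even forms without components of degree less than `d`. -/
def evenFiltration (d : ℕ) : Submodule ℂ (EvenForms W) :=
  Submodule.span ℂ {η | ∃ i, d ≤ i ∧ η ∈ evenGrading W i}

theorem evenFiltration_mono {a b : ℕ} (h : a ≤ b) : evenFiltration W b ≤ evenFiltration W a :=
  Submodule.span_mono fun _ ⟨i, hi, hη⟩ => ⟨i, h.trans hi, hη⟩

theorem mul_mem_evenFiltration {a b : ℕ} {η τ : EvenForms W} (hη : η ∈ evenFiltration W a)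
    (hτ : τ ∈ evenFiltration W b) : η * τ ∈ evenFiltration W (a + b) := by
  have h : evenFiltration W a * evenFiltration W b ≤ evenFiltration W (a + b) := by
    rw [evenFiltration, evenFiltration, Submodule.span_mul_span]
    refine Submodule.span_mono ?_
    rintro _ ⟨η, ⟨i, hi, hη⟩, τ, ⟨j, hj, hτ⟩, rfl⟩
    exact ⟨i + j, add_le_add hi hj, SetLike.mul_mem_graded hη hτ⟩
  exact h (Submodule.mul_mem_mul hη hτ)

theorem exists_sub_algebraMap_mem (η : EvenForms W) :
    ∃ c : ℂ, η - algebraMap ℂ _ c ∈ evenFiltration W 1 := by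
  obtain ⟨η, hη⟩ := η
  induction hη using Algebra.adjoin_induction with
  | mem x hx =>
    obtain ⟨u, v, rfl⟩ := hx
    refine ⟨0, ?_⟩
    rw [map_zero, sub_zero]
    exact Submodule.subset_span ⟨2, by norm_num, wedge_mem_evenGrading u v⟩
  | algebraMap r =>
    refine ⟨r, ?_⟩
    convert Submodule.zero_mem _
    exact sub_eq_zero.2 rfl
  | add x y hx hy h1 h2 =>
    obtain ⟨c, hc⟩ := h1
    obtain ⟨d, hd⟩ := h2
    refine ⟨c + d, ?_⟩
    convert Submodule.add_mem _ hc hd using 1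
    rw [map_add, sub_add_sub_comm]
    rfl
  | mul x y hx hy h1 h2 =>
    obtain ⟨c, hc⟩ := h1
    obtain ⟨d, hd⟩ := h2
    refine ⟨c * d, ?_⟩
    have e : (⟨x * y, Subalgebra.mul_mem _ hx hy⟩ : EvenForms W) = ⟨x, hx⟩ * ⟨y, hy⟩ := rfl
    rw [e, map_mul]
    generalize (⟨x, hx⟩ : EvenForms W) = x' at *
    generalize (⟨y, hy⟩ : EvenForms W) = y' at *
    convert Submodule.add_mem _ (Submodule.add_mem _ (Submodule.smul_mem _ c hd)
      (Submodule.smul_mem _ d hc)) (evenFiltration_mono (by norm_num)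
        (mul_mem_evenFiltration hc hd)) using 1
    simp only [Algebra.smul_def]
    ring

theorem constantTermHom_eq_zero {η : EvenForms W} (hη : η ∈ evenFiltration W 1) :
    constantTermHom η = 0 := by
  have : evenFiltration W 1 ≤ LinearMap.ker (constantTermHom (W := W)).toLinearMap := by
    refine Submodule.span_le.2 ?_
    rintro η ⟨i, hi, hη⟩
    change ExteriorAlgebra.algebraMapInv (EvenForms.incl W η) = 0
    rw [mem_evenGrading] at hη
    obtain ⟨i, rfl⟩ := Nat.exists_eq_add_of_le' hi
    generalize EvenForms.incl W η = τ at hη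
    change _ ∈ LinearMap.range (ExteriorAlgebra.ι ℂ) ^ (i + 1) at hη
    rw [pow_succ] at hη
    induction hη using Submodule.mul_induction_on' with
    | mem_mul_mem a ha b hb =>
      obtain ⟨v, rfl⟩ := hb
      rw [map_mul, ExteriorAlgebra.algebraMapInv, ExteriorAlgebra.lift_ι_apply]
      simp
    | add a ha b hb h1 h2 => rw [map_add, h1, h2, add_zero]
  exact this hη

theorem mem_evenFiltration_of_constantTermHom {η : EvenForms W} (h : constantTermHom η = 0) :
    η ∈ evenFiltration W 1 := by
  obtain ⟨c, hc⟩ := exists_sub_algebraMap_mem η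
  have h1 := constantTermHom_eq_zero hc
  rw [map_sub, h, AlgHom.commutes, zero_sub, neg_eq_zero] at h1
  rwa [show c = 0 from h1, map_zero, sub_zero] at hc

/-- The m-th power of a form without constant term has no component of degree below m, and no
nonzero form has degree above the dimension. -/
theorem pow_eq_zero_of_constantTermHom [Module.Finite ℂ W] {n : ℕ} (hn : Module.finrank ℂ W ≤ n)
    {η : EvenForms W} (h : constantTermHom η = 0) : η ^ (n + 1) = 0 := by
  have key : ∀ m, η ^ m ∈ evenFiltration W m := by
    intro m
    induction m with
    | zero =>
      rw [pow_zero]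
      exact Submodule.subset_span ⟨0, le_rfl, SetLike.GradedOne.one_mem⟩
    | succ m ih =>
      rw [pow_succ]
      exact mul_mem_evenFiltration ih (mem_evenFiltration_of_constantTermHom h)
  have h0 : evenFiltration W (n + 1) = ⊥ := by
    rw [evenFiltration, Submodule.span_eq_bot]
    rintro τ ⟨i, hi, hτ⟩
    rw [evenGrading_eq_bot (by omega : Module.finrank ℂ W < i)] at hτ
    exact hτ
  have := key (n + 1)
  rwa [h0] at this

/-- An even form differs from its constant term by a nilpotent form. -/
theorem isLocalHom_constantTermHom [Module.Finite ℂ W] :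
    IsLocalHom (constantTermHom (W := W)).toRingHom where
  map_nonunit η hη := by
    change IsUnit (constantTermHom η) at hη
    have h : IsNilpotent (η - algebraMap ℂ _ (constantTermHom η)) :=
      ⟨_, pow_eq_zero_of_constantTermHom le_rfl (by simp)⟩
    have h2 := h.isUnit_add_left_of_commute (hη.map (algebraMap ℂ (EvenForms W)))
      (mul_comm _ _)
    rwa [add_comm, sub_add_cancel] at h2

theorem matrix_pow_eq_zero [Module.Finite ℂ W] {n : ℕ} (hn : Module.finrank ℂ W ≤ n)
    {ι : Type*} [Fintype ι] [DecidableEq ι] {F : Matrix ι ι (EvenForms W)}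
    (h2 : ∀ i j, F i j ∈ evenGrading W 2) : F ^ (n + 1) = 0 := by
  ext1 i j
  have := pow_apply_mem (evenGrading W) F h2 (n + 1) i j
  rwa [evenGrading_eq_bot (by omega)] at this

theorem binomialSeries_half_sq :
    PowerSeries.binomialSeries ℂ (1 / 2 : ℂ) ^ 2 = 1 + PowerSeries.X := by
  rw [sq, ← PowerSeries.binomialSeries_add, add_halves]
  simpa using PowerSeries.binomialSeries_nat (A := ℂ) (R := ℂ) 1

/-- D/c - 1 is nilpotent, so evaluating the binomial series there is multiplicative and its square
gives D/c; the scalar √c restores the constant term. -/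
theorem sqrtForm_sq [Module.Finite ℂ W] {n : ℕ} (hn : Module.finrank ℂ W ≤ n) {D : EvenForms W}
    {c : ℝ} (hc : 0 < c) (hD : constantTermHom D = (c : ℂ)) :
    sqrtForm n D ^ 2 = D ∧ constantTermHom (sqrtForm n D) = (Real.sqrt c : ℂ) := by
  have hc0 : (c : ℂ) ≠ 0 := Complex.ofReal_ne_zero.2 hc.ne'
  have h1 : constantTermHom ((c : ℂ)⁻¹ • D - 1) = 0 := by
    rw [map_sub, map_smul, hD, map_one, smul_eq_mul, inv_mul_cancel₀ hc0, sub_self]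
  have h0 := pow_eq_zero_of_constantTermHom hn h1
  rw [sqrtForm, ← constantTermHom_apply, hD, Complex.ofReal_re, evalNilpotent_eq_nilEval n _ h0]
  constructor
  · rw [smul_pow, ← map_pow, binomialSeries_half_sq, map_add, map_one, nilEval_X,
      add_sub_cancel, smul_smul, ← Complex.ofReal_pow, Real.sq_sqrt hc.le, mul_inv_cancel₀ hc0,
      one_smul]
  · rw [map_smul, nilEval_apply, map_sum, Finset.sum_eq_single 0]
    · simp
    · intro m _ hm
      rw [map_smul, map_pow, h1, zero_pow hm, smul_zero]
    · simp

/-- The rational structure serves the exponential series in `MatrixFunctor.act_exp` and, through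
torsion-freeness, the comparison of derivatives in `degreeTraceSeries_mul_det`. -/
instance : Algebra ℚ (EvenForms W) := Algebra.compHom _ (algebraMap ℚ ℂ)

instance : IsAddTorsionFree (EvenForms W) := IsAddTorsionFree.of_module_rat _

end EvenFormsRing

theorem finrank_covector {n : ℕ} {M : Type*} [TopologicalSpace M]
    [ChartedSpace (EuclideanSpace ℝ (Fin n)) M] (x : M) :
    Module.finrank ℂ (Covector n x) = n := by
  change Module.finrank ℂ (EuclideanSpace ℝ (Fin n) →ₗ[ℝ] ℂ) = n
  rw [Module.finrank_linearMap ℝ ℂ, finrank_euclideanSpace_fin, Module.finrank_self, mul_one]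

instance {n : ℕ} {M : Type*} [TopologicalSpace M]
    [ChartedSpace (EuclideanSpace ℝ (Fin n)) M] (x : M) : Module.Finite ℂ (Covector n x) :=
  inferInstanceAs (Module.Finite ℂ (EuclideanSpace ℝ (Fin n) →ₗ[ℝ] ℂ))

variable {n : ℕ} {M : Type*} [TopologicalSpace M] [ChartedSpace (EuclideanSpace ℝ (Fin n)) M]
  [IsManifold (𝓡 n) ∞ M]
variable (g : RiemannianMetricOn n M) (e : OpenPartialHomeomorph M (EuclideanSpace ℝ (Fin n)))

theorem tangentCurvatureForm_mem (x : M) (i j : Fin n) :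
    tangentCurvatureForm g e x i j ∈ evenGrading (Covector n x) 2 := by
  simp only [tangentCurvatureForm, Matrix.sum_apply, Matrix.smul_apply, Matrix.map_apply]
  refine Submodule.sum_mem _ fun k _ => Submodule.sum_mem _ fun l _ => ?_
  rw [smul_eq_mul, mul_comm, ← Algebra.smul_def]
  exact Submodule.smul_mem _ _ (wedge_mem_evenGrading _ _)


end TheRingOfEvenForms

/-! ### Characters of virtual bundles -/

theorem map_det_one_sub_smul {R S ι : Type*} [CommRing R] [CommRing S] [Fintype ι] [DecidableEq ι]
    (φ : R →+* S) (s : R) (A : Matrix ι ι R) :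
    φ (1 - s • A).det = (1 - φ s • A.map φ).det := by
  rw [RingHom.map_det, map_sub, map_one]
  congr 2
  ext i j
  simp

theorem map_det_one_add_smul {R S ι : Type*} [CommRing R] [CommRing S] [Fintype ι] [DecidableEq ι]
    (φ : R →+* S) (s : R) (A : Matrix ι ι R) :
    φ (1 + s • A).det = (1 + φ s • A.map φ).det := by
  rw [RingHom.map_det, map_add, map_one]
  congr 2
  ext i j
  simp

section VirtualTrace

open PowerSeries

variable {R : Type} [CommRing R] {N : ℕ} (B : Matrix (Fin N) (Fin N) R)

/-- The trace of the action of a matrix on an exterior or symmetric power. -/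
def powerTrace : PowerName → R
  | .ext p => ((MatrixFunctor.exterior N p).act R B).trace
  | .sym p => ((MatrixFunctor.symmetric N p).act R B).trace

/-- The character of virtual bundles at a matrix. -/
def virtualTrace : VirtualBundle →+* R :=
  (AddMonoidAlgebra.lift ℤ R (Multiset PowerName)
    { toFun := fun w => (w.toAdd.map (powerTrace B)).prod
      map_one' := by simp
      map_mul' := fun v w => by rw [toAdd_mul, Multiset.map_add, Multiset.prod_add] }).toRingHom

theorem virtualTrace_apply (b : VirtualBundle) :
    virtualTrace B b = b.coeff.sum fun w m => m • (w.map (powerTrace B)).prod :=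
  AddMonoidAlgebra.lift_apply _ _

theorem virtualTrace_powerClass (a : PowerName) : virtualTrace B (powerClass a) = powerTrace B a := by
  refine (AddMonoidAlgebra.lift_single ..).trans ?_
  rw [one_smul]
  change (Multiset.map (powerTrace B) {a}).prod = _
  rw [Multiset.map_singleton, Multiset.prod_singleton]

theorem map_lambdaSeries : PowerSeries.map (virtualTrace B) lambdaSeries =
    (1 + (X : PowerSeries R) • B.map C).det := by
  rw [← traceSeries_exterior]
  ext p
  rw [coeff_map, lambdaSeries, coeff_mk, coeff_mk]
  -- The coefficient of degree 0 is the unit 1 rather than the class of Λ⁰, so it is compared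
  -- separately.
  split_ifs with h
  · subst h
    have h0 := congrArg (coeff 0) (traceSeries_exterior B)
    rw [coeff_mk] at h0
    rw [map_one, h0, coeff_zero_eq_constantCoeff_apply, map_det_one_add_smul,
      constantCoeff_X, zero_smul, add_zero, Matrix.det_one]
  · rw [virtualTrace_powerClass, powerTrace]

theorem map_symSeries [IsAddTorsionFree R] : PowerSeries.map (virtualTrace B) symSeries *
    (1 - (X : PowerSeries R) • B.map C).det = 1 := by
  rw [← traceSeries_symmetric B]
  congr 1
  ext p
  rw [coeff_map, symSeries, coeff_mk, coeff_mk]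
  split_ifs with h
  · subst h
    have h0 := congrArg (coeff 0) (traceSeries_symmetric B)
    have h1 : constantCoeff (1 - (X : PowerSeries R) • B.map C).det = 1 := by
      rw [map_det_one_sub_smul, constantCoeff_X, zero_smul, sub_zero, Matrix.det_one]
    rw [coeff_zero_eq_constantCoeff_apply, map_mul, h1, mul_one,
      ← coeff_zero_eq_constantCoeff_apply, coeff_mk] at h0
    rw [map_one, h0]; simp
  · rw [virtualTrace_powerClass, powerTrace]

theorem map_symTilde [IsAddTorsionFree R] : PowerSeries.map (virtualTrace B) (symTilde N) *
    (1 - (X : PowerSeries R) • B.map C).det = (1 - X) ^ N := by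
  rw [symTilde, map_mul, mul_right_comm, map_symSeries, one_mul, map_pow, map_sub, map_one, map_X]

theorem map_rescale_lambdaTilde :
    PowerSeries.map (virtualTrace B) (rescale (-1) (lambdaTilde N)) * (1 - X) ^ N =
      (1 - (X : PowerSeries R) • B.map C).det := by
  have h : lambdaTilde N * (1 + X) ^ N = lambdaSeries := by
    rw [lambdaTilde, mul_assoc, PowerSeries.invOfUnit_mul, mul_one]
    simp
  have h2 := congrArg (fun f => rescale (-1 : R) (PowerSeries.map (virtualTrace B) f)) h
  have h3 : ∀ f : PowerSeries VirtualBundle, rescale (-1 : R) (PowerSeries.map (virtualTrace B) f) =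
      PowerSeries.map (virtualTrace B) (rescale (-1) f) := fun f => by
    ext m
    simp [coeff_rescale]
  simp only [map_lambdaSeries] at h2
  rw [map_mul, map_mul, map_pow, map_pow, map_add, map_add, map_one, map_one, map_X,
    rescale_neg_one_X, ← sub_eq_add_neg, h3] at h2
  have h4 : (B.map C).map (rescale (-1 : R)) = B.map C := by
    ext i j m
    simp only [Matrix.map_apply, coeff_rescale, coeff_C]
    split_ifs with hm
    · rw [hm, pow_zero, one_mul]
    · rw [mul_zero]
  rw [h2, map_det_one_add_smul, h4, rescale_neg_one_X, neg_smul, sub_eq_add_neg]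

/-- The determinant of `1 - X ^ d • B`. -/
def powDet (d : ℕ) : PowerSeries R := (1 - (X : PowerSeries R) ^ d • B.map C).det

theorem expand_powDet (d : ℕ) (hd : d ≠ 0) :
    expand d hd (1 - (X : PowerSeries R) • B.map C).det = powDet B d := by
  have h : (B.map C).map (expand d hd : PowerSeries R →ₐ[R] PowerSeries R) = B.map C := by
    ext1 i j
    rw [Matrix.map_apply, Matrix.map_apply, expand_C]
  refine (map_det_one_sub_smul (expand d hd : PowerSeries R →ₐ[R] PowerSeries R).toRingHom _ _).trans ?_
  rw [powDet]
  congr 3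
  exact expand_X d hd

theorem modX_powDet {d e : ℕ} (h : d ≤ e) : modX d (powDet B e) = 1 := by
  rw [powDet, map_det_one_sub_smul, modX_X_pow h]
  have h0 : ∀ {T : Type} [CommRing T] (A : Matrix (Fin N) (Fin N) T),
      (1 - (0 : T) • A).det = 1 := fun A => by
    rw [zero_smul, sub_zero, Matrix.det_one]
  exact h0 _

theorem modX_expand {d e : ℕ} (h : d ≤ e) (he : e ≠ 0) {f : PowerSeries R}
    (hf : constantCoeff f = 1) : modX d (expand e he f) = 1 := by
  rw [← map_one (modX d), modX_eq_iff]
  intro m hm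
  rcases Nat.eq_zero_or_pos m with rfl | hm0
  · simp [hf]
  · rw [coeff_expand_of_not_dvd, coeff_one, if_neg hm0.ne']
    exact fun hd => absurd (Nat.le_of_dvd hm0 hd) (by omega)

theorem infiniteProduct_pow {f : ℕ → PowerSeries R} (hf : ∀ j, modX (j + 1) (f j) = 1) (m : ℕ) :
    infiniteProduct (fun j => f j ^ m) = infiniteProduct f ^ m := by
  induction m with
  | zero => simp only [pow_zero, infiniteProduct_one]
  | succ m ih =>
    simp only [pow_succ]
    rw [infiniteProduct_mul (fun j => by rw [map_pow, hf, one_pow]) hf, ih]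

/-- Each symmetric factor contributes (1 - X^{2j})^N / det(1 - X^{2j} B), each exterior factor det(1
- X^{2j-1} B) / (1 - X^{2j-1})^N. Denominators are moved to the left. -/
theorem map_thetaTwo [IsAddTorsionFree R] : PowerSeries.map (virtualTrace B) (thetaTwo N) *
    (infiniteProduct (fun j => powDet B (2 * (j + 1))) * oddProd 1 ^ N) =
      evenProd 1 ^ N * infiniteProduct (fun j => powDet B (2 * j + 1)) := by
  have hc : ∀ (f : PowerSeries R) (d : ℕ) (hd : d ≠ 0), constantCoeff (expand d hd f) =
    constantCoeff f := fun f d hd => constantCoeff_expand d hd f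
  have c1 : constantCoeff (1 - (X : PowerSeries R) • B.map C).det = 1 := by
    have := hc (1 - (X : PowerSeries R) • B.map C).det 1 one_ne_zero
    rw [← this, expand_powDet]
    have := modX_eq_iff.1 ((modX_powDet B (le_refl 1)).trans (map_one _).symm) 0 one_pos
    simpa using this
  have c2 : constantCoeff (PowerSeries.map (virtualTrace B) (symTilde N)) = 1 := by
    have := congrArg constantCoeff (map_symTilde B)
    rw [map_mul, c1, mul_one] at this
    rw [this]; simp
  have c3 : constantCoeff (PowerSeries.map (virtualTrace B) (rescale (-1) (lambdaTilde N))) = 1 := by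
    have := congrArg constantCoeff (map_rescale_lambdaTilde B)
    rw [map_mul, c1] at this
    simpa using this
  have e1 : ∀ j, modX (j + 1) ((1 - X ^ (2 * (j + 1)) * C (1 : R)) ^ N) = 1 := fun j => by
    rw [map_pow, modX_one_sub_X_pow (by omega), one_pow]
  have e2 : ∀ j, modX (j + 1) ((1 - X ^ (2 * j + 1) * C (1 : R)) ^ N) = 1 := fun j => by
    rw [map_pow, modX_one_sub_X_pow (by omega), one_pow]
  rw [thetaTwo, map_mul, map_infiniteProduct, map_infiniteProduct, evenProd, oddProd,
    ← infiniteProduct_pow (fun j => modX_one_sub_X_pow (by omega) _),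
    ← infiniteProduct_pow (fun j => modX_one_sub_X_pow (by omega) _), mul_mul_mul_comm]
  simp only [map_expand]
  rw [← infiniteProduct_mul (fun j => modX_expand (by omega) _ c2)
      (fun j => modX_powDet B (by omega)),
    ← infiniteProduct_mul (fun j => modX_expand (by omega) _ c3) e2]
  congr 2
  · funext j
    rw [← expand_powDet B (2 * (j + 1)) (by omega), ← map_mul, map_symTilde]
    simp
  · funext j
    rw [← expand_powDet B (2 * j + 1) (by omega), ← map_rescale_lambdaTilde, map_mul]
    simp

theorem constantCoeff_thetaTwo : constantCoeff (thetaTwo N) = 1 := by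
  rw [thetaTwo, map_mul, constantCoeff_infiniteProduct, constantCoeff_infiniteProduct, one_mul]

end VirtualTrace

/-! ### The multiplicative norm from series in x and q^{1/2} to series of forms -/

section FormNorm

open PowerSeries

variable {E : Type*} [CommRing E] [Algebra ℂ E] {ι : Type*} [Fintype ι] [DecidableEq ι]
  (N : ℕ) (F : Matrix ι ι E) (hF : F ^ (N + 1) = 0)

/-- The determinant of the value at a nilpotent matrix of a power series in two variables. -/
def formNorm : PowerSeries (PowerSeries ℂ) →* PowerSeries E :=
  Matrix.detMonoidHom.comp <| RingHom.toMonoidHom <|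
    (nilEval N (F.map (algebraMap E (PowerSeries E))) (map_pow_eq_zero _ hF)).comp <|
      (PowerSeries.map (PowerSeries.map (algebraMap ℂ E))).comp (swapSeries ℂ)

theorem formNorm_apply (φ : PowerSeries (PowerSeries ℂ)) : formNorm N F hF φ =
    (nilEval N (F.map (algebraMap E (PowerSeries E))) (map_pow_eq_zero _ hF)
      (PowerSeries.map (PowerSeries.map (algebraMap ℂ E)) (swapSeries ℂ φ))).det := rfl

theorem nilEval_map_swapSeries_C (f : PowerSeries ℂ) :
    nilEval N (F.map (algebraMap E (PowerSeries E))) (map_pow_eq_zero _ hF)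
      (PowerSeries.map (PowerSeries.map (algebraMap ℂ E)) (swapSeries ℂ (C f))) =
    (nilEval N F hF (PowerSeries.map (algebraMap ℂ E) f)).map C := by
  rw [map_nilEval _ _ _ _ (map_pow_eq_zero _ hF), swapSeries_C]
  have : PowerSeries.map (PowerSeries.map (algebraMap ℂ E)) (PowerSeries.map C f) =
      PowerSeries.map C (PowerSeries.map (algebraMap ℂ E) f) := by
    ext; simp
  rw [this]
  rfl

theorem formNorm_C (f : PowerSeries ℂ) :
    formNorm N F hF (C f) = C (nilEval N F hF (PowerSeries.map (algebraMap ℂ E) f)).det := by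
  rw [formNorm_apply, nilEval_map_swapSeries_C, RingHom.map_det]
  rfl

theorem formNorm_map_C (f : PowerSeries ℂ) : formNorm N F hF (PowerSeries.map C f) =
    (PowerSeries.map (algebraMap ℂ E) f) ^ Fintype.card ι := by
  rw [formNorm_apply, swapSeries_map_C, map_C, nilEval_C, Matrix.algebraMap_eq_diagonal,
    Matrix.det_diagonal]
  simp

theorem formNorm_one_sub (d : ℕ) (f : PowerSeries ℂ) : formNorm N F hF (1 - X ^ d * C f) =
    (1 - (X : PowerSeries E) ^ d •
      (nilEval N F hF (PowerSeries.map (algebraMap ℂ E) f)).map C).det := by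
  rw [formNorm_apply, map_sub, map_mul, map_pow, swapSeries_X, map_sub, map_mul, map_pow, map_one,
    map_one, map_C, map_X, map_sub, map_mul, map_one, map_pow, nilEval_C, nilEval_map_swapSeries_C,
    ← map_pow, Algebra.smul_def]

/-- A multiple of X^d in the q-variable changes every matrix entry by a multiple of X^d. This
continuity lets the norm pass through infinite products. -/
theorem modX_formNorm {d : ℕ} {φ ψ : PowerSeries (PowerSeries ℂ)} (h : modX d φ = modX d ψ) :
    modX d (formNorm N F hF φ) = modX d (formNorm N F hF ψ) := by
  rw [modX, Ideal.Quotient.mk_eq_mk_iff_sub_mem, Ideal.mem_span_singleton] at h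
  obtain ⟨ρ, hρ⟩ := h
  rw [sub_eq_iff_eq_add.1 hρ, formNorm_apply, formNorm_apply, map_add, map_add, map_add, map_mul,
    map_mul, map_mul, map_pow, swapSeries_X, map_pow, map_C, map_X, map_pow, nilEval_C, ← map_pow,
    ← Algebra.smul_def, RingHom.map_det, RingHom.map_det]
  congr 1
  ext1 i j
  simp only [RingHom.mapMatrix_apply, Matrix.map_apply, Matrix.add_apply, Matrix.smul_apply,
    smul_eq_mul, map_add, map_mul, modX_X_pow le_rfl, zero_mul, zero_add]

theorem formNorm_infiniteProduct {f : ℕ → PowerSeries (PowerSeries ℂ)}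
    (hf : ∀ j, modX (j + 1) (f j) = 1) :
    formNorm N F hF (infiniteProduct f) = infiniteProduct fun j => formNorm N F hF (f j) := by
  refine eq_of_modX fun d => ?_
  have h1 : ∀ j, modX (j + 1) (formNorm N F hF (f j)) = 1 := fun j => by
    rw [modX_formNorm N F hF ((hf j).trans (map_one _).symm), map_one, map_one]
  have h2 := modX_infiniteProduct hf d.le_succ
  rw [modX_infiniteProduct h1 d.le_succ, ← map_prod, ← map_prod]
  rw [← map_prod] at h2
  exact modX_formNorm N F hF h2

theorem formNorm_evenProd (f : PowerSeries ℂ) : formNorm N F hF (evenProd f) =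
    infiniteProduct fun j => (1 - (X : PowerSeries E) ^ (2 * (j + 1)) •
      (nilEval N F hF (PowerSeries.map (algebraMap ℂ E) f)).map C).det := by
  rw [evenProd, formNorm_infiniteProduct _ _ _ (fun j => modX_one_sub_X_pow (by omega) _)]
  simp only [formNorm_one_sub]

theorem formNorm_oddProd (f : PowerSeries ℂ) : formNorm N F hF (oddProd f) =
    infiniteProduct fun j => (1 - (X : PowerSeries E) ^ (2 * j + 1) •
      (nilEval N F hF (PowerSeries.map (algebraMap ℂ E) f)).map C).det := by
  rw [oddProd, formNorm_infiniteProduct _ _ _ (fun j => modX_one_sub_X_pow (by omega) _)]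
  simp only [formNorm_one_sub]

theorem formNorm_evenProd_one :
    formNorm N F hF (evenProd 1) = evenProd 1 ^ Fintype.card ι := by
  rw [← map_one (C (R := ℂ)), ← map_evenProd, formNorm_map_C, map_evenProd, map_one]

theorem formNorm_oddProd_one :
    formNorm N F hF (oddProd 1) = oddProd 1 ^ Fintype.card ι := by
  rw [← map_one (C (R := ℂ)), ← map_oddProd, formNorm_map_C, map_oddProd, map_one]

/-- Skewness makes F conjugate to -Fᵀ, so x ↦ -x does not change the determinant. -/
theorem formNorm_map_evalNegHom (G : Matrix ι ι E) (hG : IsUnit G)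
    (hskew : F.transpose * G + G * F = 0) (φ : PowerSeries (PowerSeries ℂ)) :
    formNorm N F hF (PowerSeries.map evalNegHom φ) = formNorm N F hF φ := by
  have h1 := congrArg (RingHom.mapMatrix (algebraMap E (PowerSeries E))) hskew
  rw [map_add, map_mul, map_mul, map_zero] at h1
  have h2 := det_nilEval_neg N (F.map (algebraMap E (PowerSeries E)))
    (G.map (algebraMap E (PowerSeries E))) (hG.map (RingHom.mapMatrix _)) h1 (map_pow_eq_zero _ hF)
    (PowerSeries.map (PowerSeries.map (algebraMap ℂ E)) (swapSeries ℂ φ))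
  rw [formNorm_apply, formNorm_apply, ← h2]
  congr 2
  ext m l
  rw [evalNegHom, evalNegHom, coeff_map, coeff_map, coeff_swapSeries, coeff_map, coeff_rescale,
    coeff_rescale, coeff_map, map_mul, ← coeff_swapSeries]
  rw [show ((-1 : PowerSeries E)) ^ m = C ((-1) ^ m) by simp, coeff_C_mul, coeff_map]
  simp

end FormNorm

/-! ### The character of the Witten bundle -/

theorem nilEval_map_algebraMap {E A : Type*} [CommRing E] [Algebra ℂ E] [Ring A] [Algebra ℂ A]
    [Algebra E A] [IsScalarTower ℂ E A] (N : ℕ) (x : A) (h : x ^ (N + 1) = 0) (f : PowerSeries ℂ) :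
    nilEval N x h (PowerSeries.map (algebraMap ℂ E) f) = nilEval N x h f := by
  simp only [nilEval_apply, PowerSeries.coeff_map, algebraMap_smul]

section ThetaCharacter

open PowerSeries

variable {E : Type} [CommRing E] [Algebra ℂ E] [IsAddTorsionFree E] {n : ℕ} (N : ℕ)
  (F : Matrix (Fin n) (Fin n) E) (hF : F ^ (N + 1) = 0)

/-- The product of the square of the character of the Witten bundle and of the determinant of the
quotient of theta functions. -/
theorem map_thetaTwo_sq_mul (G : Matrix (Fin n) (Fin n) E) (hG : IsUnit G)
    (hskew : F.transpose * G + G * F = 0) :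
    PowerSeries.map (virtualTrace (nilEval N F hF (PowerSeries.map (algebraMap ℂ E) (exp ℂ))))
        (thetaTwo n) ^ 2 * formNorm N F hF thetaQuotient =
      C (nilEval N F hF (PowerSeries.map (algebraMap ℂ E) sinhHalf)).det := by
  have h1 := map_thetaTwo (nilEval N F hF (PowerSeries.map (algebraMap ℂ E) (exp ℂ)))
  have h2 := congrArg (formNorm N F hF) thetaQuotient_mul
  have he := formNorm_evenProd N F hF (exp ℂ)
  have ho := formNorm_oddProd N F hF (exp ℂ)
  simp only [powDet] at h1
  rw [← he, ← ho] at h1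
  -- The factors of the theta quotient at e^x and e^{-x} have equal norms, so the quotient involves
  -- the squares of the products in the character.
  have hs := fun φ => formNorm_map_evalNegHom N F hF G hG hskew φ
  have hse := hs (evenProd (exp ℂ))
  have hso := hs (oddProd (exp ℂ))
  rw [map_evenProd] at hse
  rw [map_oddProd] at hso
  simp only [map_mul, map_pow] at h2
  rw [hse, hso, formNorm_C, formNorm_evenProd_one, formNorm_oddProd_one, Fintype.card_fin] at h2
  have u1 : IsUnit (formNorm N F hF (oddProd (exp ℂ))) := (isUnit_oddProd _).map _
  have u2 : IsUnit (evenProd (1 : E) ^ n) := (isUnit_evenProd _).pow _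
  refine ((u1.mul u2).pow 2).mul_left_cancel ?_
  generalize PowerSeries.map (virtualTrace (nilEval N F hF
    (PowerSeries.map (algebraMap ℂ E) (exp ℂ)))) (thetaTwo n) = θ at *
  generalize formNorm N F hF (oddProd (exp ℂ)) = o at *
  generalize formNorm N F hF (evenProd (exp ℂ)) = p at *
  generalize evenProd (1 : E) ^ n = e1 at *
  generalize oddProd (1 : E) ^ n = o1 at *
  generalize formNorm N F hF thetaQuotient = t at *
  linear_combination θ ^ 2 * h2 +
    C (nilEval N F hF (PowerSeries.map (algebraMap ℂ E) sinhHalf)).det *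
      (θ * (p * o1) + e1 * o) * h1

/-- The coefficients of the character of the Witten bundle, twisted by the Â-form, in terms of the
universal solution. -/
theorem theta_character (G : Matrix (Fin n) (Fin n) E) (hG : IsUnit G)
    (hskew : F.transpose * G + G * F = 0) (a : E)
    (ha : a ^ 2 * (nilEval N F hF (PowerSeries.map (algebraMap ℂ E) sinhHalf)).det = 1)
    (π : E →+* ℂ) [IsLocalHom π] (hπ : π a = 1) (Φ : MvPolynomial (Fin 2) E)
    (hΦ : IsNilpotent (Φ - 1)) (hΦ4 : Φ ^ 4 * solutionDet N F hF = 1) :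
    C a * PowerSeries.map (virtualTrace (nilEval N F hF (PowerSeries.map (algebraMap ℂ E) (exp ℂ))))
        (thetaTwo n) =
      MvPolynomial.aeval ![PowerSeries.map (Int.castRingHom E) eightDeltaTwo,
        PowerSeries.map (Int.castRingHom E) epsilonTwo] Φ := by
  set S := PowerSeries.map (virtualTrace (nilEval N F hF
    (PowerSeries.map (algebraMap ℂ E) (exp ℂ)))) (thetaTwo n) with hS
  have h1 := map_thetaTwo_sq_mul N F hF G hG hskew
  rw [← hS] at h1
  have hconst : ∀ f : PowerSeries ℤ, PowerSeries.map (PowerSeries.map (algebraMap ℂ E))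
      (swapSeries ℂ (constSeries f)) = C (PowerSeries.map (Int.castRingHom E) f) := fun f => by
    have : constSeries f = PowerSeries.map C (PowerSeries.map (Int.castRingHom ℂ) f) := by
      ext; simp [constSeries]
    rw [this, swapSeries_map_C, map_C]
    congr 1
    ext; simp
  have hder : ∀ f : PowerSeries (PowerSeries ℂ), PowerSeries.map (PowerSeries.map (algebraMap ℂ E))
      (derivative (PowerSeries ℂ) f) = derivative (PowerSeries E)
        (PowerSeries.map (PowerSeries.map (algebraMap ℂ E)) f) := fun f => by
    ext m l
    simp [coeff_derivative]
  have hode := congrArg (fun f => PowerSeries.map (PowerSeries.map (algebraMap ℂ E)) (swapSeries ℂ f))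
    thetaQuotient_ode
  have hX : PowerSeries.map (PowerSeries.map (algebraMap ℂ E)) (swapSeries ℂ (C X)) = X := by
    rw [swapSeries_C, map_X, map_X]
  set T := PowerSeries.map (PowerSeries.map (algebraMap ℂ E)) (swapSeries ℂ thetaQuotient) with hT
  have h2 : ∀ m : ℕ, ∀ [m.AtLeastTwo], PowerSeries.map (PowerSeries.map (algebraMap ℂ E))
      (swapSeries ℂ (OfNat.ofNat m)) = OfNat.ofNat m := fun m _ => by
    rw [map_ofNat, map_ofNat]
  simp only [swapSeries_derivative, hder, map_add, map_sub, map_mul, map_pow, hX, hconst, h2] at hode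
  rw [← hT] at hode
  have h3 := eval_solutionDet N F hF (PowerSeries.map (Int.castRingHom E) eightDeltaTwo)
    (PowerSeries.map (Int.castRingHom E) epsilonTwo) (T ^ 2) (by
      rw [← mul_pow, hode])
  -- The solution is the square of the theta quotient and the character enters as a square as well;
  -- hence the fourth power.
  have h4 : (nilEval N (F.map (algebraMap E (PowerSeries E))) (map_pow_eq_zero _ hF) (T ^ 2)).det =
      formNorm N F hF thetaQuotient ^ 2 := by
    rw [map_pow, Matrix.det_pow, formNorm_apply]
  rw [h4] at h3
  have h5 := congrArg (MvPolynomial.aeval ![PowerSeries.map (Int.castRingHom E) eightDeltaTwo,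
        PowerSeries.map (Int.castRingHom E) epsilonTwo]) hΦ4
  rw [map_mul, map_pow, h3, map_one] at h5
  set V := MvPolynomial.aeval ![PowerSeries.map (Int.castRingHom E) eightDeltaTwo,
        PowerSeries.map (Int.castRingHom E) epsilonTwo] Φ with hV
  have ha' := congrArg (C (R := E)) ha
  rw [map_mul, map_pow, map_one, ← h1] at ha'
  have hnil : IsNilpotent (V - 1) := by
    have := hΦ.map (MvPolynomial.aeval ![PowerSeries.map (Int.castRingHom E) eightDeltaTwo,
        PowerSeries.map (Int.castRingHom E) epsilonTwo])
    rwa [map_sub, map_one] at this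
  have hπV : π (constantCoeff V) = 1 := by
    have := (hnil.map (π.comp constantCoeff)).eq_zero
    rw [map_sub, map_one, sub_eq_zero] at this
    exact this
  have : IsLocalHom (π.comp (constantCoeff (R := E))) :=
    ⟨fun f hf => isUnit_iff_constantCoeff.2 (IsUnit.of_map π _ hf)⟩
  have ht : IsUnit (formNorm N F hF thetaQuotient ^ 2) :=
    IsUnit.of_mul_eq_one (V ^ 4) (by rw [mul_comm]; exact h5)
  -- Both sides are fourth roots of the inverse of the same unit and have value 1 at q = 0 in form
  -- degree 0.
  refine eq_of_pow_four_eq (π.comp (constantCoeff (R := E))) (ht.mul_left_cancel ?_) ?_ ?_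
  · have : (C a * S) ^ 2 * formNorm N F hF thetaQuotient = 1 := by rw [← ha']; ring
    rw [mul_comm _ (V ^ 4), h5]
    linear_combination ((C a * S) ^ 2 * formNorm N F hF thetaQuotient + 1) * this
  · rw [RingHom.comp_apply, RingHom.comp_apply, hπV, map_mul, constantCoeff_C, hS,
      ← coeff_zero_eq_constantCoeff_apply, coeff_map, coeff_zero_eq_constantCoeff_apply,
      constantCoeff_thetaTwo, map_one, mul_one, hπ]
  · rw [RingHom.comp_apply, hπV]; exact one_ne_zero

end ThetaCharacter

/-! ### The character of the L-form -/

section HyperbolicSeries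

open PowerSeries

/-- `cosh (x / 2)`. -/
def coshHalf : PowerSeries ℂ := rescale (1 / 2) coshSeries

theorem expHalf_add_inv : (expHalf : PowerSeries ℂ) + ((expHalf⁻¹ : (PowerSeries ℂ)ˣ) : PowerSeries ℂ) =
    2 * coshHalf := by
  ext n
  rw [map_add, coeff_expHalf, coeff_expHalf_inv, ← map_ofNat C 2, coeff_C_mul, coshHalf,
    coeff_rescale, coshSeries, coeff_mk]
  split_ifs with h
  · rw [Even.neg_pow h]; ring
  · rw [Odd.neg_pow (Nat.not_even_iff_odd.1 h)]; ring

theorem coshHalf_sq : 4 * coshHalf ^ 2 = 4 + (X * sinhHalf) ^ 2 := by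
  have h := Units.mul_inv expHalf
  linear_combination (-(2 * coshHalf) - expHalf - ((expHalf⁻¹ : (PowerSeries ℂ)ˣ) : PowerSeries ℂ)) *
    expHalf_add_inv + (X * sinhHalf + expHalf - ((expHalf⁻¹ : (PowerSeries ℂ)ˣ) : PowerSeries ℂ)) *
    expHalf_sub_inv + 4 * h

theorem X_mul_sinhHalf_sq : (X * sinhHalf) ^ 2 = exp ℂ + evalNegHom (exp ℂ) - 2 := by
  rw [← expHalf_inv_sq, ← expHalf_sq, ← expHalf_sub_inv]
  linear_combination (-2) * Units.mul_inv expHalf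

theorem derivative_expHalf_inv : derivative ℂ ((expHalf⁻¹ : (PowerSeries ℂ)ˣ) : PowerSeries ℂ) =
    -((1 / 2 : ℂ) • ((expHalf⁻¹ : (PowerSeries ℂ)ˣ) : PowerSeries ℂ)) := by
  have h := congrArg (derivative ℂ) (Units.mul_inv expHalf)
  rw [Derivation.leibniz, Derivation.map_one_eq_zero, derivative_expHalf] at h
  refine expHalf.isUnit.mul_left_cancel ?_
  rw [smul_eq_mul, smul_eq_mul] at h
  rw [eq_neg_of_add_eq_zero_left h]
  simp only [mul_smul_comm, mul_neg, Units.inv_mul, Units.mul_inv]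

theorem derivative_X_mul_sinhHalf : derivative ℂ (X * sinhHalf) = coshHalf := by
  have h2 : (2 : PowerSeries ℂ) = C 2 := (map_ofNat C 2).symm
  rw [← expHalf_sub_inv, map_sub, derivative_expHalf, derivative_expHalf_inv, sub_neg_eq_add,
    ← smul_add, expHalf_add_inv, h2, ← smul_eq_C_mul, smul_smul]
  norm_num

theorem derivative_coshHalf : 4 * derivative ℂ coshHalf = X * sinhHalf := by
  have h2 : (2 : PowerSeries ℂ) = C 2 := (map_ofNat C 2).symm
  have h := congrArg (derivative ℂ) expHalf_add_inv
  rw [map_add, derivative_expHalf, derivative_expHalf_inv, ← sub_eq_add_neg, ← smul_sub,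
    expHalf_sub_inv, h2, ← smul_eq_C_mul, Derivation.map_smul] at h
  rw [← map_ofNat C 4, ← smul_eq_C_mul, show (4 : ℂ) = 2 * 2 by norm_num, mul_smul, ← h, smul_smul]
  norm_num

theorem constantCoeff_coshHalf : constantCoeff coshHalf = 1 := by
  rw [← coeff_zero_eq_constantCoeff_apply, coshHalf, coeff_rescale, coshSeries, coeff_mk]; simp

theorem constantCoeff_sinhDivSeries : constantCoeff sinhDivSeries = 1 := by
  rw [← coeff_zero_eq_constantCoeff_apply, sinhDivSeries, coeff_mk]; simp

/-- `tanh (x / 2)`. -/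
def tanhHalf : PowerSeries ℂ := C (1 / 2) * (X * sinhHalf) * coshHalf⁻¹

theorem tanhHalf_mul : 2 * (tanhHalf * coshHalf) = X * sinhHalf := by
  have h : coshHalf⁻¹ * coshHalf = 1 :=
    PowerSeries.inv_mul_cancel _ (by rw [constantCoeff_coshHalf]; exact one_ne_zero)
  rw [tanhHalf, mul_assoc, h, mul_one, ← mul_assoc, ← map_ofNat C 2, ← map_mul]
  norm_num

theorem isUnit_coshHalf : IsUnit coshHalf :=
  isUnit_iff_constantCoeff.2 (by rw [constantCoeff_coshHalf]; exact isUnit_one)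

theorem derivative_tanhHalf : 2 * derivative ℂ tanhHalf = 1 - tanhHalf ^ 2 := by
  have h := congrArg (derivative ℂ) tanhHalf_mul
  rw [derivative_X_mul_sinhHalf, ← map_ofNat C 2, ← smul_eq_C_mul, Derivation.map_smul,
    Derivation.leibniz, smul_eq_C_mul, map_ofNat, smul_eq_mul, smul_eq_mul] at h
  refine isUnit_coshHalf.mul_left_cancel (isUnit_coshHalf.mul_left_cancel ?_)
  have h4 : IsUnit (2 : PowerSeries ℂ) := by
    rw [← map_ofNat C 2]; exact (isUnit_iff_ne_zero.2 two_ne_zero).map C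
  refine h4.mul_left_cancel ?_
  linear_combination 2 * coshHalf * h - tanhHalf * coshHalf * derivative_coshHalf +
    tanhHalf * coshHalf * tanhHalf_mul

/-- `sinh² (x / 2)`. -/
def sinhHalfSq : PowerSeries ℂ := C (1 / 4) * (X * sinhHalf) ^ 2

theorem four_mul_sinhHalfSq : 4 * sinhHalfSq = (X * sinhHalf) ^ 2 := by
  rw [sinhHalfSq, ← mul_assoc, ← map_ofNat C 4, ← map_mul]; norm_num

theorem one_add_sinhHalfSq : 1 + sinhHalfSq = coshHalf ^ 2 := by
  have h4 : IsUnit (4 : PowerSeries ℂ) := by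
    rw [← map_ofNat C 4]; exact (isUnit_iff_ne_zero.2 (by norm_num)).map C
  refine h4.mul_left_cancel ?_
  linear_combination four_mul_sinhHalfSq - coshHalf_sq

theorem sinhHalfSq_eq : sinhHalfSq = tanhHalf ^ 2 * (1 + sinhHalfSq) := by
  have h4 : IsUnit (4 : PowerSeries ℂ) := by
    rw [← map_ofNat C 4]; exact (isUnit_iff_ne_zero.2 (by norm_num)).map C
  refine h4.mul_left_cancel ?_
  rw [four_mul_sinhHalfSq, one_add_sinhHalfSq, ← tanhHalf_mul]
  ring

theorem derivative_sinhHalfSq : derivative ℂ sinhHalfSq = tanhHalf * (1 + sinhHalfSq) := by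
  have h2 : IsUnit (2 : PowerSeries ℂ) := by
    rw [← map_ofNat C 2]; exact (isUnit_iff_ne_zero.2 two_ne_zero).map C
  refine h2.mul_left_cancel ?_
  rw [one_add_sinhHalfSq, sinhHalfSq, ← smul_eq_C_mul, Derivation.map_smul, Derivation.leibniz_pow,
    derivative_X_mul_sinhHalf, smul_eq_C_mul, Nat.add_sub_cancel_left 1 1, pow_one, nsmul_eq_mul,
    smul_eq_mul]
  have h4 : 4 * C (1 / 4 : ℂ) = 1 := by rw [← map_ofNat C 4, ← map_mul]; norm_num
  push_cast
  linear_combination X * sinhHalf * coshHalf * h4 - coshHalf * tanhHalf_mul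

theorem rescale_aHatSeries_mul : rescale (1 / 2) aHatSeries * sinhHalf = 1 := by
  rw [sinhHalf, aHatSeries, ← map_mul, PowerSeries.inv_mul_cancel _
    (by rw [constantCoeff_sinhDivSeries]; exact one_ne_zero), map_one]

theorem rescale_lHatSeries_mul : rescale (1 / 2) lHatSeries * sinhHalf = 2 * coshHalf := by
  rw [sinhHalf, lHatSeries, coshHalf, ← map_mul, mul_assoc, PowerSeries.inv_mul_cancel _
    (by rw [constantCoeff_sinhDivSeries]; exact one_ne_zero), mul_one, map_mul, map_ofNat, map_ofNat]

end HyperbolicSeries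

/-! ### The first-order deformation of the L-form -/

section TanhCharacter

open PowerSeries

/-- Skewness gives f(Fᵀ) G = G f(-F): the matrix f(-F) is conjugate to the transpose of f(F). -/
theorem trace_nilEval_neg {S : Type*} [CommRing S] {ι : Type*} [Fintype ι] [DecidableEq ι]
    (N : ℕ) (F G : Matrix ι ι S) (hG : IsUnit G) (hF : F.transpose * G + G * F = 0)
    (h : F ^ (N + 1) = 0) (f : PowerSeries S) :
    (nilEval N F h (evalNegHom f)).trace = (nilEval N F h f).trace := by
  have h1 : F.transpose ^ (N + 1) = 0 := by rw [← Matrix.transpose_pow, h, Matrix.transpose_zero]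
  have h2 : ((-1 : S) • F) ^ (N + 1) = 0 := by rw [smul_pow, h, smul_zero]
  have h3 : SemiconjBy G ((-1 : S) • F) F.transpose := by
    rw [SemiconjBy, neg_one_smul, mul_neg]
    exact (eq_neg_of_add_eq_zero_left hF).symm
  have h4 : nilEval N F.transpose h1 f * G = G * nilEval N ((-1 : S) • F) h2 f := by
    simp only [nilEval_apply, Finset.sum_mul, Finset.mul_sum, smul_mul_assoc, mul_smul_comm,
      (h3.pow_right _).eq]
  obtain ⟨G', rfl⟩ := hG
  rw [evalNegHom, nilEval_rescale N F h (-1) h2, ← Matrix.trace_transpose (nilEval N F h f),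
    nilEval_transpose N F h h1, ← Units.mul_inv_cancel_right (nilEval N F.transpose h1 f) G', h4,
    mul_assoc, Matrix.trace_mul_comm, mul_assoc, Units.inv_mul, mul_one]

theorem det_one_add_smul_of_sq_eq_zero {S : Type*} [CommRing S] {ι : Type*} [Fintype ι]
    [DecidableEq ι] (η : S) (hη : η ^ 2 = 0) (A : Matrix ι ι S) :
    (1 + η • A).det = 1 + η * A.trace := by
  rw [Matrix.det_one_add_smul, hη, mul_zero, add_zero, mul_comm]

variable {E : Type} [CommRing E] [Algebra ℂ E] {n : ℕ} (N : ℕ)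
  (F : Matrix (Fin n) (Fin n) E) (hF : F ^ (N + 1) = 0)

/-- From 4 sinh²(x/2) = e^x + e^{-x} - 2, where both exponentials have the same trace. This is how
ch(T_ℂM) enters the deformed L-form. -/
theorem trace_nilEval_sinhHalfSq (G : Matrix (Fin n) (Fin n) E) (hG : IsUnit G)
    (hskew : F.transpose * G + G * F = 0) :
    2 * (nilEval N F hF (PowerSeries.map (algebraMap ℂ E) sinhHalfSq)).trace =
      (nilEval N F hF (PowerSeries.map (algebraMap ℂ E) (exp ℂ))).trace - n := by
  have h := congrArg (fun f => (nilEval N F hF (PowerSeries.map (algebraMap ℂ E) f)).trace)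
    (four_mul_sinhHalfSq.trans X_mul_sinhHalf_sq)
  have h1 : PowerSeries.map (algebraMap ℂ E) (evalNegHom (exp ℂ)) =
      evalNegHom (PowerSeries.map (algebraMap ℂ E) (exp ℂ)) := by
    ext m
    simp [evalNegHom, coeff_rescale]
  have h4 : ∀ (m : ℕ) [m.AtLeastTwo], nilEval N F hF (PowerSeries.map (algebraMap ℂ E)
      (OfNat.ofNat m)) = (OfNat.ofNat m : ℕ) • (1 : Matrix (Fin n) (Fin n) E) := fun m _ => by
    rw [map_ofNat, map_ofNat, nsmul_eq_mul, mul_one]; rfl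
  simp only [map_mul, map_sub, map_add, h1, h4, Matrix.trace_sub, Matrix.trace_add,
    Matrix.trace_smul, smul_mul_assoc, one_mul, trace_nilEval_neg N F G hG hskew, Matrix.trace_one,
    Fintype.card_fin] at h
  simp only [nsmul_eq_mul] at h
  have h2 : IsUnit (2 : E) := by
    have : IsUnit (algebraMap ℂ E 2) := (isUnit_iff_ne_zero.2 (by norm_num)).map _
    rwa [map_ofNat] at this
  refine h2.mul_left_cancel ?_
  push_cast at h
  linear_combination h

/-- The L-form together with the twisted L-form in terms of the universal solution. -/
theorem tanh_character (G : Matrix (Fin n) (Fin n) E) (hG : IsUnit G)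
    (hskew : F.transpose * G + G * F = 0) (ℓ : E)
    (hℓ : ℓ ^ 2 = (nilEval N F hF
      (PowerSeries.map (algebraMap ℂ E) (rescale (1 / 2) lHatSeries))).det)
    {S : Type*} [CommRing S] [Algebra E S] [Algebra ℂ S] [IsScalarTower ℂ E S] (η : S)
    (hη : η ^ 2 = 0) (π : S →+* ℂ) [IsLocalHom π] (κ : ℂ) (hκ : κ ^ 4 = 4 ^ n)
    (hπ : π (algebraMap E S ℓ) = π (algebraMap ℂ S κ)) (Φ : MvPolynomial (Fin 2) E)
    (hΦ : IsNilpotent (Φ - 1)) (hΦ4 : Φ ^ 4 * solutionDet N F hF = 1) :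
    algebraMap E S ℓ * (1 + 2 * η * algebraMap E S
        ((nilEval N F hF (PowerSeries.map (algebraMap ℂ E) (exp ℂ))).trace - n)) =
      algebraMap ℂ S κ *
        MvPolynomial.aeval ![2 + 48 * η, algebraMap ℂ S (1 / 16) - η] Φ := by
  set m : PowerSeries ℂ →+* PowerSeries S := PowerSeries.map (algebraMap ℂ S) with hm
  have hD : ∀ f, derivative S (m f) = m (derivative ℂ f) := fun f => by
    ext l
    simp [hm, coeff_derivative]
  have hmE : ∀ f, m f = PowerSeries.map (algebraMap E S) (PowerSeries.map (algebraMap ℂ E) f) :=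
    fun f => by
      ext l
      rw [hm, coeff_map, coeff_map, coeff_map, IsScalarTower.algebraMap_apply ℂ E S]
  have hev : ∀ f, nilEval N (F.map (algebraMap E S)) (map_pow_eq_zero _ hF) (m f) =
      (nilEval N F hF (PowerSeries.map (algebraMap ℂ E) f)).map (algebraMap E S) := fun f => by
    rw [hmE, map_nilEval _ _ _ _ (map_pow_eq_zero _ hF)]
  have hode := tanh_ode (derivative S) (m tanhHalf) (m sinhHalfSq) (C η)
    (C (algebraMap ℂ S (1 / 16) - η))
    (by rw [hD, ← map_ofNat m 2, ← map_mul, derivative_tanhHalf]; simp)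
    (by rw [hD, derivative_sinhHalfSq]; simp)
    (by rw [← map_one m, ← map_add, ← map_pow, ← map_mul, ← sinhHalfSq_eq])
    (by rw [← map_pow, hη, map_zero])
    (by
      rw [← mul_one (C η), ← smul_eq_C_mul, Derivation.map_smul, Derivation.map_one_eq_zero,
        smul_zero])
    (by
      rw [← map_ofNat C 16, ← map_mul, ← map_mul, ← map_one C, ← map_sub, mul_sub,
        ← map_ofNat (algebraMap ℂ S) 16, ← map_mul]
      norm_num)
  -- G₀ = 4 tanh²(x/2) / x² is the undeformed solution divided by x², and G₁ its deformation.
  set G₀ : PowerSeries ℂ := sinhHalf ^ 2 * (coshHalf⁻¹) ^ 2 with hG₀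
  set G₁ : PowerSeries S := m G₀ * (1 - 16 * C η * m sinhHalfSq) with hG₁
  have h1 : 4 * m tanhHalf ^ 2 * (1 - 16 * C η * m sinhHalfSq) = X ^ 2 * G₁ := by
    have : 4 * tanhHalf ^ 2 = X ^ 2 * G₀ := by
      have h4 : 4 * C (1 / 2 : ℂ) ^ 2 = 1 := by
        rw [← map_ofNat C 4, ← map_pow, ← map_mul]; norm_num
      rw [tanhHalf, hG₀]
      linear_combination (X * sinhHalf * coshHalf⁻¹) ^ 2 * h4
    rw [hG₁, ← mul_assoc, ← map_ofNat m 4, ← map_pow, ← map_mul, this, map_mul, map_pow, hm, map_X]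
  rw [h1] at hode
  have h2 := eval_solutionDet N F hF (2 + 48 * η) (algebraMap ℂ S (1 / 16) - η) G₁ (by
    rw [hode, map_add C 2, map_mul C 48, map_ofNat, map_ofNat])
  set ch := (nilEval N F hF (PowerSeries.map (algebraMap ℂ E) (exp ℂ))).trace with hch
  have h3 : (nilEval N (F.map (algebraMap E S)) (map_pow_eq_zero _ hF)
      (1 - 16 * C η * m sinhHalfSq)).det = 1 - 8 * η * algebraMap E S (ch - n) := by
    rw [map_sub, map_one, ← map_ofNat C 16, ← map_mul, map_mul, nilEval_C, hev, ← Algebra.smul_def,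
      sub_eq_add_neg, ← neg_smul, ← neg_mul, mul_comm, mul_smul,
      det_one_add_smul_of_sq_eq_zero η hη, ← trace_nilEval_sinhHalfSq N F hF G hG hskew,
      Matrix.trace_smul, ← AddMonoidHom.map_trace (algebraMap E S)]
    simp only [map_mul, map_ofNat, smul_eq_mul]
    ring_nf
  -- The square of the series of L̂² times G₀ is the constant 4, whose determinant is 4ⁿ = κ⁴.
  have h4 : algebraMap E S ℓ ^ 4 * (nilEval N (F.map (algebraMap E S)) (map_pow_eq_zero _ hF)
      (m G₀)).det = algebraMap ℂ S κ ^ 4 := by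
    have e1 : rescale (1 / 2) lHatSeries ^ 2 * G₀ = C 4 := by
      have hi : coshHalf * coshHalf⁻¹ = 1 :=
        PowerSeries.mul_inv_cancel _ (by rw [constantCoeff_coshHalf]; exact one_ne_zero)
      rw [hG₀, ← mul_assoc, ← mul_pow, rescale_lHatSeries_mul, ← mul_pow, mul_assoc, hi, mul_one,
        map_ofNat]
      norm_num
    have e2 := congrArg (fun f => (nilEval N F hF (PowerSeries.map (algebraMap ℂ E) f)).det) e1
    simp only [map_mul, map_pow, Matrix.det_mul, Matrix.det_pow] at e2
    rw [← hℓ, map_C, nilEval_C, Matrix.algebraMap_eq_diagonal, Matrix.det_diagonal] at e2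
    simp only [Pi.algebraMap_apply, Finset.prod_const, Finset.card_univ, Fintype.card_fin,
      Algebra.algebraMap_self, RingHom.id_apply] at e2
    have e3 : ((nilEval N F hF (PowerSeries.map (algebraMap ℂ E) G₀)).map (algebraMap E S)).det =
        algebraMap E S (nilEval N F hF (PowerSeries.map (algebraMap ℂ E) G₀)).det :=
      (RingHom.map_det _ _).symm
    rw [hev, e3, ← map_pow, ← map_mul, ← map_pow, hκ, IsScalarTower.algebraMap_apply ℂ E S,
      map_pow (algebraMap ℂ E), ← e2]
    ring_nf
  set V := MvPolynomial.aeval ![2 + 48 * η, algebraMap ℂ S (1 / 16) - η] Φ with hV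
  have h5 := congrArg (MvPolynomial.aeval ![2 + 48 * η, algebraMap ℂ S (1 / 16) - η]) hΦ4
  rw [map_mul, map_pow, h2, map_one, ← hV, hG₁, map_mul, Matrix.det_mul, h3] at h5
  have hnil : IsNilpotent (V - 1) := by
    have := hΦ.map (MvPolynomial.aeval ![2 + 48 * η, algebraMap ℂ S (1 / 16) - η])
    rwa [map_sub, map_one] at this
  have hπV : π V = 1 := by
    have := (hnil.map π).eq_zero
    rwa [map_sub, map_one, sub_eq_zero] at this
  have hπη : π η = 0 := by
    have := (IsNilpotent.map ⟨2, hη⟩ π : IsNilpotent (π η))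
    exact this.eq_zero
  have hκ0 : κ ≠ 0 := by
    rintro rfl
    rw [zero_pow four_ne_zero] at hκ
    exact pow_ne_zero n (by norm_num) hκ.symm
  set d := (nilEval N (F.map (algebraMap E S)) (map_pow_eq_zero _ hF) (m G₀)).det with hd
  set y := algebraMap E S (ch - n) with hy
  have hu : IsUnit (d * (1 - 8 * η * y)) := IsUnit.of_mul_eq_one (V ^ 4) (by rw [mul_comm]; exact h5)
  refine eq_of_pow_four_eq π (hu.mul_left_cancel ?_) ?_ ?_
  · have e4 : (1 + 2 * η * y) ^ 4 * (1 - 8 * η * y) = 1 := by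
      linear_combination (24 * y ^ 2 + 32 * y ^ 3 * η + 16 * y ^ 4 * η ^ 2 - 64 * y ^ 2
        - 192 * y ^ 3 * η - 256 * y ^ 4 * η ^ 2 - 128 * y ^ 5 * η ^ 3) * hη
    linear_combination (1 + 2 * η * y) ^ 4 * (1 - 8 * η * y) * h4 + algebraMap ℂ S κ ^ 4 * e4 -
      algebraMap ℂ S κ ^ 4 * h5
  · rw [map_mul, map_mul, hπ, hπV, map_add, map_mul, map_mul, hπη, map_one, mul_zero, zero_mul,
      add_zero]
  · rw [map_mul, hπV, mul_one]
    exact ((isUnit_iff_ne_zero.2 hκ0).map (π.comp (algebraMap ℂ S))).ne_zero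

end TanhCharacter

/-! ### The Chern character -/

section FirstCoefficient

open PowerSeries

variable {R : Type} [CommRing R] {N : ℕ} (B : Matrix (Fin N) (Fin N) R)

theorem coeff_one_powDet_one : coeff 1 (powDet B 1) = -B.trace := by
  rw [powDet, pow_one, sub_eq_add_neg, ← neg_smul, Matrix.det_one_add_smul,
    show ((-X : PowerSeries R)) ^ 2 = X * X by ring, ← mul_assoc, map_add, map_add,
    coeff_one_mul (_ * X) X, coeff_one, mul_neg, map_neg,
    show (1 : ℕ) = 0 + 1 from rfl, coeff_succ_mul_X, ← AddMonoidHom.map_trace (C (R := R))]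
  simp

theorem coeff_one_infiniteProduct (f : ℕ → PowerSeries R) :
    coeff 1 (infiniteProduct f) = coeff 1 (f 0) := by
  rw [infiniteProduct, coeff_mk, Finset.prod_range_one]

theorem bundleB_zero : bundleB N 0 = 1 := by
  rw [bundleB, coeff_zero_eq_constantCoeff_apply, constantCoeff_thetaTwo]

/-- At order q^{1/2} only Λ_{-q^{1/2}} of the reduced bundle contributes, so B₁ is minus the reduced
bundle. -/
theorem virtualTrace_bundleB_one [IsAddTorsionFree R] :
    virtualTrace B (bundleB N 1) = N - B.trace := by
  have h := congrArg (coeff 1) (map_thetaTwo B)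
  have h2 : coeff 1 (powDet B 2) = 0 := by
    have := modX_eq_iff.1 ((modX_powDet B (le_refl 2)).trans (map_one _).symm) 1 one_lt_two
    rw [this, coeff_one, if_neg one_ne_zero]
  have he : coeff 1 (evenProd (1 : R)) = 0 := by
    rw [evenProd, coeff_one_infiniteProduct, map_sub, coeff_one, map_one, mul_one, coeff_X_pow]
    simp
  have ho : coeff 1 (oddProd (1 : R)) = -1 := by
    rw [oddProd, coeff_one_infiniteProduct, map_sub, coeff_one, map_one, mul_one, coeff_X_pow]
    simp
  have ce : constantCoeff (evenProd (1 : R)) = 1 := constantCoeff_infiniteProduct _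
  have co : constantCoeff (oddProd (1 : R)) = 1 := constantCoeff_infiniteProduct _
  have cθ : constantCoeff (PowerSeries.map (virtualTrace B) (thetaTwo N)) = 1 := by
    rw [← coeff_zero_eq_constantCoeff_apply, coeff_map, coeff_zero_eq_constantCoeff_apply,
      constantCoeff_thetaTwo, map_one]
  rw [coeff_one_mul, coeff_one_mul, coeff_one_mul, coeff_one_pow, coeff_one_pow, he, ho,
    coeff_one_infiniteProduct, coeff_one_infiniteProduct, map_mul, map_pow, map_pow, ce, co, cθ,
    constantCoeff_infiniteProduct, constantCoeff_infiniteProduct, coeff_map] at h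
  simp only [mul_zero, zero_add, mul_one, coeff_one_powDet_one, h2, one_pow] at h
  rw [bundleB]
  linear_combination h

end FirstCoefficient

theorem nilEval_zero {S A : Type*} [CommRing S] [Ring A] [Algebra S A] (N : ℕ)
    (h : (0 : A) ^ (N + 1) = 0) (f : PowerSeries S) :
    nilEval N 0 h f = algebraMap S A (PowerSeries.constantCoeff f) := by
  rw [nilEval_apply, Finset.sum_range_succ', Finset.sum_eq_zero (fun m _ => by simp)]
  simp [Algebra.smul_def]

theorem curvature_mem {n : ℕ} {M : Type*} [TopologicalSpace M]
    [ChartedSpace (EuclideanSpace ℝ (Fin n)) M]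
    (e : OpenPartialHomeomorph M (EuclideanSpace ℝ (Fin n))) (B : LocalBundle n) (x : M) (i j : B.idx) :
    curvature e B x i j ∈ evenGrading (Covector n x) 2 := by
  rw [curvature, Matrix.of_apply]
  exact Submodule.sum_mem _ fun _ _ => Submodule.sum_mem _ fun _ _ =>
    Submodule.smul_mem _ _ (wedge_mem_evenGrading _ _)

/-! ### Characteristic forms as determinants and traces of series in √-1/(2π) R -/

section Geometry

variable {n : ℕ} {M : Type*} [TopologicalSpace M] [ChartedSpace (EuclideanSpace ℝ (Fin n)) M]
  [IsManifold (𝓡 n) ∞ M]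
variable (g : RiemannianMetricOn n M) (e : OpenPartialHomeomorph M (EuclideanSpace ℝ (Fin n)))

/-- The form `√-1/(2π) R`. -/
def chernMatrix (x : M) : Matrix (Fin n) (Fin n) (EvenForms (Covector n x)) :=
  (Complex.I / (2 * Real.pi)) • tangentCurvatureForm g e x

theorem chernMatrix_mem (x : M) (i j : Fin n) :
    chernMatrix g e x i j ∈ evenGrading (Covector n x) 2 :=
  Submodule.smul_mem _ _ (tangentCurvatureForm_mem g e x i j)

theorem chernMatrix_pow (x : M) : chernMatrix g e x ^ (n + 1) = 0 :=
  matrix_pow_eq_zero (finrank_covector x).le (chernMatrix_mem g e x)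

theorem chernMatrix_skew (he : e ∈ IsManifold.maximalAtlas (𝓡 n) ∞ M) {x : M} (hx : x ∈ e.source) :
    (chernMatrix g e x).transpose * metricForm g e x + metricForm g e x * chernMatrix g e x = 0 := by
  rw [chernMatrix, Matrix.transpose_smul, smul_mul_assoc, mul_smul_comm, ← smul_add,
    tangentCurvatureForm_skew g e he hx, smul_zero]

/-- The value of a power series at `√-1/(2π) R`. -/
def chernEval (x : M) (f : PowerSeries ℂ) : Matrix (Fin n) (Fin n) (EvenForms (Covector n x)) :=
  nilEval n (chernMatrix g e x) (chernMatrix_pow g e x)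
    (PowerSeries.map (algebraMap ℂ (EvenForms (Covector n x))) f)

/-- The curvature of the induced connection is `lin` of the curvature, and `act_exp` exchanges the
exponential with the functor. -/
theorem chForm_of_functor (he : e ∈ IsManifold.maximalAtlas (𝓡 n) ∞ M) {x : M} (hx : x ∈ e.source)
    (B : LocalBundle n) (ρ : MatrixFunctor (Fin n) B.idx)
    (hB : ∀ z k, B.conn z k = ρ.lin ℂ (leviCivita g e z k)) :
    chForm e B x = (ρ.act _ (chernEval g e x (PowerSeries.exp ℂ))).trace := by
  have h1 : (Complex.I / (2 * Real.pi)) • curvature e B x =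
      ρ.lin (EvenForms (Covector n x)) (chernMatrix g e x) := by
    rw [curvature_of_functor g e he hx B ρ hB, chernMatrix,
      ← algebraMap_smul (EvenForms (Covector n x)) (Complex.I / (2 * Real.pi) : ℂ)
        (tangentCurvatureForm g e x), map_smul, algebraMap_smul]
  have h2 : ρ.lin (EvenForms (Covector n x)) (chernMatrix g e x) ^ (n + 1) = 0 := by
    rw [← h1]
    exact matrix_pow_eq_zero (finrank_covector x).le fun i j =>
      Submodule.smul_mem _ _ (curvature_mem e B x i j)
  rw [chForm, h1, evalNilpotent_eq_nilEval n _ h2,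
    ← nilEval_map_algebraMap (E := EvenForms (Covector n x)), chernEval, PowerSeries.map_exp,
    ρ.act_exp n _ (chernMatrix_pow g e x) h2]

theorem powerTrace_eq {R : Type} [CommRing R] (A : Matrix (Fin n) (Fin n) R) (a : PowerName) :
    ((powerFunctor g e a).act R A).trace = powerTrace A a := by
  cases a <;> rfl

theorem chVirtual_eq (he : e ∈ IsManifold.maximalAtlas (𝓡 n) ∞ M) {x : M} (hx : x ∈ e.source)
    (b : VirtualBundle) :
    chVirtual g e b x = virtualTrace (chernEval g e x (PowerSeries.exp ℂ)) b := by
  rw [chVirtual, virtualTrace_apply]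
  refine Finsupp.sum_congr fun w _ => ?_
  rw [chForm_of_functor g e he hx _ (tensorFunctor g e w) (conn_tensorBundle g e w),
    trace_tensorFunctor]
  simp only [powerTrace_eq]

theorem chTangent_eq (x : M) :
    chTangent g e x = (chernEval g e x (PowerSeries.exp ℂ)).trace := by
  have h : chTangent g e x = (evalNilpotent n (PowerSeries.exp ℂ) (chernMatrix g e x)).trace := by
    rw [chernMatrix, ← curvature_tangentC]; rfl
  rw [h, evalNilpotent_eq_nilEval n _ (chernMatrix_pow g e x), chernEval, nilEval_map_algebraMap]

theorem constantTermHom_chernMatrix (x : M) :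
    (chernMatrix g e x).map (constantTermHom (W := Covector n x)).toRingHom = 0 := by
  ext1 i j
  exact constantTermHom_eq_zero (Submodule.subset_span ⟨2, one_le_two, chernMatrix_mem g e x i j⟩)

/-- The entries of F are 2-forms, so the constant term reduces f(F) to the scalar matrix f(0). -/
theorem constantTermHom_det_chernEval (x : M) (f : PowerSeries ℂ) :
    constantTermHom (chernEval g e x f).det = PowerSeries.constantCoeff f ^ n := by
  have h0 : (chernMatrix g e x).map (constantTermHom (W := Covector n x)).toRingHom ^ (n + 1) = 0 :=
    by rw [constantTermHom_chernMatrix, zero_pow n.succ_ne_zero]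
  have h1 := map_nilEval (constantTermHom (W := Covector n x)).toRingHom n (chernMatrix g e x)
    (chernMatrix_pow g e x) h0 (PowerSeries.map (algebraMap ℂ (EvenForms (Covector n x))) f)
  have h2 : PowerSeries.map (constantTermHom (W := Covector n x)).toRingHom
      (PowerSeries.map (algebraMap ℂ (EvenForms (Covector n x))) f) = f := by
    ext m
    rw [PowerSeries.coeff_map, PowerSeries.coeff_map]
    exact constantTermHom.commutes _
  simp only [constantTermHom_chernMatrix, nilEval_zero] at h1
  rw [h2] at h1
  refine (RingHom.map_det (constantTermHom (W := Covector n x)).toRingHom _).trans ?_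
  rw [RingHom.mapMatrix_apply, chernEval, h1, Matrix.algebraMap_eq_diagonal, Matrix.det_diagonal]
  simp

theorem det_evalNilpotent_half (x : M) (f : PowerSeries ℂ) :
    Matrix.det (evalNilpotent n f
      ((Complex.I / (4 * Real.pi)) • curvature e (tangentC g e) x)) =
      (chernEval g e x (PowerSeries.rescale (1 / 2) f)).det := by
  have h : Matrix.det (evalNilpotent n f
      ((Complex.I / (4 * Real.pi)) • curvature e (tangentC g e) x)) =
      Matrix.det (evalNilpotent n f ((1 / 2 : ℂ) • chernMatrix g e x)) := by
    rw [chernMatrix, smul_smul, show (1 / 2 : ℂ) * (Complex.I / (2 * Real.pi)) =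
      Complex.I / (4 * Real.pi) by ring, ← curvature_tangentC]; rfl
  have h0 : ((1 / 2 : ℂ) • chernMatrix g e x) ^ (n + 1) = 0 := by
    rw [smul_pow, chernMatrix_pow, smul_zero]
  rw [h, evalNilpotent_eq_nilEval n _ h0, chernEval, nilEval_map_algebraMap,
    nilEval_rescale n _ (chernMatrix_pow g e x) _ h0]

theorem aHatForm_sq (x : M) : aHatForm g e x ^ 2 * (chernEval g e x sinhHalf).det = 1 ∧
    constantTermHom (aHatForm g e x) = 1 := by
  have hc : constantTermHom (chernEval g e x (PowerSeries.rescale (1 / 2) aHatSeries)).det =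
      ((1 : ℝ) : ℂ) := by
    rw [constantTermHom_det_chernEval, ← PowerSeries.coeff_zero_eq_constantCoeff_apply,
      PowerSeries.coeff_rescale, aHatSeries, PowerSeries.coeff_zero_eq_constantCoeff_apply,
      PowerSeries.constantCoeff_inv, constantCoeff_sinhDivSeries]
    simp
  have h := sqrtForm_sq (finrank_covector x).le one_pos hc
  rw [aHatForm, det_evalNilpotent_half]
  refine ⟨?_, by rw [h.2, Real.sqrt_one, Complex.ofReal_one]⟩
  rw [h.1, chernEval, chernEval, ← Matrix.det_mul, ← map_mul, ← map_mul, rescale_aHatSeries_mul,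
    map_one, map_one, Matrix.det_one]

end Geometry

theorem lHatForm_sq {k : ℕ} {M : Type*} [TopologicalSpace M]
    [ChartedSpace (EuclideanSpace ℝ (Fin (8 * k + 4))) M] [IsManifold (𝓡 (8 * k + 4)) ∞ M]
    (g : RiemannianMetricOn (8 * k + 4) M)
    (e : OpenPartialHomeomorph M (EuclideanSpace ℝ (Fin (8 * k + 4)))) (x : M) :
    lHatForm g e x ^ 2 = (chernEval g e x (PowerSeries.rescale (1 / 2) lHatSeries)).det ∧
      constantTermHom (lHatForm g e x) = 2 ^ (4 * k + 2) := by
  have hc : constantTermHom (chernEval g e x (PowerSeries.rescale (1 / 2) lHatSeries)).det =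
      ((2 ^ (8 * k + 4) : ℝ) : ℂ) := by
    have hcosh : PowerSeries.constantCoeff coshSeries = 1 := by
      rw [← PowerSeries.coeff_zero_eq_constantCoeff_apply, coshSeries, PowerSeries.coeff_mk]; simp
    rw [constantTermHom_det_chernEval, ← PowerSeries.coeff_zero_eq_constantCoeff_apply,
      PowerSeries.coeff_rescale, lHatSeries, PowerSeries.coeff_zero_eq_constantCoeff_apply,
      map_mul, map_mul, PowerSeries.constantCoeff_inv, constantCoeff_sinhDivSeries, hcosh]
    simp
  have h := sqrtForm_sq (finrank_covector x).le (by positivity : (0 : ℝ) < 2 ^ (8 * k + 4)) hc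
  rw [lHatForm, det_evalNilpotent_half]
  refine ⟨h.1, ?_⟩
  rw [h.2, show (2 : ℝ) ^ (8 * k + 4) = (2 ^ (4 * k + 2)) ^ 2 by rw [← pow_mul]; congr 1; ring,
    Real.sqrt_sq (by positivity)]
  push_cast; rfl

/-! ### The comparison in top degree -/

section DualNumbers

variable {S : Type*} [CommRing S] [Algebra ℂ S]

/-- The numbers 24 and -16 are the logarithmic derivatives of 2 + 48η and 1/16 - η at η = 0. -/
theorem pow_mul_pow_of_sq_eq_zero (η : S) (hη : η ^ 2 = 0) (i j : ℕ) :
    (2 + 48 * η) ^ i * (algebraMap ℂ S (1 / 16) - η) ^ j =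
      algebraMap ℂ S (2 ^ i * (1 / 16) ^ j) +
        algebraMap ℂ S (2 ^ i * (1 / 16) ^ j * (24 * i - 16 * j)) * η := by
  have h16 : 16 * algebraMap ℂ S (1 / 16) = 1 := by
    rw [← map_ofNat (algebraMap ℂ S) 16, ← map_mul]; norm_num
  have h1 : (2 + 48 * η) ^ i = 2 ^ i * (1 + 24 * i * η) := by
    induction i with
    | zero => simp
    | succ i ih =>
      rw [pow_succ, ih]
      push_cast
      linear_combination 2 ^ i * 1152 * i * hη
  have h2 : (algebraMap ℂ S (1 / 16) - η) ^ j = algebraMap ℂ S (1 / 16) ^ j * (1 - 16 * j * η) := by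
    induction j with
    | zero => simp
    | succ j ih =>
      rw [pow_succ, ih]
      push_cast
      linear_combination algebraMap ℂ S (1 / 16) ^ j * 16 * j * hη +
        algebraMap ℂ S (1 / 16) ^ j * η * h16
  rw [h1, h2]
  simp only [map_mul, map_sub, map_pow, map_ofNat, map_natCast]
  linear_combination -(2 ^ i * algebraMap ℂ S (1 / 16) ^ j * 384 * i * j) * hη

end DualNumbers

theorem isLocalHom_fst {E : Type*} [CommRing E] (π : E →+* ℂ) [IsLocalHom π] :
    IsLocalHom (π.comp (TrivSqZeroExt.fstHom E E E).toRingHom) :=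
  ⟨fun _ hx => TrivSqZeroExt.isUnit_iff_isUnit_fst.2 (IsUnit.of_map π _ hx)⟩

/-- The bracket carries the factor 12(2k+1-2r) - 8r + (8k+4) - 16 = 32(k-r), and the powers of 2 add
up to 4k + 2 + (2k+1-2r) - 4r + 5 = 14 + 6(k-r-1). -/
theorem top_coefficient_eq {k r : ℕ} (hr : r ≤ k) :
    (2 : ℂ) ^ (4 * k + 2) * ((2 : ℂ) ^ (2 * k + 1 - 2 * r) * (1 / 16) ^ r *
        (24 * (2 * k + 1 - 2 * r : ℕ) - 16 * r) / 2 +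
      ((8 * k + 4) - 16) * (2 ^ (2 * k + 1 - 2 * r) * (1 / 16) ^ r)) =
    2 ^ 14 * (((k - r) * 2 ^ (6 * (k - r - 1)) : ℕ) : ℂ) := by
  obtain ⟨d, rfl⟩ := Nat.exists_eq_add_of_le hr
  rw [show 2 * (r + d) + 1 - 2 * r = 2 * d + 1 by omega, Nat.add_sub_cancel_left]
  -- For r = k the exponent k - r - 1 is truncated, but the factor k - r vanishes.
  rcases d with _ | d
  · push_cast; ring
  · have h16 : (2 : ℂ) ^ (4 * r) * (1 / 16) ^ r = 1 := by
      rw [pow_mul, ← mul_pow]; norm_num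
    rw [Nat.add_sub_cancel, show 4 * (r + (d + 1)) + 2 = 4 * r + (4 * d + 6) by ring, pow_add]
    push_cast
    linear_combination 2 ^ (4 * d + 6) * 2 ^ (2 * d + 3) * 32 * (d + 1) * h16

section TopDegree

variable {E : Type} [CommRing E] [Algebra ℂ E]

theorem fst_smul_add_smul_eps (a b : ℂ) : TrivSqZeroExt.fst
    (algebraMap ℂ (DualNumber E) a + algebraMap ℂ (DualNumber E) b * DualNumber.eps) =
      algebraMap ℂ E a := by
  rw [TrivSqZeroExt.fst_add, TrivSqZeroExt.fst_mul, DualNumber.fst_eps, mul_zero, add_zero]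
  rfl

theorem snd_smul_add_smul_eps (a b : ℂ) : TrivSqZeroExt.snd
    (algebraMap ℂ (DualNumber E) a + algebraMap ℂ (DualNumber E) b * DualNumber.eps) =
      algebraMap ℂ E b := by
  rw [IsScalarTower.algebraMap_apply ℂ E (DualNumber E) a,
    IsScalarTower.algebraMap_apply ℂ E (DualNumber E) b, ← Algebra.smul_def,
    TrivSqZeroExt.snd_add, TrivSqZeroExt.snd_smul, DualNumber.snd_eps, smul_eq_mul, mul_one]
  exact zero_add _

variable [IsAddTorsionFree E]

/-- The expansions in top degree of the twisted Â-forms and of the L-forms in terms of a common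
family. -/
theorem exists_top_expansion (𝒢 : ℕ → Submodule ℂ E) [SetLike.GradedMonoid 𝒢] (k : ℕ)
    (F : Matrix (Fin (8 * k + 4)) (Fin (8 * k + 4)) E) (N : ℕ) (hF : F ^ (N + 1) = 0)
    (h2 : ∀ i j, F i j ∈ 𝒢 2) (G : Matrix (Fin (8 * k + 4)) (Fin (8 * k + 4)) E) (hG : IsUnit G)
    (hskew : F.transpose * G + G * F = 0) (π : E →ₐ[ℂ] ℂ) [IsLocalHom π.toRingHom] (a ℓ : E)
    (ha : a ^ 2 * (nilEval N F hF (PowerSeries.map (algebraMap ℂ E) sinhHalf)).det = 1)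
    (hπa : π a = 1)
    (hℓ : ℓ ^ 2 = (nilEval N F hF (PowerSeries.map (algebraMap ℂ E)
      (PowerSeries.rescale (1 / 2) lHatSeries))).det)
    (hπℓ : π ℓ = 2 ^ (4 * k + 2)) {V : Type*} [AddCommGroup V] [Module ℂ V] (L : E →ₗ[ℂ] V)
    (hL : ∀ d, d ≠ 8 * k + 4 → ∀ x ∈ 𝒢 d, L x = 0) : ∃ α : ℕ → V,
      (∀ j, L (a * virtualTrace (nilEval N F hF (PowerSeries.map (algebraMap ℂ E)
        (PowerSeries.exp ℂ))) (bundleB (8 * k + 4) j)) =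
          ∑ s ∈ Finset.range (k + 1), basisCoeff k j s • α s) ∧
      L ℓ = (2 : ℂ) ^ (4 * k + 2) •
        ∑ r ∈ Finset.range (k + 1), ((2 : ℂ) ^ (2 * k + 1 - 2 * r) * (1 / 16) ^ r) • α r ∧
      L (2 * (ℓ * ((nilEval N F hF (PowerSeries.map (algebraMap ℂ E) (PowerSeries.exp ℂ))).trace -
          (8 * k + 4 : ℕ)))) =
        (2 : ℂ) ^ (4 * k + 2) • ∑ r ∈ Finset.range (k + 1), ((2 : ℂ) ^ (2 * k + 1 - 2 * r) *
          (1 / 16) ^ r * (24 * (2 * k + 1 - 2 * r : ℕ) - 16 * r)) • α r := by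
  -- The same Φ is evaluated at the theta point and at the hyperbolic point; its top coefficients
  -- are the common family α.
  obtain ⟨Φ, hΦ, hnil, hΦ4⟩ := exists_solutionRoot 𝒢 N F hF h2
  have h1 := theta_character N F hF G hG hskew a ha π.toRingHom hπa Φ hnil hΦ4
  have hε : (DualNumber.eps : DualNumber E) ^ 2 = 0 := by rw [sq, DualNumber.eps_mul_eps]
  have hloc := isLocalHom_fst π.toRingHom
  have h3 := tanh_character N F hF G hG hskew ℓ hℓ (DualNumber.eps : DualNumber E) hε
    (π.toRingHom.comp (TrivSqZeroExt.fstHom E E E).toRingHom) (2 ^ (4 * k + 2))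
    (by rw [show (4 : ℂ) = 2 ^ 2 by norm_num, ← pow_mul, ← pow_mul]; congr 1; ring)
    (hπℓ.trans (π.commutes _).symm) Φ hnil hΦ4
  set ch := (nilEval N F hF (PowerSeries.map (algebraMap ℂ E) (PowerSeries.exp ℂ))).trace
  rw [← Algebra.smul_def (2 ^ (4 * k + 2) : ℂ)] at h3
  -- The two components of the dual number identity: L̂ itself, and 2 L̂ (ch - (8k+4)) as
  -- coefficient of ε.
  have hfst := congrArg TrivSqZeroExt.fst h3
  have hsnd := congrArg TrivSqZeroExt.snd h3
  have e1 : algebraMap E (DualNumber E) ℓ *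
      (1 + 2 * DualNumber.eps * algebraMap E (DualNumber E) (ch - (8 * k + 4 : ℕ))) =
      TrivSqZeroExt.inl ℓ + TrivSqZeroExt.inr (2 * (ℓ * (ch - (8 * k + 4 : ℕ)))) := by
    rw [DualNumber.inr_eq_smul_eps, Algebra.smul_def, map_mul, map_mul, map_ofNat]
    change algebraMap E (DualNumber E) ℓ * _ = algebraMap E (DualNumber E) ℓ + _
    ring
  rw [e1, TrivSqZeroExt.fst_smul, TrivSqZeroExt.fst_add, TrivSqZeroExt.fst_inl,
    TrivSqZeroExt.fst_inr, add_zero] at hfst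
  rw [e1, TrivSqZeroExt.snd_smul, TrivSqZeroExt.snd_add, TrivSqZeroExt.snd_inl,
    TrivSqZeroExt.snd_inr, zero_add] at hsnd
  refine ⟨fun r => L (MvPolynomial.coeff (weightIndex k r) Φ), fun j => ?_, ?_, ?_⟩
  · have h4 := linear_aeval_diagonal 𝒢 k L hL
      (PowerSeries.map (Int.castRingHom E) eightDeltaTwo)
      (PowerSeries.map (Int.castRingHom E) epsilonTwo) (PowerSeries.coeff j)
      (fun a b => ((PowerSeries.coeff j (eightDeltaTwo ^ a * epsilonTwo ^ b) : ℤ) : ℂ))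
      (fun a b => by
        rw [← map_pow, ← map_pow, ← map_mul, PowerSeries.coeff_map, map_intCast]; rfl) hΦ
    rw [← h1, PowerSeries.coeff_C_mul, PowerSeries.coeff_map] at h4
    simp only [Int.cast_smul_eq_zsmul] at h4
    exact h4
  · have h4 := linear_aeval_diagonal 𝒢 k L hL (2 + 48 * DualNumber.eps)
      (algebraMap ℂ (DualNumber E) (1 / 16) - DualNumber.eps)
      (TrivSqZeroExt.fstHom E E E).toLinearMap (fun a b => 2 ^ a * (1 / 16) ^ b)
      (fun a b => by
        rw [pow_mul_pow_of_sq_eq_zero _ hε]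
        exact fst_smul_add_smul_eps _ _) hΦ
    rw [hfst, map_smul, ← h4]
    rfl
  · have h4 := linear_aeval_diagonal 𝒢 k L hL (2 + 48 * DualNumber.eps)
      (algebraMap ℂ (DualNumber E) (1 / 16) - DualNumber.eps)
      (TrivSqZeroExt.sndHom E E) (fun a b => 2 ^ a * (1 / 16) ^ b * (24 * a - 16 * b))
      (fun a b => by
        rw [pow_mul_pow_of_sq_eq_zero _ hε]
        exact snd_smul_add_smul_eps _ _) hΦ
    rw [hsnd, map_smul, ← h4]
    rfl

/-- The comparison of the twisted L-form with the twisted Â-forms in top degree. -/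
theorem top_degree_twisted (𝒢 : ℕ → Submodule ℂ E) [SetLike.GradedMonoid 𝒢] (k : ℕ)
    (F : Matrix (Fin (8 * k + 4)) (Fin (8 * k + 4)) E) (N : ℕ) (hF : F ^ (N + 1) = 0)
    (h2 : ∀ i j, F i j ∈ 𝒢 2) (G : Matrix (Fin (8 * k + 4)) (Fin (8 * k + 4)) E) (hG : IsUnit G)
    (hskew : F.transpose * G + G * F = 0) (π : E →ₐ[ℂ] ℂ) [IsLocalHom π.toRingHom] (a ℓ : E)
    (ha : a ^ 2 * (nilEval N F hF (PowerSeries.map (algebraMap ℂ E) sinhHalf)).det = 1)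
    (hπa : π a = 1)
    (hℓ : ℓ ^ 2 = (nilEval N F hF (PowerSeries.map (algebraMap ℂ E)
      (PowerSeries.rescale (1 / 2) lHatSeries))).det)
    (hπℓ : π ℓ = 2 ^ (4 * k + 2)) {V : Type*} [AddCommGroup V] [Module ℂ V] (L : E →ₗ[ℂ] V)
    (hL : ∀ d, d ≠ 8 * k + 4 → ∀ x ∈ 𝒢 d, L x = 0) :
    L (ℓ * (nilEval N F hF (PowerSeries.map (algebraMap ℂ E) (PowerSeries.exp ℂ))).trace -
        (16 : ℂ) • ℓ) =
      (2 : ℂ) ^ 14 • ∑ r ∈ Finset.range k, (((k - r) * 2 ^ (6 * (k - r - 1)) : ℕ) : ℂ) •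
        L (a * virtualTrace (nilEval N F hF (PowerSeries.map (algebraMap ℂ E)
          (PowerSeries.exp ℂ))) (bundleb k r)) := by
  obtain ⟨α, h1, h3, h4⟩ := exists_top_expansion 𝒢 k F N hF h2 G hG hskew π a ℓ ha hπa hℓ hπℓ L hL
  set B := nilEval N F hF (PowerSeries.map (algebraMap ℂ E) (PowerSeries.exp ℂ))
  -- The expansion of the twisted Â-forms in powers of 8δ₂ and ε₂ is inverted by the recursion
  -- defining b_r.
  have hα : ∀ r ≤ k, L (a * virtualTrace B (bundleb k r)) = α r := fun r hr => by
    rw [← sum_coeffB_smul k _ _ (fun j _ => h1 j) hr, bundleb, map_sum, Finset.mul_sum, map_sum]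
    refine Finset.sum_congr rfl fun j _ => ?_
    rw [map_zsmul, mul_smul_comm, map_zsmul]
  -- The left-hand side is split into the two forms with known expansions: half of the ε-component
  -- and a multiple of L̂.
  have e1 : ℓ * B.trace - (16 : ℂ) • ℓ =
      (1 / 2 : ℂ) • (2 * (ℓ * (B.trace - (8 * k + 4 : ℕ)))) + ((8 * k + 4 : ℂ) - 16) • ℓ := by
    have hh : algebraMap ℂ E (1 / 2) * 2 = 1 := by
      rw [← map_ofNat (algebraMap ℂ E) 2, ← map_mul]; norm_num
    simp only [Algebra.smul_def, map_sub, map_add, map_mul, map_natCast, map_ofNat]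
    push_cast
    linear_combination -(ℓ * (B.trace - (8 * k + 4))) * hh
  rw [e1, map_add, map_smul, map_smul, h3, h4, smul_smul, smul_smul,
    Finset.smul_sum, Finset.smul_sum, ← Finset.sum_add_distrib, Finset.smul_sum]
  have e2 : ∀ r ∈ Finset.range (k + 1), (1 / 2 * (2 : ℂ) ^ (4 * k + 2)) •
      ((2 : ℂ) ^ (2 * k + 1 - 2 * r) * (1 / 16) ^ r *
        (24 * (2 * k + 1 - 2 * r : ℕ) - 16 * r)) • α r +
      (((8 * k + 4 : ℂ) - 16) * (2 : ℂ) ^ (4 * k + 2)) •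
        ((2 : ℂ) ^ (2 * k + 1 - 2 * r) * (1 / 16) ^ r) • α r =
      (2 : ℂ) ^ 14 • (((k - r) * 2 ^ (6 * (k - r - 1)) : ℕ) : ℂ) •
        L (a * virtualTrace B (bundleb k r)) := by
    intro r hr
    have hr' : r ≤ k := by simpa [Nat.lt_succ_iff] using hr
    rw [hα r hr', smul_smul, smul_smul, smul_smul, ← add_smul, ← top_coefficient_eq hr']
    congr 1
    ring
  -- The term r = k carries the factor k - r = 0, so h_k drops out.
  rw [Finset.sum_congr rfl e2, Finset.sum_range_succ, Nat.sub_self, zero_mul, Nat.cast_zero,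
    zero_smul, smul_zero, add_zero]

theorem bundleb_zero (k : ℕ) : bundleb k 0 = -1 := by
  rw [bundleb, zero_add, Finset.sum_range_one, coeffB_zero_zero, bundleB_zero, neg_one_smul]

/-- In dimension 20, b₁ = 120 B₀ - B₁ with B₁ = 20 - T_ℂM. -/
theorem virtualTrace_bundleb_two_one (B : Matrix (Fin (8 * 2 + 4)) (Fin (8 * 2 + 4)) E) :
    virtualTrace B (bundleb 2 1) = B.trace + (100 : ℂ) • (1 : E) := by
  rw [bundleb, Finset.sum_range_succ, Finset.sum_range_one, coeffB_two_one_zero, coeffB_one_one,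
    bundleB_zero, map_add, map_zsmul, map_zsmul, map_one, virtualTrace_bundleB_one,
    Algebra.smul_def (100 : ℂ), map_ofNat (algebraMap ℂ E) 100]
  simp only [zsmul_eq_mul]
  push_cast
  ring

end TopDegree

/-- In dimension 20 the term r = 0 contributes 2 · 2⁶ h₀ = -128 Â, which turns the 100 of b₁ into
-28. -/
theorem degreePart_add_smul {W : Type*} [AddCommGroup W] [Module ℂ W] (d : ℕ) (η τ : EvenForms W) :
    degreePart d (η + (100 : ℂ) • τ) =
      degreePart d (η - (28 : ℂ) • τ) + (128 : ℂ) • degreePart d τ := by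
  have h : η + (100 : ℂ) • τ = (η - (28 : ℂ) • τ) + (128 : ℂ) • τ := by module
  rw [h]
  exact ((degreePartLinear d).map_add _ _).trans
    (congrArg _ ((degreePartLinear d).map_smul _ _))

theorem smul_neg_add_smul_eq {V : Type*} [AddCommGroup V] [Module ℂ V] (v w : V) :
    (((2 - 0) * 2 ^ (6 * (2 - 0 - 1)) : ℕ) : ℂ) • -v +
      (((2 - 1) * 2 ^ (6 * (2 - 1 - 1)) : ℕ) : ℂ) • (w + (128 : ℂ) • v) = w := by
  norm_num

/-! ### The twisted L-form -/

section TopForms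

variable {k : ℕ} {M : Type*} [TopologicalSpace M]
  [ChartedSpace (EuclideanSpace ℝ (Fin (8 * k + 4))) M] [IsManifold (𝓡 (8 * k + 4)) ∞ M]
  (g : RiemannianMetricOn (8 * k + 4) M)
  (e : OpenPartialHomeomorph M (EuclideanSpace ℝ (Fin (8 * k + 4))))

theorem degreePart_twisted_lHatForm (he : e ∈ IsManifold.maximalAtlas (𝓡 (8 * k + 4)) ∞ M) {x : M}
    (hx : x ∈ e.source) : degreePart (8 * k + 4) (lHatForm g e x * chTangent g e x
          - (16 : ℂ) • lHatForm g e x) =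
      (2 : ℂ) ^ 14 • ∑ r ∈ Finset.range k,
        (((k - r) * 2 ^ (6 * (k - r - 1)) : ℕ) : ℂ) • hForm k r g e x := by
  have hloc := isLocalHom_constantTermHom (W := Covector (8 * k + 4) x)
  have h := top_degree_twisted (evenGrading (Covector (8 * k + 4) x)) k
    (chernMatrix g e x) (8 * k + 4) (chernMatrix_pow g e x) (chernMatrix_mem g e x) _
    (isUnit_metricForm g e he hx) (chernMatrix_skew g e he hx) constantTermHom _ _
    (aHatForm_sq g e x).1 (aHatForm_sq g e x).2 (lHatForm_sq g e x).1 (lHatForm_sq g e x).2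
    (degreePartLinear (8 * k + 4)) (fun d hd η hη => degreePartLinear_eq_zero hd hη)
  simp only [hForm, chVirtual_eq g e he hx, chTangent_eq]
  exact h

theorem hForm_zero (he : e ∈ IsManifold.maximalAtlas (𝓡 (8 * k + 4)) ∞ M) {x : M}
    (hx : x ∈ e.source) : hForm k 0 g e x = -degreePart (8 * k + 4) (aHatForm g e x) := by
  rw [hForm, chVirtual_eq g e he hx, bundleb_zero, map_neg, map_one, mul_neg, mul_one]
  exact map_neg (degreePartLinear (8 * k + 4)) _

end TopForms

theorem hForm_two_one {M : Type*} [TopologicalSpace M]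
    [ChartedSpace (EuclideanSpace ℝ (Fin (8 * 2 + 4))) M] [IsManifold (𝓡 (8 * 2 + 4)) ∞ M]
    (g : RiemannianMetricOn (8 * 2 + 4) M)
    (e : OpenPartialHomeomorph M (EuclideanSpace ℝ (Fin (8 * 2 + 4))))
    (he : e ∈ IsManifold.maximalAtlas (𝓡 (8 * 2 + 4)) ∞ M) {x : M} (hx : x ∈ e.source) :
    hForm 2 1 g e x = degreePart (8 * 2 + 4) (aHatForm g e x * chTangent g e x +
      (100 : ℂ) • aHatForm g e x) := by
  rw [hForm, chVirtual_eq g e he hx, chTangent_eq, virtualTrace_bundleb_two_one, mul_add,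
    mul_smul_comm, mul_one]

theorem sum_hForm_two {M : Type*} [TopologicalSpace M]
    [ChartedSpace (EuclideanSpace ℝ (Fin (8 * 2 + 4))) M] [IsManifold (𝓡 (8 * 2 + 4)) ∞ M]
    (g : RiemannianMetricOn (8 * 2 + 4) M)
    (e : OpenPartialHomeomorph M (EuclideanSpace ℝ (Fin (8 * 2 + 4))))
    (he : e ∈ IsManifold.maximalAtlas (𝓡 (8 * 2 + 4)) ∞ M) {x : M} (hx : x ∈ e.source) :
    ∑ r ∈ Finset.range 2, (((2 - r) * 2 ^ (6 * (2 - r - 1)) : ℕ) : ℂ) • hForm 2 r g e x =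
      degreePart (8 * 2 + 4) (aHatForm g e x * chTangent g e x - (28 : ℂ) • aHatForm g e x) := by
  rw [Finset.sum_range_succ, Finset.sum_range_one, hForm_zero g e he hx, hForm_two_one g e he hx,
    degreePart_add_smul]
  exact smul_neg_add_smul_eq _ _

end TwistedAnomaly

end

theorem theorem2p1 (k : ℕ) {M : Type*} [TopologicalSpace M]
    [ChartedSpace (EuclideanSpace ℝ (Fin (8 * k + 4))) M] [IsManifold (𝓡 (8 * k + 4)) ∞ M]
    (g : TwistedAnomaly.RiemannianMetricOn (8 * k + 4) M)
    (e : OpenPartialHomeomorph M (EuclideanSpace ℝ (Fin (8 * k + 4))))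
    (he : e ∈ IsManifold.maximalAtlas (𝓡 (8 * k + 4)) ∞ M) (x : M) (hx : x ∈ e.source) :
    TwistedAnomaly.degreePart (8 * k + 4)
        (TwistedAnomaly.lHatForm g e x * TwistedAnomaly.chTangent g e x
          - (16 : ℂ) • TwistedAnomaly.lHatForm g e x) =
      (2 : ℂ) ^ 14 • ∑ r ∈ Finset.range k,
        (((k - r) * 2 ^ (6 * (k - r - 1)) : ℕ) : ℂ) • TwistedAnomaly.hForm k r g e x
    ∧ (k = 0 → TwistedAnomaly.degreePart (8 * k + 4)
        (TwistedAnomaly.lHatForm g e x * TwistedAnomaly.chTangent g e x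
          - (16 : ℂ) • TwistedAnomaly.lHatForm g e x) = 0)
    ∧ (k = 1 → TwistedAnomaly.degreePart (8 * k + 4)
        (TwistedAnomaly.lHatForm g e x * TwistedAnomaly.chTangent g e x
          - (16 : ℂ) • TwistedAnomaly.lHatForm g e x) =
      -((2 : ℂ) ^ 14 • TwistedAnomaly.degreePart (8 * k + 4) (TwistedAnomaly.aHatForm g e x)))
    ∧ (k = 2 → TwistedAnomaly.degreePart (8 * k + 4)
        (TwistedAnomaly.lHatForm g e x * TwistedAnomaly.chTangent g e x
          - (16 : ℂ) • TwistedAnomaly.lHatForm g e x) =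
      (2 : ℂ) ^ 14 • TwistedAnomaly.degreePart (8 * k + 4)
        (TwistedAnomaly.aHatForm g e x * TwistedAnomaly.chTangent g e x
          - (28 : ℂ) • TwistedAnomaly.aHatForm g e x)) := by
  have main := TwistedAnomaly.degreePart_twisted_lHatForm g e he hx
  refine ⟨main, ?_, ?_, ?_⟩
  · rintro rfl
    rw [main, Finset.sum_range_zero, smul_zero]
  · rintro rfl
    rw [main, Finset.sum_range_one, TwistedAnomaly.hForm_zero g e he hx]
    simp
  · rintro rfl
    rw [main, TwistedAnomaly.sum_hForm_two g e he hx]
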